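/- **Setting.** Let $\alpha<0$. Let $\mathcal S$ be the set of sequences $s_1\ge s_2\ge\dots\ge 0$ with $\sum_i s_i<\infty$, with the $\ell_1$-distance, let $\mathcal S_1=\{\mathbf s\in\mathcal S:\sum_i s_i=1\}$, $\mathbf 1=(1,0,0,\dots)$ and $\mathbf 0=(0,0,\dots)$, and let $\nu$ be a probability measure on $\mathcal S_1$ with $\nu(\{\mathbf 1\})=0$. Let $F$ be the fragmentation process with index $\alpha$ and dislocation measure $\nu$ started from $\mathbf 1$, together with its genealogy: the blocks evolve independently, and a block of mass $m>0$ lives for an exponential time of mean $m^{-\alpha}$ and then splits into blocks of masses $m\mathbf S$, where $\mathbf S$ has law $\nu$. The state $F(t)$ is the decreasing rearrangement (written $\{\cdot\}^{\downarrow}$, padded with zeros) of the masses of the blocks present at time $t$. Let $\zeta=\inf\{t\ge0:F(t)=\mathbf 0\}$, which is a.s. finite. Almost surely, for each $t<\zeta$ exactly one block present at time $t$ is the last to be reduced to dust, i.e. has descendants up to time $\zeta$. Let $F_*(t)$ be the mass of that block, and $F_*(t)=0$ for $t\ge\zeta$. Let $T_0=0$ and $T_n=\inf\{t\ge T_{n-1}:F_*(t)<F_*(T_{n-1})\}$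 for $n\ge1$. Put $Z_n=F_*(T_n)^\alpha(\zeta-T_n)$ for $n\ge 0$, $\Theta_0=1$, $\mathbf\Delta_0=\mathbf 0$, $Y_0=\zeta^{1/\alpha}$ and, for $n\ge1$, $\Theta_n=F_*(T_n)/F_*(T_{n-1})$ and $Y_n=\big((\zeta-T_n)/(\zeta-T_{n-1})\big)^{1/\alpha}$; let $\mathbf\Delta_n=(\Delta_{n,1}\ge\Delta_{n,2}\ge\dots)$ be the masses, divided by $F_*(T_{n-1})$, of the other sub-blocks produced by the split of the last fragment at time $T_n$. For $\epsilon>0$ let $N_\epsilon=\sup\{n\ge0:T_n\le\zeta-\epsilon\}$, with $\sup\emptyset=-\infty$, and, when $N_\epsilon\ne-\infty$, let $R_\epsilon(k)=\epsilon^{-1}\prod_{j=0}^{N_\epsilon+k}Y_j^\alpha$ for integers $k\ge-N_\epsilon$. For $x\in(0,\infty)$, denote by $\bar F^{(x)}$ the time-reversal of a fragmentation conditioned to become extinct before time $x$: it has làdcàg (left-continuous with right limits) paths in $\mathcal S$, with $\bar F^{(x)}(0)=\mathbf 0$ and $\bar F^{(x)}(x)=\mathbf 1$, and $(\bar F^{(x)}(t),t\ge0)$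 has the law of $\big(F(x-t)\,\mathbb 1_{\{t\le x\}},\,t\ge0\big)$ conditional on $\zeta<x$ (so that $\bar F^{(x)}(t)=\mathbf 0$ for $t>x$). **Proposition (spine decomposition).** Fix $\epsilon>0$. The sequence $(Z_n,\Theta_n,\mathbf\Delta_n)_{n\ge0}$ is a random variable, and almost surely $N_\epsilon<\infty$, and $N_\epsilon\ne-\infty$ if and only if $\epsilon\le\zeta$. There is a collection of processes $\bar F_{i,m}$, $i\in\mathbb Z$, $m\ge1$, defined on the same probability space as $F$, with the following two properties. 1. Consider the indices with $N_\epsilon\neq-\infty$, $i\ge-N_\epsilon+1$ and $\Delta_{N_\epsilon+i,m}>0$. Conditionally on $(Z_n,\Theta_n,\mathbf\Delta_n)_{n\ge0}$, the corresponding processes $\bar F_{i,m}$ are independent, and $\bar F_{i,m}$ is distributed as $\bar F^{(x)}$ with $x=\Delta_{N_\epsilon+i,m}^{\alpha}\,\Theta_{N_\epsilon+i}^{-\alpha}\,Z_{N_\epsilon+i}$; we therefore write it $\bar F_{i,m}^{(\Delta_{N_\epsilon+i,m}^{\alpha}\Theta_{N_\epsilon+i}^{-\alpha}Z_{N_\epsilon+i})}$.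 2. Almost surely on the event $\{N_\epsilon\ne-\infty\}=\{\epsilon\le\zeta\}$, for every $t$ with $0<t\le\zeta/\epsilon$ there is a unique integer $k\ge-N_\epsilon$ with $R_\epsilon(k)\ge t>R_\epsilon(k+1)$, and $$F(\zeta-\epsilon t)=\Big\{\prod_{j=0}^{N_\epsilon+k}\Theta_j,\ \Big(\prod_{j=0}^{N_\epsilon+i-1}\Theta_j\Big)\Delta_{N_\epsilon+i,m}\,\bar F_{i,m}^{(\Delta_{N_\epsilon+i,m}^{\alpha}\Theta_{N_\epsilon+i}^{-\alpha}Z_{N_\epsilon+i})}\Big(t\,\epsilon\Big(\prod_{j=0}^{N_\epsilon+i-1}\Theta_j\Big)^{\alpha}\Delta_{N_\epsilon+i,m}^{\alpha}\Big):\ m\ge1,\ -N_\epsilon+1\le i\le k\Big\}^{\downarrow},$$ where a term with $\Delta_{N_\epsilon+i,m}=0$ is read as $\mathbf 0$. -/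

import Mathlib

open MeasureTheory ProbabilityTheory Filter Topology
open scoped NNReal ENNReal

noncomputable section

namespace Fragmentation

/-! ### Mass sequences -/

/-- `s` belongs to the state space of the fragmentation: a non-increasing, non-negative, summable
sequence. Sequences are indexed from `0`, so that `s 0` is the largest mass. -/
def IsMassSeq (s : ℕ → ℝ) : Prop :=
  Antitone s ∧ (∀ i, 0 ≤ s i) ∧ Summable s

/-- The mass sequences of total mass one. Its σ-algebra is the one generated by the coordinates,
which on summable sequences is the Borel σ-algebra of the `ℓ¹`-distance. -/
abbrev UnitMassSeq : Type := {s : ℕ → ℝ // IsMassSeq s ∧ ∑' i, s i = 1}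

/-- The state `(1, 0, 0, …)`. -/
def oneState : ℕ → ℝ := Pi.single 0 1

/-- The `ℓ¹`-distance. -/
def l1Dist (s s' : ℕ → ℝ) : ℝ := ∑' i, |s i - s' i|

/-- The decreasing rearrangement of a family of non-negative numbers (of which only finitely many
exceed any given positive level), padded with zeros: its term of index `k` is the smallest level
`y ≥ 0` that is exceeded by at most `k` members of the family. -/
def decRearr {ι : Type*} (a : ι → ℝ) (k : ℕ) : ℝ :=
  sInf {y : ℝ | 0 ≤ y ∧ {i | y < a i}.encard ≤ (k : ℕ∞)}

/-! ### The fragmentation, with its genealogy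

Blocks are labelled by finite words of natural numbers; the `i`-th sub-block of block `u` is
`i :: u`, so that `v` descends from `u` (or is `u`) exactly when `u` is a suffix of `v`.
Block `u` carries a standard exponential clock `(x u).1` and the sequence `(x u).2` of the
relative masses of its sub-blocks. -/

/-- A realization of all clocks and all dislocations. -/
abbrev Realization : Type := List ℕ → ℝ × UnitMassSeq

/-- The mass of a block. -/
def mass (x : Realization) : List ℕ → ℝ
  | [] => 1
  | i :: u => mass x u * ((x u).2 : ℕ → ℝ) i

/-- The time at which a block appears: the block `u` lives for a time `m ^ (-α)` times its clock,
`m` being its mass, and is then replaced by its sub-blocks. -/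
def birth (α : ℝ) (x : Realization) : List ℕ → ℝ
  | [] => 0
  | _ :: u => birth α x u + mass x u ^ (-α) * (x u).1

/-- The time at which a block splits. -/
def death (α : ℝ) (x : Realization) (u : List ℕ) : ℝ :=
  birth α x u + mass x u ^ (-α) * (x u).1

/-- The block `u` is present at time `t`. -/
def Alive (α : ℝ) (x : Realization) (t : ℝ) (u : List ℕ) : Prop :=
  0 < mass x u ∧ birth α x u ≤ t ∧ t < death α x u

/-- The state `F(t)` of the fragmentation started from `(1, 0, …)`. -/
def frag (α : ℝ) (x : Realization) (t : ℝ) : ℕ → ℝ :=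
  decRearr fun u : {u // Alive α x t u} => mass x u

/-- The extinction time `ζ`. -/
def extinction (α : ℝ) (x : Realization) : ℝ :=
  sInf {t | 0 ≤ t ∧ frag α x t = 0}

/-- The state, at time `t + s`, of the fragmentation of the block `u` present at time `t`. -/
def subFrag (α : ℝ) (x : Realization) (t : ℝ) (u : List ℕ) (s : ℝ) : ℕ → ℝ :=
  decRearr fun v : {v // u <:+ v ∧ Alive α x (t + s) v} => mass x v

/-- The time, counted from `t`, at which the block `u` present at time `t` is reduced to dust. -/
def subExtinction (α : ℝ) (x : Realization) (t : ℝ) (u : List ℕ) : ℝ :=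
  sInf {s | 0 ≤ s ∧ subFrag α x t u s = 0}

/-! ### The last fragment and its Markov chain -/

/-- Among the blocks present at time `t`, the block `u` is a last one to be reduced to dust. -/
def IsLast (α : ℝ) (x : Realization) (t : ℝ) (u : List ℕ) : Prop :=
  Alive α x t u ∧ ∀ v, Alive α x t v → subExtinction α x t v ≤ subExtinction α x t u

/-- At each time before extinction exactly one block is the last to be reduced to dust. -/
def LastWellDefined (α : ℝ) (x : Realization) : Prop :=
  ∀ t, 0 ≤ t → t < extinction α x → ∃! u, IsLast α x t u

open Classical in
/-- The label of the last fragment at time `t`. -/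
def lastLabel (α : ℝ) (x : Realization) (t : ℝ) : List ℕ :=
  if h : ∃ u, IsLast α x t u then h.choose else []

open Classical in
/-- The last fragment process `F_*`. -/
def lastFrag (α : ℝ) (x : Realization) (t : ℝ) : ℝ :=
  if LastWellDefined α x ∧ t < extinction α x then mass x (lastLabel α x t) else 0

/-- The times `T_n` at which the last fragment splits, with `T_0 = 0`. -/
def splitTime (α : ℝ) (x : Realization) : ℕ → ℝ
  | 0 => 0
  | n + 1 => sInf {t | splitTime α x n ≤ t ∧ lastFrag α x t < lastFrag α x (splitTime α x n)}

/-- `Z_n = F_*(T_n) ^ α * (ζ - T_n)`. -/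
def chainZ (α : ℝ) (x : Realization) (n : ℕ) : ℝ :=
  lastFrag α x (splitTime α x n) ^ α * (extinction α x - splitTime α x n)

/-- `Θ_0 = 1` and `Θ_n = F_*(T_n) / F_*(T_{n-1})`. -/
def chainΘ (α : ℝ) (x : Realization) : ℕ → ℝ
  | 0 => 1
  | n + 1 => lastFrag α x (splitTime α x (n + 1)) / lastFrag α x (splitTime α x n)

/-- The masses of the siblings of a block, in their order (which is non-increasing). -/
def siblingMass (x : Realization) : List ℕ → ℕ → ℝ
  | [], _ => 0
  | i :: u, m => mass x ((if m < i then m else m + 1) :: u)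

/-- `Δ_0 = (0, 0, …)`, and `Δ_n` is the sequence of the relative masses of the other sub-blocks
that result from the split of the last fragment at time `T_n`. Indexed from `m = 0`. -/
def chainΔ (α : ℝ) (x : Realization) : ℕ → ℕ → ℝ
  | 0, _ => 0
  | n + 1, m =>
    siblingMass x (lastLabel α x (splitTime α x (n + 1))) m / lastFrag α x (splitTime α x n)

/-- The chain `(Z_n, Θ_n, Δ_n)_{n ≥ 0}`. -/
def chain (α : ℝ) (x : Realization) : ℕ → ℝ × ℝ × (ℕ → ℝ) :=
  fun n => (chainZ α x n, chainΘ α x n, chainΔ α x n)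

/-- `Y_0 = ζ ^ (1/α)` and `Y_n = ((ζ - T_n) / (ζ - T_{n-1})) ^ (1/α)`. -/
def chainY (α : ℝ) (x : Realization) : ℕ → ℝ
  | 0 => extinction α x ^ (1 / α)
  | n + 1 => ((extinction α x - splitTime α x (n + 1)) /
      (extinction α x - splitTime α x n)) ^ (1 / α)

/-! ### Re-centering -/

/-- `N_ε = sup {n ≥ 0 : ζ - ε ≥ T_n}`, where `⊥ = -∞` is the supremum of the empty set. -/
def Neps (α : ℝ) (x : Realization) (ε : ℝ) : WithBot ℕ∞ :=
  sSup ((fun n : ℕ => ((n : ℕ∞) : WithBot ℕ∞)) '' {n | splitTime α x n ≤ extinction α x - ε})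

/-- `N_ε` as an integer; only used where `N_ε` is finite. -/
def NepsInt (α : ℝ) (x : Realization) (ε : ℝ) : ℤ :=
  (((Neps α x ε).unbotD 0).toNat : ℤ)

/-- `R_ε(k) = ε⁻¹ ∏_{0 ≤ j ≤ N_ε + k} Y_j ^ α`, for integers `k ≥ -N_ε`. -/
def Reps (α : ℝ) (x : Realization) (ε : ℝ) (k : ℤ) : ℝ :=
  ε⁻¹ * ∏ j ∈ Finset.range (NepsInt α x ε + k + 1).toNat, chainY α x j ^ α

/-- `∏_{0 ≤ j ≤ N_ε + k} Θ_j`, for integers `k ≥ -N_ε`. -/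
def prodΘ (α : ℝ) (x : Realization) (ε : ℝ) (k : ℤ) : ℝ :=
  ∏ j ∈ Finset.range (NepsInt α x ε + k + 1).toNat, chainΘ α x j

/-- `Δ_{N_ε + i, m}`, for integers `i ≥ -N_ε`. -/
def shiftΔ (α : ℝ) (x : Realization) (ε : ℝ) (i : ℤ) (m : ℕ) : ℝ :=
  chainΔ α x (NepsInt α x ε + i).toNat m

/-- `Δ_{N_ε + i, m} ^ α * Θ_{N_ε + i} ^ (-α) * Z_{N_ε + i}`, for integers `i ≥ -N_ε`. -/
def condTime (α : ℝ) (x : Realization) (ε : ℝ) (i : ℤ) (m : ℕ) : ℝ :=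
  shiftΔ α x ε i m ^ α * chainΘ α x (NepsInt α x ε + i).toNat ^ (-α) *
    chainZ α x (NepsInt α x ε + i).toNat

/-- The pair `(i, m)` is the index of a block of positive mass that splits off from the last
fragment (at the time `T_{N_ε + i}`, where `N_ε ≠ -∞` and `i ≥ -N_ε + 1`). -/
def IsIndex (α : ℝ) (x : Realization) (ε : ℝ) (i : ℤ) (m : ℕ) : Prop :=
  Neps α x ε ≠ ⊥ ∧ -NepsInt α x ε + 1 ≤ i ∧ 0 < shiftΔ α x ε i m

/-! ### Conditioned time-reversed fragmentations -/

/-- The time-reversal of the fragmentation from time `c`: `r ↦ F(c - r)` for `0 ≤ r ≤ c`, and the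
zero state for `r > c`. -/
def revPath (α : ℝ) (x : Realization) (c : ℝ) (r : ℝ≥0) : ℕ → ℝ :=
  if (r : ℝ) ≤ c then frag α x (c - r) else 0

/-- The law of the time-reversal, from time `c`, of the fragmentation conditioned to become extinct
before time `c`, evaluated at a set `B` of paths (in the product σ-algebra). -/
def condRevLaw {Ω : Type*} [MeasurableSpace Ω] (P : Measure Ω) (X : Ω → Realization)
    (α c : ℝ) (B : Set (ℝ≥0 → ℕ → ℝ)) : ℝ≥0∞ :=
  P[|{ω | extinction α (X ω) < c}] {ω | revPath α (X ω) c ∈ B}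

/-- The path regularity that is part of the definition of a time-reversed fragmentation conditioned
to become extinct before time `c`: it takes its values in the mass sequences, starts from the zero
state, equals `(1, 0, …)` at time `c` and the zero state afterwards, and it is left-continuous with
right limits for the `ℓ¹`-distance. -/
def IsRevPath (c : ℝ) (f : ℝ≥0 → ℕ → ℝ) : Prop :=
  (∀ r, IsMassSeq (f r)) ∧ f 0 = 0 ∧ f c.toNNReal = oneState ∧ (∀ r : ℝ≥0, c < r → f r = 0) ∧
  (∀ r, Tendsto (fun r' => l1Dist (f r') (f r)) (𝓝[<] r) (𝓝 0)) ∧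
  (∀ r, ∃ l, IsMassSeq l ∧ Tendsto (fun r' => l1Dist (f r') l) (𝓝[>] r) (𝓝 0))

/-- `(G i m)` is a collection of time-reversed fragmentations that, conditionally on the chain
`(Z_n, Θ_n, Δ_n)_{n ≥ 0}`, are independent and respectively conditioned to become extinct before
the times `condTime … i m`. The conditional law is spelt out on its finite-dimensional marginals:
for a measurable set `A` of trajectories of the chain and finitely many indices `p`,
`P(chain ∈ A, G p ∈ B p for all p) = E[1_{chain ∈ A} ∏_p P(reversed fragmentation_p ∈ B p)]`,
on the event, determined by the chain, that all these `p` are indices of split-off blocks. -/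
def IsCondIndepRevFrag {Ω : Type*} [MeasurableSpace Ω] (P : Measure Ω) (X : Ω → Realization)
    (α ε : ℝ) (G : ℤ → ℕ → Ω → ℝ≥0 → ℕ → ℝ) : Prop :=
  (∀ i m, Measurable (G i m)) ∧
  (∀ᵐ ω ∂P, ∀ i m, IsIndex α (X ω) ε i m → IsRevPath (condTime α (X ω) ε i m) (G i m ω)) ∧
  ∀ (s : Finset (ℤ × ℕ)) (A : Set (ℕ → ℝ × ℝ × (ℕ → ℝ)))
    (B : ℤ × ℕ → Set (ℝ≥0 → ℕ → ℝ)), MeasurableSet A → (∀ p, MeasurableSet (B p)) →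
    P {ω | chain α (X ω) ∈ A ∧ ∀ p ∈ s, IsIndex α (X ω) ε p.1 p.2 ∧ G p.1 p.2 ω ∈ B p} =
      ∫⁻ ω in {ω | chain α (X ω) ∈ A ∧ ∀ p ∈ s, IsIndex α (X ω) ε p.1 p.2},
        ∏ p ∈ s, condRevLaw P X α (condTime α (X ω) ε p.1 p.2) (B p) ∂P

/-- The masses, at (rescaled, reversed) time `t` with `R_ε(k) ≥ t > R_ε(k+1)`, given by the
spine decomposition: the mass of the spine, and the masses in the fragmentations of the blocks
that split off from it. -/
def spineMasses (α : ℝ) (x : Realization) (ε : ℝ) (g : ℤ → ℕ → ℝ≥0 → ℕ → ℝ) (t : ℝ) (k : ℤ) :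
    Unit ⊕ ({i : ℤ // -NepsInt α x ε + 1 ≤ i ∧ i ≤ k} × ℕ × ℕ) → ℝ
  | .inl _ => prodΘ α x ε k
  | .inr (i, m, l) =>
    prodΘ α x ε (i - 1) * shiftΔ α x ε i m *
      g i m (t * ε * prodΘ α x ε (i - 1) ^ α * shiftΔ α x ε i m ^ α).toNNReal l

end Fragmentation

end

/-! The proof combines deterministic facts about realizations satisfying `Good`, a resampling
argument for the laws, and the almost sure statement `ae_good`.

Deterministic part. A block `u` is reduced to dust at time `dust α x u`, the supremum of the
splitting times of its descendants. In a good realization exactly one child of a block lasts as long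
as the block itself; following these children from the root gives `spine`. Its birth times increase
strictly to `life`, which is the extinction time, and they are the times `T_n`
(`Good.splitTime_eq`). Hence the chain is a functional of the spine, and the products of the `Θ_j`
and of the `Y_j ^ α` telescope to spine masses and remaining times. A block present at time `ζ - ε
t` is either the current spine block or a descendant of exactly one sibling that left the spine
before. By self-similarity these descendants form the fragmentation of a `subtree`, read in its own
units. Comparing, at each level `y`, the number of blocks of mass above `y` gives the identity of
states (`Good.frag_eq_decRearr_spineMasses`).

Conditional laws. Fix the label `v` of a sibling and replace its subtree by an independent copy `y`;
this preserves the law (`measurePreserving_graft`). As long as `life y` is smaller than the time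
`sibTime` left to `v`, the spine, the chain and all other siblings stay the same (`SibChange`);
otherwise `v` is no longer a losing sibling. Thus, given everything else, the subtree at `v` is a
fragmentation conditioned to become extinct before `sibTime` (`lintegral_sib`), and an induction
over finitely many siblings gives conditional independence (`lintegral_prod_sib`).

Almost sure part. For `p > 1` the mean of `∑ s_i ^ p` is below one, because `ν` does not charge `(1,
0, …)`. Summing over generations bounds the extinction time and sends the remaining lives of blocks
to zero. The exponential clocks have no atoms, which excludes ties between siblings. Left limits in
`ℓ¹` require that no positive mass turns to dust at a single instant; this is a second moment
estimate on pairs of blocks (`lintegral_pairMass_le`). -/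

noncomputable section

namespace Fragmentation

section

/-! ### Decreasing rearrangements -/

section Rearrangement

variable {ι κ : Type*} {a : ι → ℝ} {M : ℝ}

lemma encard_setOf_natCast_lt (N : ℕ∞) : {k : ℕ | (k : ℕ∞) < N}.encard = N := by
  induction N using ENat.recTopCoe with
  | top => simp
  | coe n =>
    have : {k : ℕ | (k : ℕ∞) < n} = ((Finset.range n : Finset ℕ) : Set ℕ) := by
      ext k; simp
    rw [this, Set.encard_coe_eq_coe_finsetCard, Finset.card_range]

/-- If `k + 1` members exceed `y`, so does the smallest of them, and any level strictly between the
two is still exceeded by more than `k` members. Rearrangements are handled below only through this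
counting function. -/
lemma lt_decRearr_iff (ha : ∀ i, a i ≤ M) {y : ℝ} (hy : 0 ≤ y) (k : ℕ) :
    y < decRearr a k ↔ (k : ℕ∞) < {i | y < a i}.encard := by
  have hbdd : BddBelow {y : ℝ | 0 ≤ y ∧ {i | y < a i}.encard ≤ (k : ℕ∞)} := ⟨0, fun z hz => hz.1⟩
  constructor
  · intro h
    by_contra! hk
    exact absurd (csInf_le hbdd (show y ∈ _ from ⟨hy, hk⟩)) (not_le.2 h)
  · intro h
    obtain ⟨T, hT, hTc⟩ := Set.exists_subset_encard_eq (Order.add_one_le_of_lt h)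
    have hfin : T.Finite := Set.finite_of_encard_eq_coe (k := k + 1) (by simpa using hTc)
    have hne : T.Nonempty := by
      rw [Set.nonempty_iff_ne_empty]
      rintro rfl
      rw [Set.encard_empty] at hTc
      exact absurd hTc.symm (by simp)
    obtain ⟨i₀, hi₀, hmin⟩ := Set.exists_min_image T a hfin hne
    have hlt : y < a i₀ := hT hi₀
    obtain ⟨y', hy1, hy2⟩ := exists_between hlt
    -- The level `max M 0` is exceeded by no member, so the infimum is over a nonempty set.
    refine lt_of_lt_of_le hy1 (le_csInf ⟨max M 0, le_max_right _ _, ?_⟩ ?_)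
    · have : {i | max M 0 < a i} = ∅ := by
        ext i; simp [ha i]
      rw [this]
      simp
    · rintro z ⟨hz, hzc⟩
      by_contra! hlt'
      have hsub : T ⊆ {i | z < a i} := fun i hi => hlt'.trans (hy2.trans_le (hmin i hi))
      have := (Set.encard_le_encard hsub).trans hzc
      rw [hTc] at this
      exact absurd this (not_le.2 (by exact_mod_cast Nat.lt_succ_self k))

lemma decRearr_nonneg (a : ι → ℝ) (k : ℕ) : 0 ≤ decRearr a k :=
  Real.sInf_nonneg fun _ h => h.1

lemma decRearr_le_iff (ha : ∀ i, a i ≤ M) {y : ℝ} (hy : 0 ≤ y) (k : ℕ) :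
    decRearr a k ≤ y ↔ {i | y < a i}.encard ≤ (k : ℕ∞) := by
  rw [← not_lt, lt_decRearr_iff ha hy, not_lt]

lemma antitone_decRearr (ha : ∀ i, a i ≤ M) : Antitone (decRearr a) := by
  intro k l hkl
  rw [decRearr_le_iff ha (decRearr_nonneg _ _)]
  exact ((decRearr_le_iff ha (decRearr_nonneg _ _) k).1 le_rfl).trans (by exact_mod_cast hkl)

lemma decRearr_congr {b : κ → ℝ}
    (h : ∀ y, 0 ≤ y → {i | y < a i}.encard = {i | y < b i}.encard) : decRearr a = decRearr b := by
  funext k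
  unfold decRearr
  congr 1
  ext y
  exact and_congr_right fun hy => by rw [h y hy]

lemma encard_lt_decRearr (ha : ∀ i, a i ≤ M) {y : ℝ} (hy : 0 ≤ y) :
    {k | y < decRearr a k}.encard = {i | y < a i}.encard := by
  simp_rw [lt_decRearr_iff ha hy]
  exact encard_setOf_natCast_lt _

lemma decRearr_eq_zero_iff (ha : ∀ i, a i ≤ M) : decRearr a = 0 ↔ ∀ i, a i ≤ 0 := by
  constructor
  · intro h i
    have h0 : decRearr a 0 ≤ 0 := by simp [h]
    rw [decRearr_le_iff ha le_rfl] at h0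
    by_contra! hi
    have : {i | 0 < a i} = ∅ := by simpa using h0
    exact (this ▸ (show i ∈ {i | 0 < a i} from hi) : i ∈ (∅ : Set ι))
  · intro h
    funext k
    refine le_antisymm ?_ (decRearr_nonneg _ _)
    rw [Pi.zero_apply, decRearr_le_iff ha le_rfl]
    have : {i | 0 < a i} = ∅ := by
      ext i; simp [h i]
    simp [this]

/-- Layer-cake formula. It shows that the sum depends only on the counting function, which a family
shares with its rearrangement. -/
lemma tsum_ofReal_eq_lintegral_encard [Countable ι] (a : ι → ℝ) :
    ∑' i, ENNReal.ofReal (a i) = ∫⁻ y in Set.Ici (0 : ℝ), ({i | y < a i}.encard : ℝ≥0∞) := by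
  have h1 : ∀ i, ENNReal.ofReal (a i) =
      ∫⁻ y in Set.Ici (0 : ℝ), (Set.Iio (a i)).indicator (fun _ => (1 : ℝ≥0∞)) y := by
    intro i
    rw [lintegral_indicator measurableSet_Iio, Measure.restrict_restrict measurableSet_Iio]
    simp only [lintegral_one, MeasurableSet.univ, Measure.restrict_apply, Set.univ_inter]
    rw [Set.Iio_inter_Ici, Real.volume_Ico, sub_zero]
  simp_rw [h1]
  rw [← lintegral_tsum fun i =>
    ((measurable_const (a := (1 : ℝ≥0∞))).indicator measurableSet_Iio).aemeasurable]
  refine lintegral_congr fun y => ?_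
  rw [← ENNReal.tsum_set_one, tsum_subtype {i | y < a i} (fun _ => (1 : ℝ≥0∞))]
  refine tsum_congr fun i => ?_
  by_cases h : y < a i <;> simp [Set.indicator, h]

lemma tsum_ofReal_decRearr [Countable ι] (ha : ∀ i, a i ≤ M) :
    ∑' k, ENNReal.ofReal (decRearr a k) = ∑' i, ENNReal.ofReal (a i) := by
  rw [tsum_ofReal_eq_lintegral_encard, tsum_ofReal_eq_lintegral_encard]
  refine setLIntegral_congr_fun measurableSet_Ici fun y hy => ?_
  rw [encard_lt_decRearr ha hy]

lemma isMassSeq_decRearr [Countable ι] (ha : ∀ i, a i ≤ M)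
    (hs : ∑' i, ENNReal.ofReal (a i) ≠ ∞) : IsMassSeq (decRearr a) := by
  refine ⟨antitone_decRearr ha, decRearr_nonneg a, ?_⟩
  rw [← tsum_ofReal_decRearr ha] at hs
  have := ENNReal.summable_toReal hs
  simpa [ENNReal.toReal_ofReal (decRearr_nonneg a _)] using this

/-- For countable sets equality of `encard` is equality of cardinals, so there are bijections
between the fibres, and these glue. It compares families indexed by labels with families indexed by
ranks. -/
lemma encard_sigma_congr {J β γ : Type} [Countable β] [Countable γ] (s : J → Set β)
    (t : J → Set γ) (h : ∀ j, (s j).encard = (t j).encard) :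
    {p : J × β | p.2 ∈ s p.1}.encard = {p : J × γ | p.2 ∈ t p.1}.encard := by
  have e : ∀ j, Nonempty (s j ≃ t j) := by
    intro j
    have h1 := h j
    simp only [Set.encard, ENat.card] at h1
    exact Cardinal.eq.1 (Cardinal.toENat_injOn Cardinal.mk_le_aleph0 Cardinal.mk_le_aleph0 h1)
  have e' := fun j => (e j).some
  refine Set.encard_congr
    { toFun := fun p => ⟨⟨p.1.1, (e' p.1.1 ⟨p.1.2, p.2⟩).1⟩, (e' p.1.1 ⟨p.1.2, p.2⟩).2⟩
      invFun := fun p => ⟨⟨p.1.1, ((e' p.1.1).symm ⟨p.1.2, p.2⟩).1⟩,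
        ((e' p.1.1).symm ⟨p.1.2, p.2⟩).2⟩
      left_inv := fun p => by simp
      right_inv := fun p => by simp }

end Rearrangement

end

section

/-! ### The genealogical tree -/

/-- The realization of the fragmentation of the block `v`, in its own units. -/
def subtree (v : List ℕ) (x : Realization) : Realization := fun w => x (w ++ v)

/-- The words of length `n`. -/
abbrev Lev (n : ℕ) : Type := {u : List ℕ // u.length = n}

/-- The words of length `n + 1` are obtained by adding a letter in front. -/
def levCons (n : ℕ) : ℕ × Lev n ≃ Lev (n + 1) where
  toFun p := ⟨p.1 :: p.2.1, by simp [p.2.2]⟩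
  invFun u := (u.1.head (by rintro h; simpa [h] using u.2), ⟨u.1.tail, by simp [u.2]⟩)
  left_inv p := by simp
  right_inv u := by simp

/-- The words of length `n + k` are obtained by putting a word of length `n` in front of one of
length `k`. -/
def levAppend (n k : ℕ) : Lev n × Lev k ≃ Lev (n + k) where
  toFun p := ⟨p.1.1 ++ p.2.1, by simp [p.1.2, p.2.2]⟩
  invFun u := (⟨u.1.take n, by simp [u.2]⟩, ⟨u.1.drop n, by simp [u.2]⟩)
  left_inv p := by
    obtain ⟨⟨u, hu⟩, ⟨v, hv⟩⟩ := p
    subst hu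
    simp
  right_inv u := by simp

lemma eq_of_suffix_of_suffix_of_length_eq {u v w : List ℕ} (hu : u <:+ w) (hv : v <:+ w)
    (h : u.length = v.length) : u = v := by
  exact (List.suffix_of_suffix_length_le hu hv h.le).eq_of_length h

variable {α : ℝ} {x : Realization}

@[simp] lemma subtree_nil (x : Realization) : subtree [] x = x := by
  funext w; simp [subtree]

lemma subtree_subtree (u v : List ℕ) (x : Realization) :
    subtree u (subtree v x) = subtree (u ++ v) x := by
  funext w; simp [subtree]

lemma subtree_apply (v w : List ℕ) (x : Realization) : subtree v x w = x (w ++ v) := rfl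

lemma UnitMassSeq.nonneg (s : UnitMassSeq) (i : ℕ) : 0 ≤ (s : ℕ → ℝ) i := s.2.1.2.1 i

lemma UnitMassSeq.hasSum (s : UnitMassSeq) : HasSum (s : ℕ → ℝ) 1 := by
  have := s.2.1.2.2.hasSum
  rwa [s.2.2] at this

lemma UnitMassSeq.le_one (s : UnitMassSeq) (i : ℕ) : (s : ℕ → ℝ) i ≤ 1 :=
  le_hasSum s.hasSum i fun j _ => s.nonneg j

lemma UnitMassSeq.tsum_ofReal (s : UnitMassSeq) :
    ∑' i, ENNReal.ofReal ((s : ℕ → ℝ) i) = 1 := by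
  rw [← ENNReal.ofReal_tsum_of_nonneg s.nonneg s.2.1.2.2, s.2.2, ENNReal.ofReal_one]

lemma mass_nonneg (x : Realization) : ∀ u, 0 ≤ mass x u
  | [] => zero_le_one
  | _ :: u => mul_nonneg (mass_nonneg x u) (UnitMassSeq.nonneg _ _)

lemma mass_append (x : Realization) (w v : List ℕ) :
    mass x (w ++ v) = mass x v * mass (subtree v x) w := by
  induction w with
  | nil => simp [mass]
  | cons i w ih => simp only [List.cons_append, mass, ih, subtree_apply, mul_assoc]

lemma mass_append_le (x : Realization) (w v : List ℕ) : mass x (w ++ v) ≤ mass x v := by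
  induction w with
  | nil => simp
  | cons i w ih =>
    exact (mul_le_of_le_one_right (mass_nonneg _ _) (UnitMassSeq.le_one _ _)).trans ih

lemma mass_le_one (x : Realization) (u : List ℕ) : mass x u ≤ 1 := by
  simpa [mass] using mass_append_le x u []

lemma mass_pos_of_append {w v : List ℕ} (h : 0 < mass x (w ++ v)) : 0 < mass x v :=
  h.trans_le (mass_append_le x w v)

/-- Self-similarity: seen from `v`, masses scale by `mass x v` and times by `mass x v ^ (-α)`. -/
lemma birth_append (x : Realization) (w v : List ℕ) :
    birth α x (w ++ v) = birth α x v + mass x v ^ (-α) * birth α (subtree v x) w := by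
  induction w with
  | nil => simp [birth]
  | cons i w ih =>
    simp only [List.cons_append, birth, ih, mass_append, subtree_apply]
    rw [Real.mul_rpow (mass_nonneg _ _) (mass_nonneg _ _)]
    ring

lemma death_append (x : Realization) (w v : List ℕ) :
    death α x (w ++ v) = birth α x v + mass x v ^ (-α) * death α (subtree v x) w :=
  birth_append x (0 :: w) v

lemma tsum_mass_cons (x : Realization) (u : List ℕ) :
    ∑' i, ENNReal.ofReal (mass x (i :: u)) = ENNReal.ofReal (mass x u) := by
  simp_rw [mass, ENNReal.ofReal_mul (mass_nonneg x u)]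
  rw [ENNReal.tsum_mul_left, UnitMassSeq.tsum_ofReal, mul_one]

lemma tsum_lev_mass (x : Realization) (n : ℕ) :
    ∑' u : Lev n, ENNReal.ofReal (mass x u.1) = 1 := by
  induction n with
  | zero =>
    have : ∀ u : Lev 0, u = ⟨[], rfl⟩ := fun u => Subtype.ext (List.length_eq_zero_iff.1 u.2)
    rw [tsum_eq_single ⟨[], rfl⟩ fun u hu => absurd (this u) hu]
    simp [mass]
  | succ n ih =>
    rw [← (levCons n).tsum_eq, ENNReal.tsum_prod', ENNReal.tsum_comm, ← ih]
    exact tsum_congr fun u => tsum_mass_cons x u.1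

lemma tsum_lev_mass_append (x : Realization) (n : ℕ) (v : List ℕ) :
    ∑' u : Lev n, ENNReal.ofReal (mass x (u.1 ++ v)) = ENNReal.ofReal (mass x v) := by
  simp_rw [mass_append, ENNReal.ofReal_mul (mass_nonneg x v)]
  rw [ENNReal.tsum_mul_left, tsum_lev_mass, mul_one]

/-- The total mass of the words of length `n` with the property `p`. -/
def levMass (x : Realization) (n : ℕ) (p : List ℕ → Prop) : ℝ≥0∞ :=
  ∑' u : {u : Lev n // p u.1}, ENNReal.ofReal (mass x u.1.1)

lemma levMass_eq_indicator (x : Realization) (n : ℕ) (p : List ℕ → Prop) :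
    levMass x n p = ∑' u : Lev n, {u : Lev n | p u.1}.indicator
      (fun u => ENNReal.ofReal (mass x u.1)) u :=
  tsum_subtype {u : Lev n | p u.1} (fun u => ENNReal.ofReal (mass x u.1))

lemma levMass_mono (x : Realization) (n : ℕ) {p q : List ℕ → Prop} (h : ∀ u, u.length = n → p u → q u) :
    levMass x n p ≤ levMass x n q := by
  rw [levMass_eq_indicator, levMass_eq_indicator]
  refine ENNReal.tsum_le_tsum fun u => Set.indicator_le_indicator_of_subset ?_ (by simp) u
  exact fun u hu => h _ u.2 hu

lemma levMass_or_le (x : Realization) (n : ℕ) (p q : List ℕ → Prop) :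
    levMass x n (fun u => p u ∨ q u) ≤ levMass x n p + levMass x n q := by
  simp_rw [levMass_eq_indicator]
  rw [← ENNReal.tsum_add]
  refine ENNReal.tsum_le_tsum fun u => ?_
  by_cases hp : p u.1 <;> by_cases hq : q u.1 <;> simp [Set.indicator, hp, hq]

/-- Conservation of mass: dislocations have total mass one, so the descendants in any later
generation carry exactly the mass of their ancestor. -/
lemma levMass_suffix (x : Realization) {n : ℕ} {v : List ℕ} (hv : v.length ≤ n) :
    levMass x n (v <:+ ·) = ENNReal.ofReal (mass x v) := by
  obtain ⟨k, rfl⟩ := Nat.exists_eq_add_of_le' hv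
  rw [← tsum_lev_mass_append x k v, levMass]
  let e : Lev k ≃ {u : Lev (k + v.length) // v <:+ u.1} :=
    { toFun := fun u => ⟨⟨u.1 ++ v, by simp [u.2]⟩, List.suffix_append _ _⟩
      invFun := fun u => ⟨u.1.1.take k, by simp [u.1.2]⟩
      left_inv := fun u => by
        obtain ⟨u, rfl⟩ := u
        simp
      right_inv := fun u => by
        obtain ⟨⟨u, hu⟩, w, hw⟩ := u
        simp only at hw
        subst hw
        simp only [List.length_append, Nat.add_right_cancel_iff] at hu
        subst hu
        simp }
  rw [← e.tsum_eq]
  rfl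

lemma levMass_suffix_le (x : Realization) (n : ℕ) (v : List ℕ) :
    levMass x n (v <:+ ·) ≤ ENNReal.ofReal (mass x v) := by
  by_cases hv : v.length ≤ n
  · exact (levMass_suffix x hv).le
  · have : IsEmpty {u : Lev n // v <:+ u.1} :=
      ⟨fun u => hv (by simpa [u.1.2] using u.2.length_le)⟩
    simp [levMass]

lemma levMass_exists_suffix_le (x : Realization) (n : ℕ) (A : Set (List ℕ)) :
    levMass x n (fun u => ∃ v ∈ A, v <:+ u) ≤ ∑' v : A, ENNReal.ofReal (mass x v) := by
  refine le_trans ?_ (ENNReal.tsum_le_tsum fun v : A => levMass_suffix_le x n v)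
  simp_rw [levMass_eq_indicator]
  rw [ENNReal.tsum_comm]
  refine ENNReal.tsum_le_tsum fun u => ?_
  by_cases h : ∃ v ∈ A, v <:+ u.1
  · obtain ⟨v, hv, hvu⟩ := h
    refine le_trans ?_ (ENNReal.le_tsum ⟨v, hv⟩)
    rw [Set.indicator_of_mem (by exact ⟨v, hv, hvu⟩), Set.indicator_of_mem (by exact hvu)]
  · rw [Set.indicator_of_notMem (by exact h)]
    exact zero_le

/-- No element of `A` is a strict ancestor of another one. -/
def IsAntichainSuffix (A : Set (List ℕ)) : Prop := ∀ u ∈ A, ∀ v ∈ A, u <:+ v → u = v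

/-- A word has at most one ancestor in an antichain, because its ancestors are totally ordered. The
descendants of the members of `A` in generation `n` are thus disjoint, and each member is
represented there by its full mass. -/
lemma tsum_antichain_le (x : Realization) {A : Set (List ℕ)} (hA : IsAntichainSuffix A) (n : ℕ)
    (hn : ∀ u ∈ A, u.length ≤ n) :
    ∑' v : A, ENNReal.ofReal (mass x v) ≤ levMass x n (fun u => ∃ v ∈ A, v <:+ u) := by
  have h1 : ∀ v : A, ENNReal.ofReal (mass x v) = levMass x n (v.1 <:+ ·) :=
    fun v => (levMass_suffix x (hn v v.2)).symm
  simp_rw [h1, levMass_eq_indicator]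
  rw [ENNReal.tsum_comm]
  refine ENNReal.tsum_le_tsum fun u => ?_
  by_cases h : ∃ v ∈ A, v <:+ u.1
  · obtain ⟨v, hv, hvu⟩ := h
    rw [Set.indicator_of_mem (by exact ⟨v, hv, hvu⟩), tsum_eq_single ⟨v, hv⟩]
    · exact Set.indicator_le_self _ _ _
    · rintro ⟨w, hw⟩ hne
      refine Set.indicator_of_notMem (fun hwu => hne ?_) _
      have hwu' : w <:+ u.1 := hwu
      rcases List.suffix_or_suffix_of_suffix hwu' hvu with h | h
      · exact Subtype.ext (hA _ hw _ hv h)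
      · exact Subtype.ext (hA _ hv _ hw h).symm
  · rw [Set.indicator_of_notMem (by exact h)]
    refine (ENNReal.tsum_eq_zero.2 fun v => Set.indicator_of_notMem (fun hv => h ?_) _).le
    exact ⟨v, v.2, hv⟩

lemma levMass_le_one (x : Realization) (n : ℕ) (p : List ℕ → Prop) : levMass x n p ≤ 1 := by
  rw [← tsum_lev_mass x n]
  exact ENNReal.tsum_comp_le_tsum_of_injective Subtype.val_injective
    (fun u : Lev n => ENNReal.ofReal (mass x u.1))

/-- The mass of a set of blocks is the supremum of the masses of its blocks of bounded length. -/
lemma tsum_mass_le_of_forall_length (x : Realization) {A : Set (List ℕ)} {C : ℝ≥0∞}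
    (h : ∀ n, ∑' v : {v // v ∈ A ∧ v.length ≤ n}, ENNReal.ofReal (mass x v) ≤ C) :
    ∑' v : A, ENNReal.ofReal (mass x v) ≤ C := by
  rw [ENNReal.tsum_eq_iSup_sum]
  refine iSup_le fun s => ?_
  obtain ⟨n, hn⟩ : ∃ n, ∀ v ∈ s, v.1.length ≤ n :=
    ⟨s.sup fun v => v.1.length, fun v hv => Finset.le_sup (f := fun v : A => v.1.length) hv⟩
  refine le_trans ?_ (h n)
  let i : s → {v // v ∈ A ∧ v.length ≤ n} := fun v => ⟨v.1.1, v.1.2, hn _ v.2⟩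
  have hi : Function.Injective i := by
    intro u v huv
    have h1 : u.1.1 = v.1.1 := congrArg (fun z => z.1) huv
    exact Subtype.ext (Subtype.ext h1)
  rw [← Finset.sum_coe_sort, ← tsum_fintype (L := .unconditional _)]
  exact ENNReal.tsum_comp_le_tsum_of_injective hi
    (fun v : {v // v ∈ A ∧ v.length ≤ n} => ENNReal.ofReal (mass x v))

lemma tsum_antichain_le_one (x : Realization) {A : Set (List ℕ)} (hA : IsAntichainSuffix A) :
    ∑' v : A, ENNReal.ofReal (mass x v) ≤ 1 := by
  refine tsum_mass_le_of_forall_length x fun n => ?_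
  refine (tsum_antichain_le (A := {v | v ∈ A ∧ v.length ≤ n}) x ?_ n fun u hu => hu.2).trans
    (levMass_le_one _ _ _)
  exact fun u hu v hv => hA u hu.1 v hv.1

/-! ### Blocks present at a given time -/

/-- All the clocks are positive. -/
def ClockPos (x : Realization) : Prop := ∀ u, 0 < (x u).1

lemma ClockPos.subtree (h : ClockPos x) (v : List ℕ) : ClockPos (subtree v x) := fun _ => h _

lemma birth_nonneg (h : ClockPos x) : ∀ u, 0 ≤ birth α x u
  | [] => le_rfl
  | _ :: u => add_nonneg (birth_nonneg h u)
      (mul_nonneg (Real.rpow_nonneg (mass_nonneg _ _) _) (h u).le)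

lemma birth_le_death (h : ClockPos x) (u : List ℕ) : birth α x u ≤ death α x u :=
  le_add_of_nonneg_right (mul_nonneg (Real.rpow_nonneg (mass_nonneg _ _) _) (h u).le)

lemma birth_lt_death (h : ClockPos x) {u : List ℕ} (hu : 0 < mass x u) :
    birth α x u < death α x u :=
  lt_add_of_pos_right _ (mul_pos (Real.rpow_pos_of_pos hu _) (h u))

lemma death_le_death_append (h : ClockPos x) (w v : List ℕ) :
    death α x v ≤ death α x (w ++ v) := by
  induction w with
  | nil => exact le_rfl
  | cons i w ih => exact ih.trans (birth_le_death h (i :: (w ++ v)))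

lemma death_le_birth_of_suffix (h : ClockPos x) {u v : List ℕ} (huv : u <:+ v) (hne : u ≠ v) :
    death α x u ≤ birth α x v := by
  obtain ⟨w, rfl⟩ := huv
  cases w with
  | nil => simp at hne
  | cons i w => exact death_le_death_append h w u

lemma Alive.eq_of_suffix (h : ClockPos x) {t : ℝ} {u v : List ℕ} (hu : Alive α x t u)
    (hv : Alive α x t v) (huv : u <:+ v) : u = v := by
  by_contra hne
  exact absurd (hu.2.2.trans_le (death_le_birth_of_suffix h huv hne)) (not_lt.2 hv.2.1)

/-- Along a line of descent the lifetimes are consecutive half-open intervals, so they cover all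
times from the birth of `u` to the death of `v`. -/
lemma exists_alive_suffix {t : ℝ} {u v : List ℕ} (huv : u <:+ v)
    (hv : 0 < mass x v) (h1 : birth α x u ≤ t) (h2 : t < death α x v) :
    ∃ w, u <:+ w ∧ w <:+ v ∧ Alive α x t w := by
  obtain ⟨w, rfl⟩ := huv
  induction w with
  | nil => exact ⟨u, List.suffix_rfl, List.suffix_rfl, hv, h1, h2⟩
  | cons i w ih =>
    by_cases hb : birth α x (i :: w ++ u) ≤ t
    · exact ⟨_, List.suffix_append _ _, List.suffix_rfl, hv, hb, h2⟩
    -- The birth of a child is by definition the death of its parent.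
    · obtain ⟨z, hz1, hz2, hz3⟩ := ih (mass_pos_of_append (w := [i]) hv) (not_le.1 hb)
      exact ⟨z, hz1, hz2.trans (List.suffix_cons _ _), hz3⟩

lemma isAntichainSuffix_alive (h : ClockPos x) (t : ℝ) : IsAntichainSuffix {u | Alive α x t u} :=
  fun _ hu _ hv huv => Alive.eq_of_suffix h hu hv huv

lemma frag_eq_zero_iff {t : ℝ} : frag α x t = 0 ↔ ∀ u, ¬ Alive α x t u := by
  rw [frag, decRearr_eq_zero_iff (a := fun u : {u // Alive α x t u} => mass x u)
    fun u => mass_le_one x u.1]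
  exact ⟨fun h u hu => absurd hu.1 (not_lt.2 (h ⟨u, hu⟩)), fun h u => absurd u.2 (h u.1)⟩

lemma subFrag_eq_zero_iff {t s : ℝ} {u : List ℕ} :
    subFrag α x t u s = 0 ↔ ∀ v, u <:+ v → ¬ Alive α x (t + s) v := by
  rw [subFrag, decRearr_eq_zero_iff
    (a := fun v : {v // u <:+ v ∧ Alive α x (t + s) v} => mass x v) fun u => mass_le_one x u.1]
  exact ⟨fun h u hu hu' => absurd hu'.1 (not_lt.2 (h ⟨u, hu, hu'⟩)),
    fun h u => absurd u.2.2 (h u.1 u.2.1)⟩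

lemma alive_append_iff {t : ℝ} {v : List ℕ} (hv : 0 < mass x v) (w : List ℕ) :
    Alive α x t (w ++ v) ↔ Alive α (subtree v x) ((t - birth α x v) * mass x v ^ α) w := by
  have hp : 0 < mass x v ^ (-α) := Real.rpow_pos_of_pos hv _
  have hinv : mass x v ^ α = (mass x v ^ (-α))⁻¹ := by rw [Real.rpow_neg hv.le, inv_inv]
  unfold Alive
  rw [mass_append, birth_append, death_append, hinv, ← div_eq_mul_inv, le_div_iff₀ hp,
    div_lt_iff₀ hp]
  refine and_congr (mul_pos_iff_of_pos_left hv) (and_congr ?_ ?_) <;> constructor <;> intro h <;>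
    linarith

/-! ### Extinction times -/

/-- The last time at which a block splits. -/
def life (α : ℝ) (x : Realization) : ℝ :=
  open Classical in ⨆ w, if 0 < mass x w then death α x w else 0

/-- The time at which the block `u` is reduced to dust. -/
def dust (α : ℝ) (x : Realization) (u : List ℕ) : ℝ :=
  birth α x u + mass x u ^ (-α) * life α (subtree u x)

/-- The splitting times are bounded. -/
def BddDeath (α : ℝ) (x : Realization) : Prop :=
  ∃ C, ∀ w, 0 < mass x w → death α x w ≤ C

lemma BddDeath.subtree (h : BddDeath α x) {v : List ℕ} (hv : 0 < mass x v) :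
    BddDeath α (subtree v x) := by
  obtain ⟨C, hC⟩ := h
  refine ⟨(C - birth α x v) / mass x v ^ (-α), fun w hw => ?_⟩
  rw [le_div_iff₀ (Real.rpow_pos_of_pos hv _)]
  have := hC (w ++ v) (by rw [mass_append]; positivity)
  rw [death_append] at this
  linarith

lemma death_le_life (h : BddDeath α x) {w : List ℕ} (hw : 0 < mass x w) :
    death α x w ≤ life α x := by
  classical
  obtain ⟨C, hC⟩ := h
  refine le_trans ?_ (le_ciSup ⟨max C 0, ?_⟩ w)
  · simp [hw]
  · rintro _ ⟨w, rfl⟩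
    dsimp only
    split_ifs with h
    · exact (hC w h).trans (le_max_left _ _)
    · exact le_max_right _ _

lemma life_pos (hc : ClockPos x) (h : BddDeath α x) : 0 < life α x := by
  have := death_le_life h (w := []) (by simp [mass])
  exact lt_of_lt_of_le (by simpa [death, birth, mass] using hc []) this

lemma life_le (hc : ClockPos x) {C : ℝ} (hC : ∀ w, 0 < mass x w → death α x w ≤ C) :
    life α x ≤ C := by
  classical
  refine ciSup_le fun w => ?_
  split_ifs with h
  · exact hC w h
  · exact ((birth_nonneg hc []).trans (birth_le_death hc [])).trans (hC [] (by simp [mass]))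

@[simp] lemma dust_nil : dust α x [] = life α x := by
  simp [dust, birth, mass]

lemma dust_append (x : Realization) (w v : List ℕ) :
    dust α x (w ++ v) = birth α x v + mass x v ^ (-α) * dust α (subtree v x) w := by
  rw [dust, dust, birth_append, mass_append, Real.mul_rpow (mass_nonneg _ _) (mass_nonneg _ _),
    subtree_subtree]
  ring

lemma death_le_dust (h : BddDeath α x) {u v : List ℕ} (huv : u <:+ v) (hv : 0 < mass x v) :
    death α x v ≤ dust α x u := by
  obtain ⟨w, rfl⟩ := huv
  have hu := mass_pos_of_append hv
  rw [death_append, dust]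
  have := death_le_life (h.subtree hu) (w := w) (by rwa [mass_append, mul_pos_iff_of_pos_left hu] at hv)
  have hp : 0 < mass x u ^ (-α) := Real.rpow_pos_of_pos hu _
  gcongr

lemma dust_le (hc : ClockPos x) {u : List ℕ} (hu : 0 < mass x u) {C : ℝ}
    (hC : ∀ v, u <:+ v → 0 < mass x v → death α x v ≤ C) : dust α x u ≤ C := by
  have hp : 0 < mass x u ^ (-α) := Real.rpow_pos_of_pos hu _
  have : life α (subtree u x) ≤ (C - birth α x u) / mass x u ^ (-α) := by
    refine life_le (hc.subtree u) fun w hw => ?_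
    rw [le_div_iff₀ hp]
    have := hC (w ++ u) (List.suffix_append _ _) (by rw [mass_append]; positivity)
    rw [death_append] at this
    linarith
  rw [le_div_iff₀ hp] at this
  rw [dust]
  linarith

lemma dust_le_dust (hc : ClockPos x) (h : BddDeath α x) {u v : List ℕ} (huv : u <:+ v)
    (hv : 0 < mass x v) : dust α x v ≤ dust α x u :=
  dust_le hc hv fun _ hw hm => death_le_dust h (huv.trans hw) hm

/-- If `t` precedes the supremum of the splitting times below `u`, some descendant splits after `t`,
and its line of descent from `u` meets a block present at `t`. Both kinds of extinction time reduce
to `dust` in this way. -/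
lemma exists_alive_iff_lt_dust (hc : ClockPos x) (h : BddDeath α x) {u : List ℕ}
    (hu : 0 < mass x u) {t : ℝ} (ht : birth α x u ≤ t) :
    (∃ v, u <:+ v ∧ Alive α x t v) ↔ t < dust α x u := by
  constructor
  · rintro ⟨v, hv, hm, -, hd⟩
    exact hd.trans_le (death_le_dust h hv hm)
  · intro hlt
    by_contra! hno
    refine absurd (dust_le hc hu fun v huv hv => ?_) (not_le.2 hlt)
    by_contra! hd
    obtain ⟨w, hw, -, ha⟩ := exists_alive_suffix huv hv ht hd
    exact hno w hw ha

lemma sInf_setOf_le_and {c : ℝ} {p : ℝ → Prop} (hc : 0 ≤ c)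
    (hp : ∀ s, 0 ≤ s → (p s ↔ c ≤ s)) : sInf {s | 0 ≤ s ∧ p s} = c := by
  have : {s | 0 ≤ s ∧ p s} = Set.Ici c := by
    ext s
    exact ⟨fun hs => (hp s hs.1).1 hs.2, fun hs => ⟨hc.trans hs, (hp s (hc.trans hs)).2 hs⟩⟩
  rw [this, csInf_Ici]

lemma extinction_eq_life (hc : ClockPos x) (h : BddDeath α x) :
    extinction α x = life α x := by
  refine sInf_setOf_le_and (life_pos hc h).le fun s hs => ?_
  rw [frag_eq_zero_iff, ← not_lt, ← dust_nil,
    ← exists_alive_iff_lt_dust hc h (by simp [mass]) (by simpa [birth] using hs)]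
  simp

lemma subExtinction_eq (hc : ClockPos x) (h : BddDeath α x) {t : ℝ} {u : List ℕ}
    (hu : Alive α x t u) : subExtinction α x t u = dust α x u - t := by
  have h1 : t ≤ dust α x u :=
    hu.2.2.le.trans (death_le_dust h List.suffix_rfl hu.1)
  refine sInf_setOf_le_and (sub_nonneg.2 h1) fun s hs => ?_
  rw [subFrag_eq_zero_iff, sub_le_iff_le_add', ← not_lt,
    ← exists_alive_iff_lt_dust hc h hu.1 (by linarith [hu.2.1])]
  push Not
  rfl

end

section

variable {α : ℝ} {x : Realization}

/-! ### Regular realizations -/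

/-- The time that the dust from the `i`-th sub-block of the first block still needs. -/
def childLife (α : ℝ) (x : Realization) (i : ℕ) : ℝ :=
  ((x []).2 : ℕ → ℝ) i ^ (-α) * life α (subtree [i] x)

/-- The mass of the pairs of blocks of generation `n` that are born within time `δ` of each
other. -/
def pairMass (α : ℝ) (x : Realization) (n : ℕ) (δ : ℝ) : ℝ≥0∞ :=
  ∑' p : Lev n × Lev n, {p : Lev n × Lev n | |birth α x p.1.1 - birth α x p.2.1| < δ}.indicator
    (fun p => ENNReal.ofReal (mass x p.1.1) * ENNReal.ofReal (mass x p.2.1)) p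

/-- The almost sure properties of a fragmentation on which the spine decomposition relies. -/
structure Nice (α : ℝ) (x : Realization) : Prop where
  clock_pos : 0 < (x []).1
  -- Makes the mass of the last fragment drop strictly at every split, so that the times `T_n`
  -- detect all of them.
  lt_one : ∀ i, ((x []).2 : ℕ → ℝ) i < 1
  bdd : BddDeath α x
  mass_tendsto : Tendsto (mass x) cofinite (𝓝 0)
  -- Makes the longest-lived child exist, and makes the birth times along the spine converge to the
  -- extinction time.
  life_tendsto : Tendsto (fun v => mass x v ^ (-α) * life α (subtree v x)) cofinite (𝓝 0)
  childLife_ne : ∀ i j, i ≠ j → 0 < ((x []).2 : ℕ → ℝ) i → 0 < ((x []).2 : ℕ → ℝ) j →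
    childLife α x i ≠ childLife α x j
  -- Excludes that positive mass is lost at one instant; used only for the left limits of the
  -- fragmentation.
  pairMass_lt : ∀ η : ℝ≥0∞, 0 < η → ∃ δ : ℝ, 0 < δ ∧ ∃ᶠ n in atTop, pairMass α x n δ < η

/-- All the fragmentations of blocks are regular. -/
def Good (α : ℝ) (x : Realization) : Prop := ∀ v, Nice α (subtree v x)

lemma Good.toSubtree (h : Good α x) (v : List ℕ) : Good α (subtree v x) := fun u => by
  rw [subtree_subtree]; exact h _

lemma Good.nice (h : Good α x) : Nice α x := by simpa using h []

lemma Good.clockPos (h : Good α x) : ClockPos x := fun u => by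
  simpa [subtree] using (h u).clock_pos

lemma Good.bdd (h : Good α x) : BddDeath α x := h.nice.bdd

lemma Good.life_pos (h : Good α x) : 0 < life α x := Fragmentation.life_pos h.clockPos h.bdd

lemma Good.extinction_eq (h : Good α x) : extinction α x = life α x :=
  extinction_eq_life h.clockPos h.bdd

lemma exists_forall_le_of_tendsto_zero {ι : Type*} {f : ι → ℝ} (hf : Tendsto f cofinite (𝓝 0))
    {i₀ : ι} (h : 0 < f i₀) : ∃ i, ∀ j, f j ≤ f i := by
  have hfin : {j | f i₀ ≤ f j}.Finite := by
    have := hf.eventually_lt_const h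
    rw [eventually_cofinite] at this
    simpa using this
  obtain ⟨i, hi, hmax⟩ := Set.exists_max_image _ f hfin ⟨i₀, show f i₀ ≤ f i₀ from le_rfl⟩
  refine ⟨i, fun j => ?_⟩
  by_cases hj : f i₀ ≤ f j
  · exact hmax j hj
  · exact (not_le.1 hj).le.trans hi

/-! ### The spine -/

/-- The sub-block of the first block that is the last to be reduced to dust. -/
def best (α : ℝ) (x : Realization) : ℕ :=
  sInf {i | ∀ j, childLife α x j ≤ childLife α x i}

/-- The successive last fragments. -/
def spine (α : ℝ) (x : Realization) : ℕ → List ℕ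
  | 0 => []
  | n + 1 => best α (subtree (spine α x n) x) :: spine α x n

lemma exists_pos_child (x : Realization) : ∃ i, 0 < ((x []).2 : ℕ → ℝ) i := by
  by_contra! h
  have h0 : ((x []).2 : ℕ → ℝ) = 0 :=
    funext fun i => le_antisymm (h i) (UnitMassSeq.nonneg _ i)
  have := (x []).2.2.2
  simp [h0] at this

lemma Good.childLife_pos (h : Good α x) {i : ℕ} (hi : 0 < ((x []).2 : ℕ → ℝ) i) :
    0 < childLife α x i :=
  mul_pos (Real.rpow_pos_of_pos hi _) (h.toSubtree [i]).life_pos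

lemma mass_singleton (x : Realization) (i : ℕ) : mass x [i] = ((x []).2 : ℕ → ℝ) i := by
  simp [mass]

lemma dust_singleton (x : Realization) (i : ℕ) :
    dust α x [i] = (x []).1 + childLife α x i := by
  simp [dust, childLife, birth, mass]

lemma dust_cons (x : Realization) (i : ℕ) (u : List ℕ) :
    dust α x (i :: u) = birth α x u + mass x u ^ (-α) *
      ((x u).1 + childLife α (subtree u x) i) := by
  have := dust_append (α := α) x [i] u
  rw [dust_singleton] at this
  simpa [subtree_apply] using this

lemma Good.childLife_le_best (h : Good α x) (j : ℕ) :
    childLife α x j ≤ childLife α x (best α x) := by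
  have hne : {i | ∀ j, childLife α x j ≤ childLife α x i}.Nonempty := by
    obtain ⟨i₀, hi₀⟩ := exists_pos_child x
    refine exists_forall_le_of_tendsto_zero (i₀ := i₀) ?_ (h.childLife_pos hi₀)
    have := h.nice.life_tendsto.comp (
      List.singleton_injective (α := ℕ)).tendsto_cofinite
    refine this.congr fun i => ?_
    simp [childLife, mass]
  exact Nat.sInf_mem hne j

/-- As `-α ≠ 0`, a child without mass has `childLife` equal to `0 ^ (-α) * _ = 0`, and it loses
against any child of positive mass. -/
lemma Good.childLife_best_pos (hα : α < 0) (h : Good α x) : 0 < ((x []).2 : ℕ → ℝ) (best α x) := by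
  obtain ⟨i₀, hi₀⟩ := exists_pos_child x
  have h1 := (h.childLife_pos hi₀).trans_le (h.childLife_le_best i₀)
  refine lt_of_le_of_ne (UnitMassSeq.nonneg _ _) fun h0 => ?_
  rw [childLife, ← h0, Real.zero_rpow (by linarith), zero_mul] at h1
  exact lt_irrefl _ h1

lemma Good.childLife_lt_best (hα : α < 0) (h : Good α x) {j : ℕ} (hj : j ≠ best α x) :
    childLife α x j < childLife α x (best α x) := by
  have hb := h.childLife_best_pos hα
  rcases (UnitMassSeq.nonneg (x []).2 j).eq_or_lt with h0 | h0
  · rw [childLife, ← h0, Real.zero_rpow (by linarith), zero_mul]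
    exact h.childLife_pos hb
  · exact lt_of_le_of_ne (h.childLife_le_best j) (h.nice.childLife_ne _ _ hj h0 hb)

lemma Good.life_eq (hα : α < 0) (h : Good α x) :
    life α x = (x []).1 + childLife α x (best α x) := by
  have hb : 0 < mass x [best α x] := by
    rw [mass_singleton]; exact h.childLife_best_pos hα
  refine le_antisymm (life_le h.clockPos fun w hw => ?_) ?_
  -- Splitting off the last letter exposes the child `[i]` of the root from which the word descends.
  · induction w using List.reverseRecOn with
    | nil =>
      simpa [death, birth, mass] using
        (h.childLife_pos (h.childLife_best_pos hα)).le
    | append_singleton w i _ =>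
      refine (death_le_dust h.bdd (List.suffix_append w [i]) hw).trans ?_
      rw [dust_singleton]
      gcongr
      exact h.childLife_le_best i
  · rw [← dust_singleton, ← dust_nil]
    exact dust_le_dust h.clockPos h.bdd List.nil_suffix hb

lemma Good.dust_best (hα : α < 0) (h : Good α x) (u : List ℕ) :
    dust α x (best α (subtree u x) :: u) = dust α x u := by
  rw [dust_cons, dust, (h.toSubtree u).life_eq hα]
  simp [subtree_apply]

lemma Good.dust_cons_lt (hα : α < 0) (h : Good α x) {u : List ℕ} (hu : 0 < mass x u) {i : ℕ}
    (hi : i ≠ best α (subtree u x)) : dust α x (i :: u) < dust α x u := by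
  rw [← h.dust_best hα u, dust_cons, dust_cons]
  have := (h.toSubtree u).childLife_lt_best hα hi
  have hp : 0 < mass x u ^ (-α) := Real.rpow_pos_of_pos hu _
  gcongr

@[simp] lemma length_spine (α : ℝ) (x : Realization) (n : ℕ) : (spine α x n).length = n := by
  induction n with
  | zero => rfl
  | succ n ih => simp [spine, ih]

lemma spine_suffix (α : ℝ) (x : Realization) {n k : ℕ} (h : n ≤ k) :
    spine α x n <:+ spine α x k := by
  induction k, h using Nat.le_induction with
  | base => exact List.suffix_rfl
  | succ k _ ih => exact ih.trans (List.suffix_cons _ _)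

lemma Good.mass_spine_pos (hα : α < 0) (h : Good α x) (n : ℕ) : 0 < mass x (spine α x n) := by
  induction n with
  | zero => simp [spine, mass]
  | succ n ih =>
    have := (h.toSubtree (spine α x n)).childLife_best_pos hα
    exact mul_pos ih (by simpa [subtree_apply] using this)

lemma Good.dust_spine (hα : α < 0) (h : Good α x) (n : ℕ) :
    dust α x (spine α x n) = life α x := by
  induction n with
  | zero => simp [spine]
  | succ n ih => rw [spine, h.dust_best hα, ih]

lemma Good.dust_le_life (h : Good α x) {u : List ℕ} (hu : 0 < mass x u) :
    dust α x u ≤ life α x := by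
  rw [← dust_nil]
  exact dust_le_dust h.clockPos h.bdd List.nil_suffix hu

/-- Dust times do not increase along a line of descent and never exceed `life`. If `u` attains
`life`, all its ancestors do, and no letter can differ from the best child, which would make the
dust time strictly smaller. -/
lemma Good.eq_spine (hα : α < 0) (h : Good α x) {u : List ℕ} (hu : 0 < mass x u)
    (hd : dust α x u = life α x) : u = spine α x u.length := by
  induction u with
  | nil => rfl
  | cons i u ih =>
    have hu' : 0 < mass x u := mass_pos_of_append (w := [i]) hu
    have h1 : dust α x (i :: u) ≤ dust α x u :=
      dust_le_dust h.clockPos h.bdd (List.suffix_cons _ _) hu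
    have h2 := ih hu' (le_antisymm (h.dust_le_life hu') (hd ▸ h1))
    have hi : i = best α (subtree u x) := by
      by_contra hi
      have := h.dust_cons_lt hα hu' hi
      have := h.dust_le_life hu'
      linarith
    rw [List.length_cons, spine, ← h2, ← hi]

/-- The birth time of the `n`-th last fragment. -/
def spineTime (α : ℝ) (x : Realization) (n : ℕ) : ℝ := birth α x (spine α x n)

lemma spineTime_zero : spineTime α x 0 = 0 := rfl

lemma Good.strictMono_spineTime (hα : α < 0) (h : Good α x) : StrictMono (spineTime α x) :=
  strictMono_nat_of_lt_succ fun n => birth_lt_death h.clockPos (h.mass_spine_pos hα n)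

lemma Good.spineTime_nonneg (h : Good α x) (n : ℕ) : 0 ≤ spineTime α x n :=
  birth_nonneg h.clockPos _

lemma Good.life_sub_spineTime (hα : α < 0) (h : Good α x) (n : ℕ) :
    life α x - spineTime α x n =
      mass x (spine α x n) ^ (-α) * life α (subtree (spine α x n) x) := by
  rw [← h.dust_spine hα n, dust, spineTime]
  ring

lemma Good.spineTime_lt_life (hα : α < 0) (h : Good α x) (n : ℕ) :
    spineTime α x n < life α x := by
  rw [← sub_pos, h.life_sub_spineTime hα]
  exact mul_pos (Real.rpow_pos_of_pos (h.mass_spine_pos hα n) _) (h.toSubtree _).life_pos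

/-- The time left at the birth of a spine block is its own remaining life, which tends to zero along
any sequence of distinct blocks. Therefore the spine covers all of `[0, ζ)`, and `N_ε` is finite. -/
lemma Good.tendsto_spineTime (hα : α < 0) (h : Good α x) :
    Tendsto (spineTime α x) atTop (𝓝 (life α x)) := by
  have hinj : Function.Injective (spine α x) := fun n k hnk => by
    simpa using congrArg List.length hnk
  have h1 := h.nice.life_tendsto.comp hinj.tendsto_cofinite
  rw [Nat.cofinite_eq_atTop] at h1
  have h2 : Tendsto (fun n => life α x - spineTime α x n) atTop (𝓝 0) :=
    h1.congr fun n => (h.life_sub_spineTime hα n).symm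
  simpa using h2.const_sub (life α x)

lemma Good.exists_spineTime (hα : α < 0) (h : Good α x) {t : ℝ} (h0 : 0 ≤ t)
    (ht : t < life α x) : ∃ n, spineTime α x n ≤ t ∧ t < spineTime α x (n + 1) := by
  classical
  have hex : ∃ n, t < spineTime α x n :=
    ((h.tendsto_spineTime hα).eventually_const_lt ht).exists
  obtain ⟨n, hn⟩ : ∃ n, Nat.find hex = n + 1 := by
    refine Nat.exists_eq_succ_of_ne_zero fun hz => ?_
    have := Nat.find_spec hex
    rw [hz, spineTime_zero] at this
    linarith
  exact ⟨n, not_lt.1 (Nat.find_min hex (by omega)), hn ▸ Nat.find_spec hex⟩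

lemma Good.alive_spine_iff (hα : α < 0) (h : Good α x) {t : ℝ} {n : ℕ} :
    Alive α x t (spine α x n) ↔ spineTime α x n ≤ t ∧ t < spineTime α x (n + 1) :=
  ⟨fun ha => ha.2, fun ha => ⟨h.mass_spine_pos hα n, ha⟩⟩

lemma Good.spineTime_unique (hα : α < 0) (h : Good α x) {t : ℝ} {n k : ℕ}
    (hn : spineTime α x n ≤ t ∧ t < spineTime α x (n + 1))
    (hk : spineTime α x k ≤ t ∧ t < spineTime α x (k + 1)) : n = k := by
  have h1 := (h.strictMono_spineTime hα).lt_iff_lt.1 (hn.1.trans_lt hk.2)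
  have h2 := (h.strictMono_spineTime hα).lt_iff_lt.1 (hk.1.trans_lt hn.2)
  omega

/-- For blocks present at time `t`, comparing sub-extinction times is comparing dust times, and only
spine blocks attain the maximum `life`. The spine blocks have disjoint lifetimes, so one index is
left. -/
lemma Good.isLast_iff (hα : α < 0) (h : Good α x) {t : ℝ} {n : ℕ}
    (hn : spineTime α x n ≤ t ∧ t < spineTime α x (n + 1)) (u : List ℕ) :
    IsLast α x t u ↔ u = spine α x n := by
  have hs : Alive α x t (spine α x n) := (h.alive_spine_iff hα).2 hn
  have key : ∀ v, Alive α x t v → subExtinction α x t v ≤ subExtinction α x t (spine α x n) := by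
    intro v hv
    rw [subExtinction_eq h.clockPos h.bdd hv, subExtinction_eq h.clockPos h.bdd hs,
      h.dust_spine hα]
    linarith [h.dust_le_life hv.1]
  constructor
  · rintro ⟨hu, hmax⟩
    have h1 := hmax _ hs
    rw [subExtinction_eq h.clockPos h.bdd hu, subExtinction_eq h.clockPos h.bdd hs,
      h.dust_spine hα] at h1
    have h2 := h.eq_spine hα hu.1 (le_antisymm (h.dust_le_life hu.1) (by linarith))
    rw [h2, h.alive_spine_iff hα] at hu
    rw [h2, h.spineTime_unique hα hu hn]
  · rintro rfl
    exact ⟨hs, key⟩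

lemma Good.lastWellDefined (hα : α < 0) (h : Good α x) : LastWellDefined α x := by
  intro t h0 ht
  rw [h.extinction_eq] at ht
  obtain ⟨n, hn⟩ := h.exists_spineTime hα h0 ht
  exact ⟨spine α x n, (h.isLast_iff hα hn _).2 rfl, fun u hu => (h.isLast_iff hα hn u).1 hu⟩

lemma Good.lastLabel_eq (hα : α < 0) (h : Good α x) {t : ℝ} {n : ℕ}
    (hn : spineTime α x n ≤ t ∧ t < spineTime α x (n + 1)) : lastLabel α x t = spine α x n := by
  have hex : ∃ u, IsLast α x t u := ⟨_, (h.isLast_iff hα hn _).2 rfl⟩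
  rw [lastLabel, dif_pos hex]
  exact (h.isLast_iff hα hn _).1 hex.choose_spec

lemma Good.lastFrag_eq (hα : α < 0) (h : Good α x) {t : ℝ} {n : ℕ}
    (hn : spineTime α x n ≤ t ∧ t < spineTime α x (n + 1)) :
    lastFrag α x t = mass x (spine α x n) := by
  rw [lastFrag, if_pos, h.lastLabel_eq hα hn]
  exact ⟨h.lastWellDefined hα, h.extinction_eq ▸ hn.2.trans (h.spineTime_lt_life hα _)⟩

lemma Good.strictAnti_mass_spine (hα : α < 0) (h : Good α x) :
    StrictAnti fun n => mass x (spine α x n) := by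
  refine strictAnti_nat_of_succ_lt fun n => ?_
  refine mul_lt_of_lt_one_right (h.mass_spine_pos hα n) ?_
  simpa [subtree_apply] using (h (spine α x n)).lt_one (best α (subtree (spine α x n) x))

lemma Good.spineTime_self (hα : α < 0) (h : Good α x) (n : ℕ) :
    spineTime α x n ≤ spineTime α x n ∧ spineTime α x n < spineTime α x (n + 1) :=
  ⟨le_rfl, h.strictMono_spineTime hα n.lt_succ_self⟩

lemma Good.splitTime_eq (hα : α < 0) (h : Good α x) (n : ℕ) :
    splitTime α x n = spineTime α x n := by
  induction n with
  | zero => rfl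
  | succ n ih =>
    rw [splitTime, ih, h.lastFrag_eq hα (h.spineTime_self hα n)]
    have : {t | spineTime α x n ≤ t ∧ lastFrag α x t < mass x (spine α x n)} =
        Set.Ici (spineTime α x (n + 1)) := by
      ext t
      constructor
      · rintro ⟨h1, h2⟩
        by_contra h3
        rw [h.lastFrag_eq hα ⟨h1, not_le.1 h3⟩] at h2
        exact lt_irrefl _ h2
      · intro ht
        have ht' : spineTime α x (n + 1) ≤ t := ht
        refine ⟨(h.strictMono_spineTime hα n.lt_succ_self).le.trans ht', ?_⟩
        by_cases hl : t < life α x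
        · obtain ⟨k, hk⟩ := h.exists_spineTime hα ((h.spineTime_nonneg _).trans ht') hl
          rw [h.lastFrag_eq hα hk]
          refine h.strictAnti_mass_spine hα ?_
          have := (h.strictMono_spineTime hα).lt_iff_lt.1 (ht'.trans_lt hk.2)
          omega
        -- After extinction `lastFrag` is zero, so these times also belong to the set whose infimum
        -- defines `T_{n+1}`.
        · rw [lastFrag, if_neg fun hh => hl (h.extinction_eq ▸ hh.2)]
          exact h.mass_spine_pos hα n
    rw [this, csInf_Ici]

lemma Good.lastFrag_splitTime (hα : α < 0) (h : Good α x) (n : ℕ) :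
    lastFrag α x (splitTime α x n) = mass x (spine α x n) := by
  rw [h.splitTime_eq hα, h.lastFrag_eq hα (h.spineTime_self hα n)]

lemma Good.chainZ_eq (hα : α < 0) (h : Good α x) (n : ℕ) :
    chainZ α x n = mass x (spine α x n) ^ α * (life α x - spineTime α x n) := by
  rw [chainZ, h.lastFrag_splitTime hα, h.extinction_eq, h.splitTime_eq hα]

lemma Good.chainΘ_succ (hα : α < 0) (h : Good α x) (n : ℕ) :
    chainΘ α x (n + 1) = mass x (spine α x (n + 1)) / mass x (spine α x n) := by
  rw [chainΘ, h.lastFrag_splitTime hα, h.lastFrag_splitTime hα]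

/-- The label of the `m`-th sibling of the `i`-th sub-block. -/
def sibIdx (i m : ℕ) : ℕ := if m < i then m else m + 1

lemma sibIdx_ne (i m : ℕ) : sibIdx i m ≠ i := by
  unfold sibIdx; split_ifs <;> omega

lemma sibIdx_injective (i : ℕ) : Function.Injective (sibIdx i) := by
  intro m k h
  unfold sibIdx at h
  split_ifs at h <;> omega

lemma exists_sibIdx {i j : ℕ} (h : j ≠ i) : ∃ m, sibIdx i m = j := by
  rcases lt_or_gt_of_ne h with h | h
  · exact ⟨j, by simp [sibIdx, h]⟩
  · exact ⟨j - 1, by unfold sibIdx; split_ifs <;> omega⟩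

/-- The `m`-th block that splits off when the `n`-th last fragment splits. -/
def sibWord (α : ℝ) (x : Realization) (n m : ℕ) : List ℕ :=
  sibIdx (best α (subtree (spine α x n) x)) m :: spine α x n

lemma Good.chainΔ_succ (hα : α < 0) (h : Good α x) (n m : ℕ) :
    chainΔ α x (n + 1) m = mass x (sibWord α x n m) / mass x (spine α x n) := by
  rw [chainΔ, h.lastFrag_splitTime hα, h.splitTime_eq hα,
    h.lastLabel_eq hα (h.spineTime_self hα _)]
  rfl

lemma Good.prod_chainΘ (hα : α < 0) (h : Good α x) (n : ℕ) :
    ∏ j ∈ Finset.range (n + 1), chainΘ α x j = mass x (spine α x n) := by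
  induction n with
  | zero => simp [chainΘ, spine, mass]
  | succ n ih =>
    rw [Finset.prod_range_succ, ih, h.chainΘ_succ hα, mul_div_cancel₀ _ (h.mass_spine_pos hα n).ne']

/-- The power `α` undoes the power `1 / α`, and the ratios of remaining times telescope. -/
lemma Good.prod_chainY (hα : α < 0) (h : Good α x) (n : ℕ) :
    ∏ j ∈ Finset.range (n + 1), chainY α x j ^ α = life α x - spineTime α x n := by
  have hpow : ∀ z : ℝ, 0 ≤ z → (z ^ (1 / α)) ^ α = z := fun z hz => by
    rw [← Real.rpow_mul hz, one_div_mul_cancel hα.ne, Real.rpow_one]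
  induction n with
  | zero =>
    simp [chainY, h.extinction_eq, spineTime_zero]
    simpa using hpow _ h.life_pos.le
  | succ n ih =>
    have h1 := sub_pos.2 (h.spineTime_lt_life hα n)
    have h2 := sub_pos.2 (h.spineTime_lt_life hα (n + 1))
    rw [Finset.prod_range_succ, ih, chainY, h.extinction_eq, h.splitTime_eq hα, h.splitTime_eq hα,
      hpow _ (by positivity), mul_div_cancel₀ _ h1.ne']

/-! ### The number of splits of the last fragment up to a time before extinction -/

/-- `N_ε`, where it is finite. -/
def spineCount (α ε : ℝ) (x : Realization) : ℕ :=
  sInf {n | life α x - ε < spineTime α x (n + 1)}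

lemma Good.spineTime_le_iff (hα : α < 0) (h : Good α x) {ε : ℝ} (hε : 0 < ε)
    (hl : ε ≤ life α x) (n : ℕ) :
    spineTime α x n ≤ life α x - ε ↔ n ≤ spineCount α ε x := by
  obtain ⟨k, hk⟩ := h.exists_spineTime hα (t := life α x - ε) (by linarith) (by linarith)
  have hc : spineCount α ε x = k := by
    refine le_antisymm (Nat.sInf_le hk.2) (le_csInf ⟨k, hk.2⟩ fun n hn => ?_)
    have := (h.strictMono_spineTime hα).lt_iff_lt.1 (hk.1.trans_lt hn)
    omega
  rw [hc]
  constructor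
  · intro hn
    have := (h.strictMono_spineTime hα).lt_iff_lt.1 (hn.trans_lt hk.2)
    omega
  · intro hn
    exact ((h.strictMono_spineTime hα).monotone hn).trans hk.1

lemma Good.Neps_eq (hα : α < 0) (h : Good α x) {ε : ℝ} (hε : 0 < ε) (hl : ε ≤ life α x) :
    Neps α x ε = ((spineCount α ε x : ℕ∞) : WithBot ℕ∞) := by
  have : {n | splitTime α x n ≤ extinction α x - ε} = Set.Iic (spineCount α ε x) := by
    ext n
    show splitTime α x n ≤ extinction α x - ε ↔ n ≤ _
    rw [h.extinction_eq, h.splitTime_eq hα, h.spineTime_le_iff hα hε hl]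
  rw [Neps, this]
  refine IsLUB.sSup_eq (IsGreatest.isLUB ⟨⟨_, Set.self_mem_Iic, rfl⟩, ?_⟩)
  rintro _ ⟨n, hn, rfl⟩
  have hn' : n ≤ spineCount α ε x := hn
  show ((n : ℕ∞) : WithBot ℕ∞) ≤ ((spineCount α ε x : ℕ∞) : WithBot ℕ∞)
  exact_mod_cast hn'

lemma Good.Neps_eq_bot (hα : α < 0) (h : Good α x) {ε : ℝ} (hl : life α x < ε) :
    Neps α x ε = ⊥ := by
  have : {n | splitTime α x n ≤ extinction α x - ε} = ∅ := by
    ext n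
    show splitTime α x n ≤ extinction α x - ε ↔ False
    rw [h.extinction_eq, h.splitTime_eq hα]
    simp only [iff_false, not_le]
    linarith [h.spineTime_nonneg n]
  rw [Neps, this, Set.image_empty, sSup_empty]

lemma Good.Neps_ne_bot_iff (hα : α < 0) (h : Good α x) {ε : ℝ} (hε : 0 < ε) :
    Neps α x ε ≠ ⊥ ↔ ε ≤ life α x := by
  constructor
  · intro hne
    by_contra! hl
    exact hne (h.Neps_eq_bot hα hl)
  · intro hl
    rw [h.Neps_eq hα hε hl]
    exact WithBot.coe_ne_bot

lemma Good.Neps_ne_top (hα : α < 0) (h : Good α x) {ε : ℝ} (hε : 0 < ε) :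
    Neps α x ε ≠ ((⊤ : ℕ∞) : WithBot ℕ∞) := by
  by_cases hl : ε ≤ life α x
  · rw [h.Neps_eq hα hε hl]
    exact fun hh => ENat.natCast_ne_top _ (WithBot.coe_injective hh)
  · rw [h.Neps_eq_bot hα (not_le.1 hl)]
    exact WithBot.bot_ne_coe

lemma Good.NepsInt_eq (hα : α < 0) (h : Good α x) {ε : ℝ} (hε : 0 < ε) (hl : ε ≤ life α x) :
    NepsInt α x ε = spineCount α ε x := by
  rw [NepsInt, h.Neps_eq hα hε hl]
  rfl

end

section

variable {α : ℝ} {x : Realization}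

/-! ### Convergence of rearrangements -/

/-- Scheffé's argument: `|b - l| = (b - l) + 2 (l - b)⁺`, where the first sum tends to zero by
assumption and the positive part is dominated by the summable `l`. -/
lemma tendsto_l1Dist_of_tendsto {β : Type*} {F : Filter β} {b : β → ℕ → ℝ} {l : ℕ → ℝ}
    (hb : ∀ s, IsMassSeq (b s)) (hl : IsMassSeq l)
    (h : ∀ k, Tendsto (fun s => b s k) F (𝓝 (l k)))
    (hsum : Tendsto (fun s => ∑' k, b s k) F (𝓝 (∑' k, l k))) :
    Tendsto (fun s => l1Dist (b s) l) F (𝓝 0) := by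
  have hpos : ∀ s, Summable fun k => max (l k - b s k) 0 := fun s =>
    hl.2.2.of_nonneg_of_le (fun k => le_max_right _ _)
      fun k => max_le (sub_le_self _ ((hb s).2.1 k)) (hl.2.1 k)
  have h1 : ∀ s, l1Dist (b s) l =
      ∑' k, b s k - ∑' k, l k + 2 * ∑' k, max (l k - b s k) 0 := by
    intro s
    rw [← (hb s).2.2.tsum_sub hl.2.2, ← tsum_mul_left,
      ← ((hb s).2.2.sub hl.2.2).tsum_add ((hpos s).mul_left 2)]
    refine tsum_congr fun k => ?_
    rcases le_total (b s k) (l k) with h | h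
    · rw [abs_of_nonpos (sub_nonpos.2 h), max_eq_left (sub_nonneg.2 h)]; ring
    · rw [abs_of_nonneg (sub_nonneg.2 h), max_eq_right (sub_nonpos.2 h)]; ring
  have h2 : Tendsto (fun s => ∑' k, max (l k - b s k) 0) F (𝓝 (∑' _ : ℕ, (0 : ℝ))) := by
    refine tendsto_tsum_of_dominated_convergence hl.2.2 (fun k => ?_) (.of_forall fun s k => ?_)
    · simpa using ((h k).const_sub (l k)).max (tendsto_const_nhds (x := (0 : ℝ)))
    · rw [Real.norm_of_nonneg (le_max_right _ _)]
      exact max_le (sub_le_self _ ((hb s).2.1 k)) (hl.2.1 k)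
  simp_rw [h1]
  simpa using (hsum.sub_const (∑' k, l k)).add (h2.const_mul 2)

lemma encard_subtype_and {ι : Type*} (p q : ι → Prop) :
    {v : {u // p u} | q v.1}.encard = {u | p u ∧ q u}.encard :=
  Set.encard_congr
    { toFun := fun v => ⟨v.1.1, v.1.2, v.2⟩
      invFun := fun v => ⟨⟨v.1, v.2.1⟩, v.2.2⟩
      left_inv := fun _ => rfl
      right_inv := fun _ => rfl }

/-- Only finitely many members exceed `y / 2`, and eventually the two families agree on those. At
levels `z ≥ y / 2` the two rearrangements are then indistinguishable: both terms are at most `y /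
2`, or they are equal. -/
lemma tendsto_decRearr_of_eventually {β ι : Type*} {F : Filter β} {m : ι → ℝ}
    (hm1 : ∀ u, m u ≤ 1) (hm : Tendsto m cofinite (𝓝 0)) {A : β → ι → Prop} {A₀ : ι → Prop}
    (hA : ∀ u, ∀ᶠ s in F, A s u ↔ A₀ u) (k : ℕ) :
    Tendsto (fun s => decRearr (fun v : {u // A s u} => m v) k) F
      (𝓝 (decRearr (fun v : {u // A₀ u} => m v) k)) := by
  rw [Metric.tendsto_nhds]
  intro y hy
  have hfin : {u | y / 2 < m u}.Finite := by
    have := hm.eventually_le_const (half_pos hy)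
    rw [eventually_cofinite] at this
    simpa using this
  have hev : ∀ᶠ s in F, ∀ u ∈ {u | y / 2 < m u}, (A s u ↔ A₀ u) :=
    (eventually_all_finite hfin).2 fun u _ => hA u
  filter_upwards [hev] with s hs
  have key : ∀ z, y / 2 ≤ z → (decRearr (fun v : {u // A s u} => m v) k ≤ z ↔
      decRearr (fun v : {u // A₀ u} => m v) k ≤ z) := by
    intro z hz
    rw [decRearr_le_iff (a := fun v : {u // A s u} => m v) (fun u => hm1 u.1) (by linarith),
      decRearr_le_iff (a := fun v : {u // A₀ u} => m v) (fun u => hm1 u.1) (by linarith),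
      encard_subtype_and (A s) (fun u => z < m u), encard_subtype_and A₀ (fun u => z < m u)]
    have : {u | A s u ∧ z < m u} = {u | A₀ u ∧ z < m u} := by
      ext u
      exact and_congr_left fun hu => hs u (lt_of_le_of_lt hz hu)
    rw [this]
  have n1 := decRearr_nonneg (fun v : {u // A s u} => m v) k
  have n2 := decRearr_nonneg (fun v : {u // A₀ u} => m v) k
  rw [Real.dist_eq, abs_lt]
  set p := decRearr (fun v : {u // A s u} => m v) k
  set q := decRearr (fun v : {u // A₀ u} => m v) k
  rcases le_or_gt p (y / 2) with h | h
  · have := (key _ le_rfl).1 h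
    constructor <;> linarith
  · have h1 := (key _ h.le).1 le_rfl
    have h2 : y / 2 < q := by
      by_contra! hq
      exact absurd ((key _ le_rfl).2 hq) (not_le.2 h)
    have h3 := (key _ h2.le).2 le_rfl
    constructor <;> linarith

/-- The total mass of the blocks with a given property. -/
def massOf (x : Realization) (A : List ℕ → Prop) : ℝ≥0∞ :=
  ∑' v : {u // A u}, ENNReal.ofReal (mass x v)

lemma isMassSeq_massOf {A : List ℕ → Prop} (h : massOf x A ≠ ∞) :
    IsMassSeq (decRearr fun v : {u // A u} => mass x v) :=
  isMassSeq_decRearr (M := 1) (fun v => mass_le_one x v.1) h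

lemma tsum_decRearr_eq_massOf {A : List ℕ → Prop} :
    ∑' k, decRearr (fun v : {u // A u} => mass x v) k = (massOf x A).toReal := by
  rw [massOf, ← tsum_ofReal_decRearr (a := fun v : {u // A u} => mass x v)
    (fun v => mass_le_one x v.1), ENNReal.tsum_toReal_eq
    (fun _ => ENNReal.ofReal_ne_top)]
  exact tsum_congr fun k => (ENNReal.toReal_ofReal (decRearr_nonneg _ _)).symm

lemma tendsto_l1Dist_decRearr {β : Type*} {F : Filter β}
    (hm : Tendsto (mass x) cofinite (𝓝 0)) {A : β → List ℕ → Prop} {A₀ : List ℕ → Prop}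
    (hA : ∀ u, ∀ᶠ s in F, A s u ↔ A₀ u) (hfin : ∀ s, massOf x (A s) ≤ 1)
    (hfin₀ : massOf x A₀ ≤ 1) (hsum : Tendsto (fun s => massOf x (A s)) F (𝓝 (massOf x A₀))) :
    Tendsto (fun s => l1Dist (decRearr fun v : {u // A s u} => mass x v)
      (decRearr fun v : {u // A₀ u} => mass x v)) F (𝓝 0) := by
  have hne : ∀ {A : List ℕ → Prop}, massOf x A ≤ 1 → massOf x A ≠ ∞ :=
    fun h => (h.trans_lt ENNReal.one_lt_top).ne
  refine tendsto_l1Dist_of_tendsto (fun s => isMassSeq_massOf (hne (hfin s)))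
    (isMassSeq_massOf (hne hfin₀))
    (fun k => tendsto_decRearr_of_eventually (mass_le_one x) hm hA k) ?_
  simp_rw [tsum_decRearr_eq_massOf]
  exact (ENNReal.tendsto_toReal (hne hfin₀)).comp hsum

/-- Lower semicontinuity: a finite partial sum already exceeds `C`, and its finitely many members
eventually belong to `A s`. No domination is needed, so only the upper bounds on the limit of the
mass require work. -/
lemma eventually_lt_massOf {β : Type*} {F : Filter β} {A : β → List ℕ → Prop}
    {A₀ : List ℕ → Prop} (hA : ∀ u, ∀ᶠ s in F, A s u ↔ A₀ u) {C : ℝ≥0∞}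
    (hC : C < massOf x A₀) : ∀ᶠ s in F, C < massOf x (A s) := by
  rw [massOf, ENNReal.tsum_eq_iSup_sum, lt_iSup_iff] at hC
  obtain ⟨S, hS⟩ := hC
  have hev : ∀ᶠ s in F, ∀ u ∈ S, (A s u.1 ↔ A₀ u.1) :=
    (eventually_all_finset S).2 fun u _ => hA u.1
  filter_upwards [hev] with s hs
  refine hS.trans_le ?_
  let i : S → {u // A s u} := fun v => ⟨v.1.1, (hs v.1 v.2).2 v.1.2⟩
  have hi : Function.Injective i := by
    intro u v huv
    have h1 : u.1.1 = v.1.1 := congrArg (fun z => z.1) huv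
    exact Subtype.ext (Subtype.ext h1)
  rw [← Finset.sum_coe_sort, ← tsum_fintype (L := .unconditional _)]
  exact ENNReal.tsum_comp_le_tsum_of_injective hi
    (fun v : {u // A s u} => ENNReal.ofReal (mass x v))

/-! ### Path regularity -/

/-- The block `u` is present just before time `t`. -/
def AliveLeft (α : ℝ) (x : Realization) (t : ℝ) (u : List ℕ) : Prop :=
  0 < mass x u ∧ birth α x u < t ∧ t ≤ death α x u

lemma isAntichainSuffix_aliveLeft (h : ClockPos x) (t : ℝ) :
    IsAntichainSuffix {u | AliveLeft α x t u} := by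
  intro u hu v hv huv
  by_contra hne
  have hu' : AliveLeft α x t u := hu
  have hv' : AliveLeft α x t v := hv
  have := death_le_birth_of_suffix (α := α) h huv hne
  linarith [hu'.2.2, hv'.2.1]

lemma exists_aliveLeft_suffix {t : ℝ} {u v : List ℕ} (huv : u <:+ v)
    (hv : 0 < mass x v) (h1 : birth α x u < t) (h2 : t ≤ death α x v) :
    ∃ w, u <:+ w ∧ w <:+ v ∧ AliveLeft α x t w := by
  obtain ⟨w, rfl⟩ := huv
  induction w with
  | nil => exact ⟨u, List.suffix_rfl, List.suffix_rfl, hv, h1, h2⟩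
  | cons i w ih =>
    by_cases hb : birth α x (i :: w ++ u) < t
    · exact ⟨_, List.suffix_append _ _, List.suffix_rfl, hv, hb, h2⟩
    · obtain ⟨z, hz1, hz2, hz3⟩ := ih (mass_pos_of_append (w := [i]) hv) (not_lt.1 hb)
      exact ⟨z, hz1, hz2.trans (List.suffix_cons _ _), hz3⟩

lemma massOf_alive_le_one (h : ClockPos x) (t : ℝ) : massOf x (Alive α x t) ≤ 1 :=
  tsum_antichain_le_one x (isAntichainSuffix_alive h t)

lemma massOf_aliveLeft_le_one (h : ClockPos x) (t : ℝ) : massOf x (AliveLeft α x t) ≤ 1 :=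
  tsum_antichain_le_one x (isAntichainSuffix_aliveLeft h t)

lemma isMassSeq_frag (h : ClockPos x) (t : ℝ) : IsMassSeq (frag α x t) :=
  isMassSeq_massOf ((massOf_alive_le_one h t).trans_lt ENNReal.one_lt_top).ne

lemma massOf_alive_le_levMass (h : ClockPos x) (s : ℝ) (n k : ℕ) (hnk : n ≤ k) :
    ∑' v : {v // v ∈ {u | Alive α x s u} ∧ v.length ≤ n}, ENNReal.ofReal (mass x v) ≤
      levMass x k (fun u => ∃ v, (Alive α x s v ∧ v.length ≤ n) ∧ v <:+ u) := by
  exact tsum_antichain_le (A := {v | v ∈ {u | Alive α x s u} ∧ v.length ≤ n}) x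
    (fun u hu v hv => isAntichainSuffix_alive h s u hu.1 v hv.1) k (fun u hu => hu.2.trans hnk)

lemma massOf_alive_antitone (h : ClockPos x) {t s : ℝ} (h0 : 0 ≤ t) (hts : t ≤ s) :
    massOf x (Alive α x s) ≤ massOf x (Alive α x t) := by
  refine tsum_mass_le_of_forall_length (A := {u | Alive α x s u}) x fun n => ?_
  refine (massOf_alive_le_levMass h s n n le_rfl).trans (le_trans (levMass_mono x n ?_)
    (levMass_exists_suffix_le x n {u | Alive α x t u}))
  rintro u - ⟨v, ⟨hv, -⟩, hvu⟩
  obtain ⟨w, -, hw, ha⟩ := exists_alive_suffix (α := α) (t := t) List.nil_suffix hv.1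
    (by simpa [birth] using h0) (hts.trans_lt hv.2.2)
  exact ⟨w, ha, hw.trans hvu⟩

lemma levMass_and_mass_pos (x : Realization) (n : ℕ) (p : List ℕ → Prop) :
    levMass x n p ≤ levMass x n (fun u => p u ∧ 0 < mass x u) := by
  simp_rw [levMass_eq_indicator]
  refine ENNReal.tsum_le_tsum fun u => ?_
  rcases (mass_nonneg x u.1).eq_or_lt with h | h
  · simp [Set.indicator, ← h]
  · by_cases hp : p u.1 <;> simp [Set.indicator, h, hp]

/-- The square is a sum over pairs of words, and two birth times in `(s, t)` differ by less than `t
- s`. -/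
lemma levMass_sq_le_pairMass {s t δ : ℝ} (h : t - s ≤ δ) (n : ℕ) :
    levMass x n (fun u => s < birth α x u ∧ birth α x u < t) ^ 2 ≤ pairMass α x n δ := by
  rw [levMass_eq_indicator, sq, ← ENNReal.tsum_mul_right, pairMass, ENNReal.tsum_prod']
  refine ENNReal.tsum_le_tsum fun u => ?_
  rw [← ENNReal.tsum_mul_left]
  refine ENNReal.tsum_le_tsum fun v => ?_
  by_cases hu : s < birth α x u.1 ∧ birth α x u.1 < t
  · by_cases hv : s < birth α x v.1 ∧ birth α x v.1 < t
    · have : |birth α x u.1 - birth α x v.1| < δ := by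
        rw [abs_lt]; constructor <;> linarith
      simp [Set.indicator, hu, hv, this]
    · simp [Set.indicator, hv]
  · simp [Set.indicator, hu]

/-- Replace the blocks present at `s` by their descendants in a far generation `N`. Those born at
`t` or later descend from a block present just before `t`; the others are born in `(s, t)`, and the
square of their mass is below `η ^ 2` by `pairMass_lt`. -/
lemma exists_massOf_alive_le (h : Nice α x) (hc : ClockPos x) (t : ℝ) {η : ℝ≥0} (hη : 0 < η) :
    ∃ δ > 0, ∀ s, t - δ < s → s < t →
      massOf x (Alive α x s) ≤ massOf x (AliveLeft α x t) + η := by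
  obtain ⟨δ, hδ, hfreq⟩ := h.pairMass_lt ((η : ℝ≥0∞) ^ 2) (by positivity)
  refine ⟨δ, hδ, fun s hs1 hs2 => ?_⟩
  refine tsum_mass_le_of_forall_length (A := {u | Alive α x s u}) x fun n => ?_
  -- Generation `N` exceeds `n`, so the descendants are strict and are born after their ancestor has
  -- split, hence after `s`.
  obtain ⟨N, hN, hpair⟩ := frequently_atTop.1 hfreq (n + 1)
  have h2 : levMass x N (fun u => s < birth α x u ∧ birth α x u < t) ≤ η := by
    by_contra! hlt
    refine absurd ((levMass_sq_le_pairMass (α := α) (x := x) (s := s) (t := t) (δ := δ)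
      (by linarith) N).trans_lt hpair) (not_lt.2 ?_)
    gcongr
  refine (massOf_alive_le_levMass hc s n N (by omega)).trans ?_
  refine (levMass_and_mass_pos _ _ _).trans ?_
  refine le_trans (levMass_mono x N (q := fun u => (∃ v ∈ {u | AliveLeft α x t u}, v <:+ u) ∨
    (s < birth α x u ∧ birth α x u < t)) ?_) ?_
  · rintro u hlu ⟨⟨v, ⟨hv, hlen⟩, hvu⟩, hu⟩
    by_cases hb : birth α x u < t
    · have hne : v ≠ u := by rintro rfl; omega
      exact Or.inr ⟨hv.2.2.trans_le (death_le_birth_of_suffix hc hvu hne), hb⟩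
    · obtain ⟨w, -, hw, ha⟩ := exists_aliveLeft_suffix (α := α) (t := t) hvu hu
        (hv.2.1.trans_lt hs2) ((not_lt.1 hb).trans (birth_le_death hc u))
      exact Or.inl ⟨w, ha, hw⟩
  · exact (levMass_or_le x N _ _).trans
      (add_le_add (levMass_exists_suffix_le x N {u | AliveLeft α x t u}) h2)

lemma tendsto_massOf_left (h : Nice α x) (hc : ClockPos x) (t : ℝ)
    (hA : ∀ u, ∀ᶠ s in 𝓝[<] t, Alive α x s u ↔ AliveLeft α x t u) :
    Tendsto (fun s => massOf x (Alive α x s)) (𝓝[<] t) (𝓝 (massOf x (AliveLeft α x t))) := by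
  refine tendsto_order.2 ⟨fun C hC => eventually_lt_massOf hA hC, fun C hC => ?_⟩
  obtain ⟨η, hη, hlt⟩ := ENNReal.lt_iff_exists_add_pos_lt.1 hC
  obtain ⟨δ, hδ, hle⟩ := exists_massOf_alive_le h hc t hη
  filter_upwards [Ioo_mem_nhdsLT (show t - δ < t by linarith)] with s hs
  exact (hle s hs.1 hs.2).trans_lt hlt

/-- From the right, the upper bound is just the monotonicity of the mass in time. -/
lemma tendsto_massOf_right (hc : ClockPos x) {t : ℝ} (ht : 0 ≤ t)
    (hA : ∀ u, ∀ᶠ s in 𝓝[>] t, Alive α x s u ↔ Alive α x t u) :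
    Tendsto (fun s => massOf x (Alive α x s)) (𝓝[>] t) (𝓝 (massOf x (Alive α x t))) := by
  refine tendsto_order.2 ⟨fun C hC => eventually_lt_massOf hA hC, fun C hC => ?_⟩
  filter_upwards [self_mem_nhdsWithin] with s hs
  exact (massOf_alive_antitone hc ht (le_of_lt hs)).trans_lt hC

lemma eventually_alive_right (t : ℝ) (u : List ℕ) :
    ∀ᶠ s in 𝓝[>] t, Alive α x s u ↔ Alive α x t u := by
  have h1 : ∀ᶠ s in 𝓝[>] t, birth α x u ≤ s ↔ birth α x u ≤ t := by
    by_cases hb : birth α x u ≤ t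
    · filter_upwards [self_mem_nhdsWithin] with s hs
      exact iff_of_true (hb.trans (le_of_lt hs)) hb
    · filter_upwards [Ioo_mem_nhdsGT (not_le.1 hb)] with s hs
      exact iff_of_false (not_le.2 hs.2) hb
  have h2 : ∀ᶠ s in 𝓝[>] t, s < death α x u ↔ t < death α x u := by
    by_cases hb : t < death α x u
    · filter_upwards [Ioo_mem_nhdsGT hb] with s hs
      exact iff_of_true hs.2 hb
    · filter_upwards [self_mem_nhdsWithin] with s hs
      exact iff_of_false (not_lt.2 ((not_lt.1 hb).trans (le_of_lt hs))) hb
  filter_upwards [h1, h2] with s hs1 hs2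
  rw [Alive, Alive, hs1, hs2]

lemma eventually_alive_left (t : ℝ) (u : List ℕ) :
    ∀ᶠ s in 𝓝[<] t, Alive α x s u ↔ AliveLeft α x t u := by
  have h1 : ∀ᶠ s in 𝓝[<] t, birth α x u ≤ s ↔ birth α x u < t := by
    by_cases hb : birth α x u < t
    · filter_upwards [Ioo_mem_nhdsLT hb] with s hs
      exact iff_of_true hs.1.le hb
    · filter_upwards [self_mem_nhdsWithin] with s hs
      exact iff_of_false (not_le.2 (lt_of_lt_of_le hs (not_lt.1 hb))) hb
  have h2 : ∀ᶠ s in 𝓝[<] t, s < death α x u ↔ t ≤ death α x u := by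
    by_cases hb : t ≤ death α x u
    · filter_upwards [self_mem_nhdsWithin] with s hs
      exact iff_of_true (lt_of_lt_of_le hs hb) hb
    · filter_upwards [Ioo_mem_nhdsLT (not_le.1 hb)] with s hs
      exact iff_of_false (not_lt.2 hs.1.le) hb
  filter_upwards [h1, h2] with s hs1 hs2
  rw [Alive, AliveLeft, hs1, hs2]

/-- The fragmentation is right-continuous for the `ℓ¹`-distance. -/
lemma Good.tendsto_frag_right (h : Good α x) {t : ℝ} (ht : 0 ≤ t) :
    Tendsto (fun s => l1Dist (frag α x s) (frag α x t)) (𝓝[>] t) (𝓝 0) :=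
  tendsto_l1Dist_decRearr h.nice.mass_tendsto (eventually_alive_right t)
    (massOf_alive_le_one h.clockPos) (massOf_alive_le_one h.clockPos t)
    (tendsto_massOf_right h.clockPos ht (eventually_alive_right t))

/-- The fragmentation has left limits for the `ℓ¹`-distance. -/
lemma Good.exists_tendsto_frag_left (h : Good α x) (t : ℝ) :
    ∃ l, IsMassSeq l ∧ Tendsto (fun s => l1Dist (frag α x s) l) (𝓝[<] t) (𝓝 0) :=
  ⟨decRearr fun v : {u // AliveLeft α x t u} => mass x v,
    isMassSeq_massOf ((massOf_aliveLeft_le_one h.clockPos t).trans_lt ENNReal.one_lt_top).ne,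
    tendsto_l1Dist_decRearr h.nice.mass_tendsto (eventually_alive_left t)
      (massOf_alive_le_one h.clockPos) (massOf_aliveLeft_le_one h.clockPos t)
      (tendsto_massOf_left h.nice h.clockPos t (eventually_alive_left t))⟩

lemma frag_eq_zero_of_life_le (h : BddDeath α x) {t : ℝ} (ht : life α x ≤ t) :
    frag α x t = 0 :=
  frag_eq_zero_iff.2 fun _ hu => absurd (hu.2.2.trans_le ((death_le_life h hu.1).trans ht))
    (lt_irrefl _)

lemma alive_zero_iff (h : ClockPos x) {u : List ℕ} : Alive α x 0 u ↔ u = [] := by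
  have h0 : Alive α x 0 [] := by
    refine ⟨by simp [mass], le_rfl, ?_⟩
    exact birth_lt_death h (u := []) (by simp [mass])
  exact ⟨fun hu => (Alive.eq_of_suffix h h0 hu List.nil_suffix).symm, fun hu => hu ▸ h0⟩

lemma frag_zero (h : ClockPos x) : frag α x 0 = oneState := by
  have hset : ∀ y : ℝ, y < 1 → {u : {u // Alive α x 0 u} | y < mass x u}.encard = 1 := by
    intro y hy
    rw [Set.encard_eq_one]
    refine ⟨⟨[], (alive_zero_iff h).2 rfl⟩, ?_⟩
    ext ⟨u, hu⟩
    obtain rfl := (alive_zero_iff h).1 hu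
    simp [mass, hy]
  have hb : ∀ u : {u // Alive α x 0 u}, mass x u ≤ 1 := fun u => mass_le_one x u.1
  funext k
  refine le_antisymm ?_ ?_
  · unfold oneState
    rcases k with _ | k
    · rw [frag, decRearr_le_iff hb (by simp)]
      have : {u : {u // Alive α x 0 u} | (Pi.single 0 1 : ℕ → ℝ) 0 < mass x u} = ∅ := by
        ext u
        simpa using hb u
      rw [this]
      simp
    · rw [frag, decRearr_le_iff hb (by simp)]
      simp [hset 0 one_pos]
  · unfold oneState
    rcases k with _ | k
    · refine le_of_forall_lt fun y hy => ?_
      rcases lt_or_ge y 0 with h0 | h0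
      · exact h0.trans_le (decRearr_nonneg _ _)
      · rw [frag, lt_decRearr_iff hb h0, hset y (by simpa using hy)]
        simp
    · simpa [frag] using decRearr_nonneg (fun u : {u // Alive α x 0 u} => mass x u) (k + 1)

lemma l1Dist_self (s : ℕ → ℝ) : l1Dist s s = 0 := by simp [l1Dist]

lemma isMassSeq_zero : IsMassSeq 0 := ⟨antitone_const, fun _ => le_rfl, summable_zero⟩

/-- Reversal exchanges the two sides: left-continuity at `r` is right-continuity of the
fragmentation at `c - r`, and right limits come from its left limits. From `c` on, the right limits
are zero. -/
lemma Good.isRevPath (h : Good α x) {c : ℝ} (hc : life α x ≤ c) :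
    IsRevPath c (revPath α x c) := by
  have hc0 : 0 < c := h.life_pos.trans_le hc
  have hlate : ∀ r : ℝ≥0, c < r → revPath α x c r = 0 := fun r hr => by
    simp [revPath, hr]
  refine ⟨fun r => ?_, ?_, ?_, hlate, fun r => ?_, fun r => ?_⟩
  · unfold revPath
    split_ifs
    · exact isMassSeq_frag h.clockPos _
    · exact isMassSeq_zero
  · simp [revPath, hc0.le, frag_eq_zero_of_life_le h.bdd hc]
  · simp [revPath, Real.coe_toNNReal c hc0.le, frag_zero h.clockPos]
  · rcases le_or_gt (r : ℝ) c with hr | hr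
    · have h1 : Tendsto (fun r' : ℝ≥0 => c - (r' : ℝ)) (𝓝[<] r) (𝓝[>] (c - r)) := by
        refine tendsto_nhdsWithin_iff.2 ⟨?_, ?_⟩
        · exact ((NNReal.continuous_coe.tendsto r).const_sub c).mono_left nhdsWithin_le_nhds
        · filter_upwards [self_mem_nhdsWithin] with r' hr'
          have : (r' : ℝ) < r := NNReal.coe_lt_coe.2 hr'
          show c - (r : ℝ) < c - r'
          linarith
      refine ((h.tendsto_frag_right (sub_nonneg.2 hr)).comp h1).congr' ?_
      filter_upwards [self_mem_nhdsWithin] with r' hr'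
      have : (r' : ℝ) < r := NNReal.coe_lt_coe.2 hr'
      simp [revPath, hr, this.le.trans hr]
    · refine tendsto_const_nhds.congr' ?_
      have : ∀ᶠ r' : ℝ≥0 in 𝓝[<] r, c < r' :=
        ((NNReal.continuous_coe.tendsto r).mono_left nhdsWithin_le_nhds).eventually_const_lt hr
      filter_upwards [this] with r' hr'
      rw [hlate r hr, hlate r' hr', l1Dist_self]
  · rcases lt_or_ge (r : ℝ) c with hr | hr
    · obtain ⟨l, hl, ht⟩ := h.exists_tendsto_frag_left (c - r)
      refine ⟨l, hl, ?_⟩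
      have h1 : Tendsto (fun r' : ℝ≥0 => c - (r' : ℝ)) (𝓝[>] r) (𝓝[<] (c - r)) := by
        refine tendsto_nhdsWithin_iff.2 ⟨?_, ?_⟩
        · exact ((NNReal.continuous_coe.tendsto r).const_sub c).mono_left nhdsWithin_le_nhds
        · filter_upwards [self_mem_nhdsWithin] with r' hr'
          have : (r : ℝ) < r' := NNReal.coe_lt_coe.2 hr'
          show c - (r' : ℝ) < c - r
          linarith
      refine (ht.comp h1).congr' ?_
      have : ∀ᶠ r' : ℝ≥0 in 𝓝[>] r, (r' : ℝ) < c :=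
        ((NNReal.continuous_coe.tendsto r).mono_left nhdsWithin_le_nhds).eventually_lt_const hr
      filter_upwards [this] with r' hr'
      simp [revPath, hr'.le]
    · refine ⟨0, isMassSeq_zero, tendsto_const_nhds.congr' ?_⟩
      filter_upwards [self_mem_nhdsWithin] with r' hr'
      have : (r : ℝ) < r' := NNReal.coe_lt_coe.2 hr'
      rw [hlate r' (hr.trans_lt this), l1Dist_self]

end

section

variable {α : ℝ}

/-! ### Measurability -/

section Measurability

lemma measurable_mass : ∀ u : List ℕ, Measurable fun x : Realization => mass x u
  | [] => measurable_const
  | i :: u => (measurable_mass u).mul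
      ((measurable_pi_apply i).comp (measurable_subtype_coe.comp
        (measurable_snd.comp (measurable_pi_apply u))))

lemma measurable_clock (u : List ℕ) : Measurable fun x : Realization => (x u).1 :=
  measurable_fst.comp (measurable_pi_apply u)

lemma measurable_birth : ∀ u : List ℕ, Measurable fun x : Realization => birth α x u
  | [] => measurable_const
  | _ :: u => (measurable_birth u).add (((measurable_mass u).pow_const _).mul (measurable_clock u))

lemma measurable_death (u : List ℕ) : Measurable fun x : Realization => death α x u :=
  measurable_birth (0 :: u)

lemma measurable_subtree (v : List ℕ) : Measurable (subtree v) :=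
  measurable_pi_lambda _ fun _ => measurable_pi_apply _

lemma measurable_life : Measurable fun x : Realization => life α x := by
  classical
  refine Measurable.iSup fun w => ?_
  exact Measurable.ite (measurableSet_lt measurable_const (measurable_mass w))
    (measurable_death w) measurable_const

lemma measurable_childLife (i : ℕ) : Measurable fun x : Realization => childLife α x i := by
  have : (fun x : Realization => childLife α x i) =
      fun x => mass x [i] ^ (-α) * life α (subtree [i] x) := by
    funext x; rw [childLife, mass_singleton]
  rw [this]
  exact ((measurable_mass _).pow_const _).mul (measurable_life.comp (measurable_subtree _))

lemma measurable_nat_sInf {β : Type*} [MeasurableSpace β] {p : β → ℕ → Prop}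
    (hp : ∀ i, MeasurableSet {b | p b i}) : Measurable fun b => sInf {i | p b i} := by
  refine measurable_to_countable' fun k => ?_
  have : (fun b => sInf {i | p b i}) ⁻¹' {k} =
      -- The last term accounts for the convention `sInf ∅ = 0`.
      ({b | p b k} ∩ ⋂ j ∈ Finset.range k, {b | p b j}ᶜ) ∪
        (if k = 0 then ⋂ j, {b | p b j}ᶜ else ∅) := by
    ext b
    by_cases hne : {i | p b i}.Nonempty
    · have h1 : ¬ ∀ j, ¬ p b j := by
        obtain ⟨j, hj⟩ := hne
        exact fun h => h j hj
      have h2 : b ∉ (if k = 0 then ⋂ j, {b | p b j}ᶜ else ∅) := by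
        split_ifs
        · simpa using h1
        · simp
      rw [Set.mem_union, or_iff_left h2]
      simp only [Set.mem_preimage, Set.mem_singleton_iff, Set.mem_inter_iff, Set.mem_iInter,
        Finset.mem_range, Set.mem_compl_iff]
      constructor
      · rintro rfl
        exact ⟨Nat.sInf_mem hne, fun j hj => Nat.notMem_of_lt_sInf hj⟩
      · rintro ⟨h3, h4⟩
        refine le_antisymm (Nat.sInf_le h3) (le_csInf hne fun j hj => ?_)
        by_contra! hlt
        exact h4 j hlt hj
    · have h1 : ∀ j, ¬ p b j := fun j hj => hne ⟨j, hj⟩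
      have h2 : {i | p b i} = ∅ := Set.not_nonempty_iff_eq_empty.1 hne
      have h3 : sInf {i | p b i} = 0 := by rw [h2]; simp
      simp only [Set.mem_preimage, h3, Set.mem_singleton_iff, Set.mem_union, Set.mem_inter_iff]
      constructor
      · rintro rfl
        right
        simpa using h1
      · rintro (h | h)
        · exact absurd h.1 (h1 k)
        · split_ifs at h with hk
          · exact hk.symm
          · simp at h
  rw [this]
  refine ((hp k).inter (Finset.measurableSet_biInter _ fun j _ => (hp j).compl)).union ?_
  split_ifs
  · exact MeasurableSet.iInter fun j => (hp j).compl
  · exact MeasurableSet.empty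

lemma measurable_best : Measurable fun x : Realization => best α x := by
  refine measurable_nat_sInf fun i => ?_
  have : {x : Realization | ∀ j, childLife α x j ≤ childLife α x i} =
      ⋂ j, {x | childLife α x j ≤ childLife α x i} := by
    ext; simp
  rw [this]
  exact MeasurableSet.iInter fun j => measurableSet_le (measurable_childLife j)
    (measurable_childLife i)

/-- A family of measurable functions, evaluated at a discrete random index, is measurable. -/
lemma measurable_of_discrete_index {β κ γ : Type*} [MeasurableSpace β] [MeasurableSpace γ]
    [Countable κ] {g : β → κ} (hg : ∀ w, MeasurableSet {b | g b = w}) {f : κ → β → γ}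
    (hf : ∀ w, Measurable (f w)) : Measurable fun b => f (g b) b := by
  intro S hS
  have : (fun b => f (g b) b) ⁻¹' S = ⋃ w, {b | g b = w} ∩ f w ⁻¹' S := by
    ext b; simp
  rw [this]
  exact MeasurableSet.iUnion fun w => (hg w).inter (hf w hS)

lemma measurableSet_spine (n : ℕ) :
    ∀ w, MeasurableSet {x : Realization | spine α x n = w} := by
  induction n with
  | zero => intro w; simp [spine]
  | succ n ih =>
    intro w
    have hb : Measurable fun x : Realization => best α (subtree (spine α x n) x) :=
      measurable_of_discrete_index (f := fun w x => best α (subtree w x)) ih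
        fun w => measurable_best.comp (measurable_subtree w)
    cases w with
    | nil => simp [spine]
    | cons i w =>
      have : {x : Realization | spine α x (n + 1) = i :: w} =
          {x | best α (subtree (spine α x n) x) = i} ∩ {x | spine α x n = w} := by
        ext x; simp [spine]
      rw [this]
      exact (hb (measurableSet_singleton i)).inter (ih w)

lemma measurable_spineTime (n : ℕ) : Measurable fun x : Realization => spineTime α x n :=
  measurable_of_discrete_index (f := fun w x => birth α x w) (measurableSet_spine n) measurable_birth

lemma measurable_mass_spine (n : ℕ) : Measurable fun x : Realization => mass x (spine α x n) :=
  measurable_of_discrete_index (f := fun w x => mass x w) (measurableSet_spine n) measurable_mass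

lemma measurableSet_sibWord (n m : ℕ) (w : List ℕ) :
    MeasurableSet {x : Realization | sibWord α x n m = w} := by
  cases w with
  | nil => simp [sibWord]
  | cons i w =>
    have hb : Measurable fun x : Realization => best α (subtree (spine α x n) x) :=
      measurable_of_discrete_index (f := fun w x => best α (subtree w x)) (measurableSet_spine n)
        fun w => measurable_best.comp (measurable_subtree w)
    have : {x : Realization | sibWord α x n m = i :: w} =
        {x | sibIdx (best α (subtree (spine α x n) x)) m = i} ∩ {x | spine α x n = w} := by
      ext x; simp [sibWord]
    rw [this]
    exact ((measurable_of_countable (fun j => sibIdx j m)).comp hb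
      (measurableSet_singleton i)).inter (measurableSet_spine n w)

lemma measurable_spineCount (ε : ℝ) : Measurable fun x : Realization => spineCount α ε x :=
  measurable_nat_sInf fun _ =>
    measurableSet_lt (measurable_life.sub_const ε) (measurable_spineTime _)

/-- At most `k` elements satisfy `p` exactly when every one of the countably many finite sets of `k
+ 1` elements contains one that does not. -/
lemma measurableSet_encard_le {β κ : Type*} [MeasurableSpace β] [Countable κ] {p : β → κ → Prop}
    (hp : ∀ u, MeasurableSet {b | p b u}) (k : ℕ) :
    MeasurableSet {b | {u | p b u}.encard ≤ (k : ℕ∞)} := by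
  have : {b | {u | p b u}.encard ≤ (k : ℕ∞)} =
      ⋂ s : {s : Finset κ // s.card = k + 1}, ⋃ u ∈ s.1, {b | p b u}ᶜ := by
    ext b
    simp only [Set.mem_iInter, Set.mem_iUnion, Set.mem_compl_iff]
    constructor
    · rintro h ⟨s, hs⟩
      by_contra hno
      push Not at hno
      have hsub : (s : Set κ) ⊆ {u | p b u} := fun u hu => hno u hu
      have := (Set.encard_le_encard hsub).trans h
      rw [Set.encard_coe_eq_coe_finsetCard, hs] at this
      exact absurd this (not_le.2 (by exact_mod_cast Nat.lt_succ_self k))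
    · intro h
      by_contra hlt
      have hlt' : (k : ℕ∞) < {u | p b u}.encard := not_le.1 hlt
      obtain ⟨T, hT, hTc⟩ := Set.exists_subset_encard_eq (Order.add_one_le_of_lt hlt')
      have hfin : T.Finite := Set.finite_of_encard_eq_coe (k := k + 1) (by simpa using hTc)
      have hcard : hfin.toFinset.card = k + 1 := by
        rw [hfin.encard_eq_coe_toFinset_card] at hTc
        exact_mod_cast hTc
      obtain ⟨u, hu, hnu⟩ := h ⟨hfin.toFinset, hcard⟩
      exact hnu (hT (hfin.mem_toFinset.1 hu))
  rw [this]
  exact MeasurableSet.iInter fun s => Finset.measurableSet_biUnion _ fun u _ => (hp u).compl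

lemma measurable_frag {β : Type*} [MeasurableSpace β] {g : β → Realization} (hg : Measurable g)
    {t : β → ℝ} (ht : Measurable t) : Measurable fun b => frag α (g b) (t b) := by
  refine measurable_pi_lambda _ fun k => measurable_of_Iic fun y => ?_
  rcases lt_or_ge y 0 with hy | hy
  · have : (fun b => frag α (g b) (t b) k) ⁻¹' Set.Iic y = ∅ := by
      ext b
      exact iff_of_false (not_le.2 (hy.trans_le (decRearr_nonneg _ _))) id
    rw [this]
    exact MeasurableSet.empty
  · have : (fun b => frag α (g b) (t b) k) ⁻¹' Set.Iic y =
        {b | {u | Alive α (g b) (t b) u ∧ y < mass (g b) u}.encard ≤ (k : ℕ∞)} := by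
      ext b
      show frag α (g b) (t b) k ≤ y ↔ _
      rw [frag, decRearr_le_iff (M := 1) (a := fun u : {u // Alive α (g b) (t b) u} => mass (g b) u)
        (fun u => mass_le_one _ _) hy,
        encard_subtype_and (Alive α (g b) (t b)) (fun u => y < mass (g b) u)]
      rfl
    rw [this]
    refine measurableSet_encard_le (fun u => ?_) k
    have hm := (measurable_mass u).comp hg
    have hb := (measurable_birth (α := α) u).comp hg
    have hd := (measurable_death (α := α) u).comp hg
    exact ((measurableSet_lt measurable_const hm).inter ((measurableSet_le hb ht).inter
      (measurableSet_lt ht hd))).inter (measurableSet_lt measurable_const hm)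

lemma measurable_revPath {β : Type*} [MeasurableSpace β] {g : β → Realization}
    (hg : Measurable g) {c : β → ℝ} (hc : Measurable c) :
    Measurable fun b => revPath α (g b) (c b) := by
  refine measurable_pi_lambda _ fun r => ?_
  exact Measurable.ite (measurableSet_le measurable_const hc)
    (measurable_frag hg (hc.sub_const _)) measurable_const

lemma measurable_pairMass (n : ℕ) (δ : ℝ) :
    Measurable fun x : Realization => pairMass α x n δ := by
  refine Measurable.tsum fun p => ?_
  have hb : MeasurableSet {x : Realization | |birth α x p.1.1 - birth α x p.2.1| < δ} := by
    have := (measurable_birth (α := α) p.1.1).sub (measurable_birth (α := α) p.2.1)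
    exact measurableSet_lt (continuous_abs.measurable.comp this) measurable_const
  have : (fun x : Realization => {p : Lev n × Lev n |
      |birth α x p.1.1 - birth α x p.2.1| < δ}.indicator
      (fun p => ENNReal.ofReal (mass x p.1.1) * ENNReal.ofReal (mass x p.2.1)) p) =
      {x : Realization | |birth α x p.1.1 - birth α x p.2.1| < δ}.indicator
      (fun x => ENNReal.ofReal (mass x p.1.1) * ENNReal.ofReal (mass x p.2.1)) := by
    funext x
    by_cases h : |birth α x p.1.1 - birth α x p.2.1| < δ <;> simp [Set.indicator, h]
  rw [this]
  exact ((measurable_mass _).ennreal_ofReal.mul (measurable_mass _).ennreal_ofReal).indicator hb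

end Measurability

/-! ### Independent copies -/

section Mix

variable {ι E : Type*} [MeasurableSpace E] (μ₀ : Measure E) [IsProbabilityMeasure μ₀]

/-- If the coordinates of a family are taken, without repetition, from two independent families of
independent, identically distributed random variables, then the family is of the same kind. -/
lemma measurePreserving_mix [Nonempty ι] {σ : ι → ι ⊕ ι} (hσ : Function.Injective σ) :
    MeasurePreserving (fun (p : (ι → E) × (ι → E)) u => Sum.elim p.1 p.2 (σ u))
      ((Measure.infinitePi fun _ : ι => μ₀).prod (Measure.infinitePi fun _ : ι => μ₀))
      (Measure.infinitePi fun _ : ι => μ₀) := by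
  classical
  have hmeas : Measurable fun (p : (ι → E) × (ι → E)) u => Sum.elim p.1 p.2 (σ u) := by
    refine measurable_pi_lambda _ fun u => ?_
    rcases σ u with i | i
    · exact (measurable_pi_apply i).comp measurable_fst
    · exact (measurable_pi_apply i).comp measurable_snd
  refine ⟨hmeas, Measure.eq_infinitePi _ fun s t ht => ?_⟩
  set τ := Function.invFun σ
  have hτ : ∀ u, τ (σ u) = u := Function.leftInverse_invFun hσ
  rw [Measure.map_apply hmeas (MeasurableSet.pi s.countable_toSet fun i _ => ht i)]
  -- The preimage of a cylinder is a product of two cylinders, on the left and right parts of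
  -- `σ(s)`. Injectivity of `σ` ensures that no coordinate is constrained twice.
  have hpre : (fun (p : (ι → E) × (ι → E)) u => Sum.elim p.1 p.2 (σ u)) ⁻¹' (s : Set ι).pi t =
      (((s.image σ).toLeft : Set ι).pi fun i => t (τ (Sum.inl i))) ×ˢ
        (((s.image σ).toRight : Set ι).pi fun i => t (τ (Sum.inr i))) := by
    ext p
    simp only [Set.mem_preimage, Set.mem_pi, Set.mem_prod, Finset.mem_coe, Finset.mem_toLeft,
      Finset.mem_toRight, Finset.mem_image]
    constructor
    · intro h
      refine ⟨?_, ?_⟩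
      · rintro i ⟨u, hu, hui⟩
        have := h u hu
        rw [hui] at this
        rw [← hui, hτ]
        exact this
      · rintro i ⟨u, hu, hui⟩
        have := h u hu
        rw [hui] at this
        rw [← hui, hτ]
        exact this
    · rintro ⟨h1, h2⟩ u hu
      rcases hui : σ u with i | i
      · have := h1 i ⟨u, hu, hui⟩
        rwa [← hui, hτ] at this
      · have := h2 i ⟨u, hu, hui⟩
        rwa [← hui, hτ] at this
  rw [hpre, Measure.prod_prod, Measure.infinitePi_pi (fun _ => μ₀) (fun i _ => ht _),
    Measure.infinitePi_pi (fun _ => μ₀) (fun i _ => ht _)]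
  rw [← Finset.prod_disjSum (f := fun j => μ₀ (t (τ j))), Finset.toLeft_disjSum_toRight,
    Finset.prod_image fun a _ b _ hab => hσ hab]
  simp [hτ]

end Mix

/-- Replace the fragmentation of the block `v` of `x` by `y`. -/
def graft (v : List ℕ) (x y : Realization) : Realization := fun u =>
  if v <:+ u then y (u.take (u.length - v.length)) else x u

lemma graft_append (v w : List ℕ) (x y : Realization) : graft v x y (w ++ v) = y w := by
  simp [graft]

lemma graft_of_not_suffix {v u : List ℕ} (h : ¬ v <:+ u) (x y : Realization) :
    graft v x y u = x u := by
  simp [graft, h]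

lemma subtree_graft (v : List ℕ) (x y : Realization) : subtree v (graft v x y) = y := by
  funext w; exact graft_append v w x y

lemma subtree_graft_of_incomparable {u v : List ℕ} (h1 : ¬ u <:+ v) (h2 : ¬ v <:+ u)
    (x y : Realization) : subtree u (graft v x y) = subtree u x := by
  funext w
  refine graft_of_not_suffix (fun h => ?_) _ _
  rcases List.suffix_or_suffix_of_suffix h (List.suffix_append w u) with h | h
  exacts [h2 h, h1 h]

section Law

variable (ν : Measure UnitMassSeq)

/-- The law of a clock and a dislocation. -/
def nodeLaw : Measure (ℝ × UnitMassSeq) := (expMeasure 1).prod ν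

/-- The law of a realization. -/
def realLaw : Measure Realization := Measure.infinitePi fun _ : List ℕ => nodeLaw ν

instance : IsProbabilityMeasure (expMeasure 1) := isProbabilityMeasure_expMeasure one_pos

variable [IsProbabilityMeasure ν]

instance : IsProbabilityMeasure (nodeLaw ν) := by unfold nodeLaw; infer_instance

instance : IsProbabilityMeasure (realLaw ν) := by unfold realLaw; infer_instance

/-- Grafting reads each node either from `x`, outside the subtree of `v`, or from `y`, inside it,
and never reads a node twice. -/
lemma measurePreserving_graft (v : List ℕ) :
    MeasurePreserving (fun p : Realization × Realization => graft v p.1 p.2)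
      ((realLaw ν).prod (realLaw ν)) (realLaw ν) := by
  have hσ : Function.Injective (fun u : List ℕ =>
      (if v <:+ u then Sum.inr (u.take (u.length - v.length)) else Sum.inl u :
        List ℕ ⊕ List ℕ)) := by
    intro u u' h
    by_cases hu : v <:+ u <;> by_cases hu' : v <:+ u'
    · obtain ⟨w, rfl⟩ := hu
      obtain ⟨w', rfl⟩ := hu'
      simpa using h
    · simp [hu, hu'] at h
    · simp [hu, hu'] at h
    · simpa [hu, hu'] using h
  have h := measurePreserving_mix (nodeLaw ν) hσ
  have he : (fun p : Realization × Realization => graft v p.1 p.2) = fun p u =>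
      Sum.elim p.1 p.2 (if v <:+ u then Sum.inr (u.take (u.length - v.length)) else Sum.inl u) := by
    funext p u
    by_cases hu : v <:+ u <;> simp [graft, hu]
  rw [he]
  exact h

lemma lintegral_graft (v : List ℕ) {f : Realization → ℝ≥0∞} (hf : Measurable f) :
    ∫⁻ x, f x ∂realLaw ν = ∫⁻ x, ∫⁻ y, f (graft v x y) ∂realLaw ν ∂realLaw ν := by
  have h := measurePreserving_graft ν v
  rw [← h.lintegral_comp hf, lintegral_prod]
  exact (hf.comp h.measurable).aemeasurable

lemma measurePreserving_subtree (v : List ℕ) :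
    MeasurePreserving (subtree v) (realLaw ν) (realLaw ν) := by
  refine ⟨measurable_subtree v, ?_⟩
  have h1 := measurePreserving_graft ν v
  have h2 : MeasurePreserving (fun p : Realization × Realization => p.2)
    ((realLaw ν).prod (realLaw ν)) (realLaw ν) := measurePreserving_snd
  conv_lhs => rw [← h1.map_eq]
  rw [Measure.map_map (measurable_subtree v) h1.measurable]
  refine Eq.trans ?_ h2.map_eq
  congr 1
  funext p
  exact subtree_graft v p.1 p.2

/-- Mixing with a second realization of which only the node `[]` is read amounts to refreshing the
single node `v`. -/
lemma measurePreserving_update (v : List ℕ) :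
    MeasurePreserving (fun p : Realization × (ℝ × UnitMassSeq) => Function.update p.1 v p.2)
      ((realLaw ν).prod (nodeLaw ν)) (realLaw ν) := by
  have hσ : Function.Injective (fun u : List ℕ =>
      (if u = v then Sum.inr [] else Sum.inl u : List ℕ ⊕ List ℕ)) := by
    intro u u' h
    by_cases hu : u = v <;> by_cases hu' : u' = v <;> simp_all
  have h1 := measurePreserving_mix (nodeLaw ν) hσ
  have h2 : MeasurePreserving (fun p : Realization × Realization => (p.1, p.2 []))
      ((realLaw ν).prod (realLaw ν)) ((realLaw ν).prod (nodeLaw ν)) :=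
    (MeasurePreserving.id _).prod (measurePreserving_eval_infinitePi (fun _ => nodeLaw ν) [])
  have hm : Measurable fun p : Realization × (ℝ × UnitMassSeq) => Function.update p.1 v p.2 := by
    refine measurable_pi_lambda _ fun u => ?_
    by_cases hu : u = v
    · subst hu; simpa using measurable_snd
    · simpa [hu, Function.comp_def] using
        (measurable_pi_apply (X := fun _ : List ℕ => ℝ × UnitMassSeq) u).comp measurable_fst
  refine ⟨hm, ?_⟩
  rw [← h2.map_eq, Measure.map_map hm h2.measurable]
  refine Eq.trans ?_ h1.map_eq
  congr 1
  funext p u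
  by_cases hu : u = v
  · subst hu; simp
  · simp [hu]

lemma lintegral_update (v : List ℕ) {f : Realization → ℝ≥0∞} (hf : Measurable f) :
    ∫⁻ x, f x ∂realLaw ν =
      ∫⁻ x, ∫⁻ s, ∫⁻ e, f (Function.update x v (e, s)) ∂expMeasure 1 ∂ν ∂realLaw ν := by
  have h := measurePreserving_update ν v
  rw [← h.lintegral_comp hf, lintegral_prod]
  swap
  · exact (hf.comp h.measurable).aemeasurable
  refine lintegral_congr fun x => ?_
  rw [nodeLaw, lintegral_prod_symm]
  exact (hf.comp (h.measurable.comp measurable_prodMk_left)).aemeasurable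

end Law

end

section

variable {α : ℝ} {x : Realization}

/-! ### The exponential law -/

/-- The density `exp (-e)` is at most one. This gives both the absence of atoms and the bound on the
probability of short intervals. -/
lemma expMeasure_le_volume : expMeasure 1 ≤ volume := by
  have h : gammaPDF 1 1 ≤ 1 := by
    intro e
    rcases lt_or_ge e 0 with he | he
    · rw [gammaPDF_of_neg he]; exact zero_le
    · rw [gammaPDF_of_nonneg he]
      simp only [Real.one_rpow, Real.Gamma_one, div_one, sub_self, Real.rpow_zero, one_mul,
        Pi.one_apply]
      exact ENNReal.ofReal_le_one.2 (Real.exp_le_one_iff.2 (by linarith))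
  calc expMeasure 1 = volume.withDensity (gammaPDF 1 1) := rfl
    _ ≤ volume.withDensity 1 := withDensity_mono (.of_forall h)
    _ = volume := withDensity_one

instance : NullSingletonClass (expMeasure 1) :=
  ⟨fun e => le_antisymm ((expMeasure_le_volume {e}).trans (by simp)) zero_le⟩

lemma expMeasure_ae_pos : ∀ᵐ e ∂expMeasure 1, 0 < e := by
  have h : expMeasure 1 (Set.Iio 0) = 0 := by
    rw [expMeasure, gammaMeasure, withDensity_apply _ measurableSet_Iio]
    exact lintegral_gammaPDF_of_nonpos le_rfl
  have h2 : expMeasure 1 (Set.Iic 0) = 0 := by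
    rw [← Set.Iio_union_right]
    exact measure_union_null h (measure_singleton 0)
  rw [ae_iff]
  convert h2 using 2
  ext e; simp

lemma lintegral_pow_expMeasure_lt_top (q : ℕ) :
    ∫⁻ e, ENNReal.ofReal (e ^ q) ∂expMeasure 1 < ∞ := by
  have h1 : expMeasure 1 = (expMeasure 1).restrict (Set.Ioi 0) := by
    rw [Measure.restrict_eq_self_of_ae_mem]
    exact expMeasure_ae_pos
  have hm : Measurable (gammaPDF 1 1) := (measurable_gammaPDFReal 1 1).ennreal_ofReal
  rw [h1, expMeasure, gammaMeasure, restrict_withDensity measurableSet_Ioi,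
    lintegral_withDensity_eq_lintegral_mul _ hm (by fun_prop)]
  have h2 := (Real.GammaIntegral_convergent (s := q + 1) (by positivity)).lintegral_lt_top
  refine lt_of_le_of_lt (le_of_eq (setLIntegral_congr_fun measurableSet_Ioi fun e he => ?_)) h2
  have he' : (0 : ℝ) < e := he
  simp only [Pi.mul_apply]
  rw [gammaPDF_of_nonneg he'.le, ← ENNReal.ofReal_mul (by positivity)]
  simp

lemma expMeasure_abs_lt_le (c : ℝ) {m : ℝ} (hm : 0 < m) (δ : ℝ) :
    expMeasure 1 {e | |c + m * e| < δ} ≤ ENNReal.ofReal (2 * δ / m) := by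
  refine (expMeasure_le_volume _).trans ?_
  have : {e : ℝ | |c + m * e| < δ} = Set.Ioo ((-δ - c) / m) ((δ - c) / m) := by
    ext e
    show |c + m * e| < δ ↔ _ < e ∧ e < _
    rw [abs_lt, div_lt_iff₀ hm, lt_div_iff₀ hm]
    constructor <;> rintro ⟨h1, h2⟩ <;> constructor <;> linarith
  rw [this, Real.volume_Ioo]
  refine ENNReal.ofReal_le_ofReal (le_of_eq ?_)
  ring

/-! ### Changing one clock -/

/-- The realizations `x` and `z` differ at most by the clock of the block `v`. -/
def AgreeExceptClock (v : List ℕ) (x z : Realization) : Prop :=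
  (∀ u, (x u).2 = (z u).2) ∧ ∀ u, u ≠ v → (x u).1 = (z u).1

lemma agreeExceptClock_update (v : List ℕ) (x : Realization) (s : UnitMassSeq) (e e' : ℝ) :
    AgreeExceptClock v (Function.update x v (e, s)) (Function.update x v (e', s)) := by
  constructor
  · intro u
    by_cases h : u = v
    · subst h; simp
    · simp [h]
  · intro u h
    simp [h]

lemma AgreeExceptClock.mass_eq {v : List ℕ} {x z : Realization} (h : AgreeExceptClock v x z) :
    ∀ u, mass z u = mass x u
  | [] => rfl
  | i :: u => by rw [mass, mass, h.mass_eq u, h.1 u]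

-- The clock of `v` delays by one and the same amount the splits of `v` and of all its descendants,
-- and nothing else.
open Classical in
lemma AgreeExceptClock.death_eq {v : List ℕ} {x z : Realization} (h : AgreeExceptClock v x z)
    (u : List ℕ) : death α z u = death α x u +
      if v <:+ u then mass x v ^ (-α) * ((z v).1 - (x v).1) else 0 := by
  have step : ∀ u, birth α z u = birth α x u +
      (if v <:+ u ∧ v ≠ u then mass x v ^ (-α) * ((z v).1 - (x v).1) else 0) →
      death α z u = death α x u +
        if v <:+ u then mass x v ^ (-α) * ((z v).1 - (x v).1) else 0 := by
    intro u hu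
    rw [death, death, hu, h.mass_eq u]
    by_cases huv : v = u
    · subst huv
      simp
      ring
    · rw [h.2 u (Ne.symm huv)]
      simp [huv]
      ring
  induction u with
  | nil =>
    refine step [] ?_
    have : ¬ (v <:+ [] ∧ v ≠ []) := fun hv => hv.2 (List.suffix_nil.1 hv.1)
    rw [if_neg this]
    simp [birth]
  | cons i u ih =>
    refine step (i :: u) ?_
    have hiff : (v <:+ i :: u ∧ v ≠ i :: u) ↔ v <:+ u := by
      rw [List.suffix_cons_iff]
      constructor
      · rintro ⟨h1 | h1, h2⟩
        exacts [absurd h1 h2, h1]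
      · intro h1
        refine ⟨Or.inr h1, ?_⟩
        rintro rfl
        have := h1.length_le
        simp at this
    rw [if_congr hiff rfl rfl]
    exact ih

/-- Every block descends from the root, so all splitting times shift with the root clock. Applied in
both directions, this says that `life` minus the root clock does not depend on that clock. -/
lemma AgreeExceptClock.life_sub_le {x z : Realization} (h : AgreeExceptClock [] x z)
    (hx : BddDeath α x) (hc : ClockPos z) :
    life α z - (z []).1 ≤ life α x - (x []).1 := by
  rw [sub_le_iff_le_add]
  refine life_le hc fun w hw => ?_
  rw [h.death_eq]
  rw [h.mass_eq] at hw
  have := death_le_life hx hw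
  simp [mass]
  linarith

/-! ### Moments -/

section Moments

variable (ν : Measure UnitMassSeq)

/-- The mean of the `p`-th powers of the `i`-th mass of a dislocation. -/
def powMean (p : ℝ) (i : ℕ) : ℝ≥0∞ := ∫⁻ s, ENNReal.ofReal ((s : ℕ → ℝ) i ^ p) ∂ν

/-- The mean sum of the `p`-th powers of the masses of a dislocation. -/
def powSum (p : ℝ) : ℝ≥0∞ := ∑' i, powMean ν p i

lemma measurable_coord_pow (p : ℝ) (i : ℕ) :
    Measurable fun s : UnitMassSeq => ENNReal.ofReal ((s : ℕ → ℝ) i ^ p) :=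
  (((measurable_pi_apply i).comp measurable_subtype_coe).pow_const p).ennreal_ofReal

lemma ae_lt_one (hν : ν {s | (s : ℕ → ℝ) = oneState} = 0) :
    ∀ᵐ s : UnitMassSeq ∂ν, ∀ i, (s : ℕ → ℝ) i < 1 := by
  have h : ∀ᵐ s : UnitMassSeq ∂ν, ¬ ((s : ℕ → ℝ) = oneState) := by
    rw [ae_iff]; simpa using hν
  filter_upwards [h] with s hs i
  by_contra! hi
  refine hs ?_
  have h0 : (s : ℕ → ℝ) 0 = 1 := le_antisymm (s.le_one 0) (hi.trans (s.2.1.1 (Nat.zero_le i)))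
  funext j
  rcases eq_or_ne j 0 with rfl | hj
  · simp [oneState, h0]
  · have := sum_le_hasSum {0, j} (fun k _ => s.nonneg k) s.hasSum
    rw [Finset.sum_pair hj.symm, h0] at this
    rw [oneState, Pi.single_eq_of_ne hj]
    linarith [s.nonneg j]

variable [IsProbabilityMeasure ν]

lemma lintegral_coord_nodeLaw {f : UnitMassSeq → ℝ≥0∞} (hf : Measurable f) (u : List ℕ) :
    ∫⁻ x : Realization, f (x u).2 ∂realLaw ν = ∫⁻ s, f s ∂ν := by
  have h1 : MeasurePreserving (fun x : Realization => x u) (realLaw ν) (nodeLaw ν) :=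
    measurePreserving_eval_infinitePi (fun _ => nodeLaw ν) u
  have h2 : MeasurePreserving (Prod.snd : ℝ × UnitMassSeq → UnitMassSeq) (nodeLaw ν) ν :=
    measurePreserving_snd
  exact (h2.comp h1).lintegral_comp hf

lemma lintegral_clock {f : ℝ → ℝ≥0∞} (hf : Measurable f) (u : List ℕ) :
    ∫⁻ x : Realization, f (x u).1 ∂realLaw ν = ∫⁻ e, f e ∂expMeasure 1 := by
  have h1 : MeasurePreserving (fun x : Realization => x u) (realLaw ν) (nodeLaw ν) :=
    measurePreserving_eval_infinitePi (fun _ => nodeLaw ν) u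
  have h2 : MeasurePreserving (Prod.fst : ℝ × UnitMassSeq → ℝ) (nodeLaw ν) (expMeasure 1) :=
    measurePreserving_fst
  exact (h2.comp h1).lintegral_comp hf

/-- Almost surely every mass is below one and some mass is positive. For `p > 1` this mass satisfies
`s_i ^ p < s_i`, so the sum of powers is strictly below `∑ s_i = 1`, and so is its mean. -/
lemma powSum_lt_one (hν : ν {s | (s : ℕ → ℝ) = oneState} = 0) {p : ℝ} (hp : 1 < p) :
    powSum ν p < 1 := by
  have h1 : powSum ν p = ∫⁻ s, ∑' i, ENNReal.ofReal ((s : ℕ → ℝ) i ^ p) ∂ν :=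
    (lintegral_tsum fun i => (measurable_coord_pow p i).aemeasurable).symm
  have h2 : ∫⁻ _ : UnitMassSeq, (1 : ℝ≥0∞) ∂ν = 1 := by simp
  have hle : ∀ s : UnitMassSeq, ∀ i, ENNReal.ofReal ((s : ℕ → ℝ) i ^ p) ≤
      ENNReal.ofReal ((s : ℕ → ℝ) i) := fun s i => by
    refine ENNReal.ofReal_le_ofReal ?_
    exact Real.rpow_le_self_of_le_one (s.nonneg i) (s.le_one i) hp.le
  have hle1 : ∀ s : UnitMassSeq, ∑' i, ENNReal.ofReal ((s : ℕ → ℝ) i ^ p) ≤ 1 := fun s =>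
    (ENNReal.tsum_le_tsum (hle s)).trans (UnitMassSeq.tsum_ofReal s).le
  rw [h1]
  conv_rhs => rw [← h2]
  refine lintegral_strict_mono (IsProbabilityMeasure.ne_zero ν) aemeasurable_const ?_ ?_
  · refine ((lintegral_mono hle1).trans_lt ?_).ne
    rw [h2]; exact ENNReal.one_lt_top
  · filter_upwards [ae_lt_one ν hν] with s hs
    obtain ⟨i, hi⟩ : ∃ i, 0 < (s : ℕ → ℝ) i := by
      by_contra! h
      have h0 : (s : ℕ → ℝ) = 0 := funext fun i => le_antisymm (h i) (s.nonneg i)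
      have := s.2.2
      simp [h0] at this
    rw [← UnitMassSeq.tsum_ofReal s]
    refine ENNReal.tsum_lt_tsum (i := i) ((hle1 s).trans_lt ENNReal.one_lt_top).ne (hle s) ?_
    rw [ENNReal.ofReal_lt_ofReal_iff hi]
    exact Real.rpow_lt_self_of_lt_one hi (hs i) hp

lemma lintegral_mass_pow (p : ℝ) {f : ℝ → ℝ≥0∞} (hf : Measurable f) (u : List ℕ) :
    ∫⁻ x, ENNReal.ofReal (mass x u ^ p) * f (x u).1 ∂realLaw ν =
      (u.map (powMean ν p)).prod * ∫⁻ e, f e ∂expMeasure 1 := by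
  have hmeas : ∀ u : List ℕ, Measurable fun x : Realization =>
      ENNReal.ofReal (mass x u ^ p) * f (x u).1 := fun u =>
    ((measurable_mass u).pow_const p).ennreal_ofReal.mul (hf.comp (measurable_clock u))
  -- The last letter is the child of the root; the rest of the word lives in the subtree of that
  -- child, which is independent of the root.
  induction u using List.reverseRecOn with
  | nil => simpa [mass] using lintegral_clock ν hf []
  | append_singleton w i ih =>
    rw [lintegral_graft ν [i] (hmeas _)]
    have h1 : ∀ x y : Realization, ENNReal.ofReal (mass (graft [i] x y) (w ++ [i]) ^ p) *
        f (graft [i] x y (w ++ [i])).1 = ENNReal.ofReal (((x []).2 : ℕ → ℝ) i ^ p) *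
          (ENNReal.ofReal (mass y w ^ p) * f (y w).1) := by
      intro x y
      have h0 : graft [i] x y [] = x [] := graft_of_not_suffix (by simp) _ _
      rw [mass_append, subtree_graft, graft_append, mass_singleton, h0,
        Real.mul_rpow (UnitMassSeq.nonneg _ _) (mass_nonneg _ _),
        ENNReal.ofReal_mul (Real.rpow_nonneg (UnitMassSeq.nonneg _ _) _), mul_assoc]
    simp_rw [h1]
    simp_rw [lintegral_const_mul _ (hmeas w), ih]
    have hS : Measurable fun x : Realization => ENNReal.ofReal (((x []).2 : ℕ → ℝ) i ^ p) :=
      (measurable_coord_pow p i).comp (measurable_snd.comp (measurable_pi_apply []))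
    rw [lintegral_mul_const _ hS,
      lintegral_coord_nodeLaw ν (measurable_coord_pow p i) []]
    simp only [List.map_append, List.prod_append, List.map_cons, List.map_nil, List.prod_cons,
      List.prod_nil, mul_one]
    rw [powMean]
    ring

lemma tsum_lev_prod (g : ℕ → ℝ≥0∞) (n : ℕ) :
    ∑' u : Lev n, (u.1.map g).prod = (∑' i, g i) ^ n := by
  induction n with
  | zero =>
    have : ∀ u : Lev 0, u = ⟨[], rfl⟩ := fun u => Subtype.ext (List.length_eq_zero_iff.1 u.2)
    rw [tsum_eq_single ⟨[], rfl⟩ fun u hu => absurd (this u) hu]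
    simp
  | succ n ih =>
    rw [← (levCons n).tsum_eq, ENNReal.tsum_prod']
    simp only [levCons, Equiv.coe_fn_mk, List.map_cons, List.prod_cons]
    simp_rw [ENNReal.tsum_mul_left, ih]
    rw [ENNReal.tsum_mul_right, pow_succ']

lemma tsum_list_eq (f : List ℕ → ℝ≥0∞) : ∑' u, f u = ∑' n, ∑' u : Lev n, f u.1 := by
  rw [← (Equiv.sigmaFiberEquiv (List.length (α := ℕ))).tsum_eq, ENNReal.tsum_sigma']
  rfl

lemma lintegral_tsum_mass_pow (p : ℝ) {f : ℝ → ℝ≥0∞} (hf : Measurable f) (b : ℝ≥0∞) :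
    ∫⁻ x, ∑' u : List ℕ, b ^ u.length * (ENNReal.ofReal (mass x u ^ p) * f (x u).1) ∂realLaw ν =
      (∑' n : ℕ, (b * powSum ν p) ^ n) * ∫⁻ e, f e ∂expMeasure 1 := by
  have hmeas : ∀ u : List ℕ, Measurable fun x : Realization =>
      ENNReal.ofReal (mass x u ^ p) * f (x u).1 := fun u =>
    ((measurable_mass u).pow_const p).ennreal_ofReal.mul (hf.comp (measurable_clock u))
  rw [lintegral_tsum fun u => ((hmeas u).const_mul _).aemeasurable]
  simp_rw [lintegral_const_mul _ (hmeas _), lintegral_mass_pow ν p hf, ← mul_assoc]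
  rw [ENNReal.tsum_mul_right, tsum_list_eq]
  congr 1
  refine tsum_congr fun n => ?_
  rw [mul_pow, powSum, ← tsum_lev_prod, ← ENNReal.tsum_mul_left]
  exact tsum_congr fun u => by rw [u.2]

lemma ae_tsum_mass_pow_lt_top {p : ℝ} {f : ℝ → ℝ≥0∞} (hf : Measurable f)
    (hfi : ∫⁻ e, f e ∂expMeasure 1 < ∞) {b : ℝ≥0∞} (hb : b * powSum ν p < 1) :
    ∀ᵐ x ∂realLaw ν,
      ∑' u : List ℕ, b ^ u.length * (ENNReal.ofReal (mass x u ^ p) * f (x u).1) < ∞ := by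
  have hmeas : ∀ u : List ℕ, Measurable fun x : Realization =>
      b ^ u.length * (ENNReal.ofReal (mass x u ^ p) * f (x u).1) := fun u =>
    (((measurable_mass u).pow_const p).ennreal_ofReal.mul
      (hf.comp (measurable_clock u))).const_mul _
  refine ae_lt_top (Measurable.tsum hmeas) ?_
  rw [lintegral_tsum_mass_pow ν p hf, ENNReal.tsum_geometric]
  refine ENNReal.mul_ne_top (ENNReal.inv_ne_top.2 ?_) hfi.ne
  exact (tsub_pos_of_lt hb).ne'

lemma ae_tendsto_mass (hν : ν {s | (s : ℕ → ℝ) = oneState} = 0) :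
    ∀ᵐ x ∂realLaw ν, Tendsto (mass x) cofinite (𝓝 0) := by
  have h := ae_tsum_mass_pow_lt_top ν (p := 2) (f := fun _ => 1) measurable_const (by simp)
    (b := 1) (by rw [one_mul]; exact powSum_lt_one ν hν (by norm_num))
  filter_upwards [h] with x hx
  simp only [one_pow, one_mul, mul_one] at hx
  have h1 := ENNReal.tendsto_cofinite_zero_of_tsum_ne_top hx.ne
  rw [← ENNReal.ofReal_zero] at h1
  have h2 : Tendsto (fun u => mass x u ^ (2 : ℝ)) cofinite (𝓝 0) := by
    have := (ENNReal.tendsto_toReal (a := ENNReal.ofReal 0) (by simp)).comp h1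
    simpa [Function.comp_def, mass_nonneg, Real.rpow_nonneg] using this
  have h3 := h2.rpow_const (p := 1 / 2) (Or.inr (by norm_num))
  refine (h3.congr fun u => ?_).trans_eq ?_
  · rw [← Real.rpow_mul (mass_nonneg x u)]; norm_num
  · rw [Real.zero_rpow (by norm_num)]

end Moments

end

section

variable {α : ℝ} {x : Realization}

/-! ### Bounds on the time to extinction -/

/-- The elapsed time is a sum of lifetimes along one line of descent. Its blocks have distinct
lengths, which allows a comparison with a geometric series. -/
lemma exists_finset_death (x : Realization) (v w : List ℕ) :
    ∃ F : Finset (List ℕ), (∀ z ∈ F, v <:+ z ∧ z.length ≤ (w ++ v).length) ∧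
      Set.InjOn List.length (F : Set (List ℕ)) ∧
      death α x (w ++ v) - birth α x v = ∑ z ∈ F, mass x z ^ (-α) * (x z).1 := by
  induction w with
  | nil =>
    refine ⟨{v}, by simp, by simp, ?_⟩
    simp [death]
  | cons i w ih =>
    obtain ⟨F, hF, hinj, hsum⟩ := ih
    have hnot : ∀ z ∈ F, z.length ≠ (i :: w ++ v).length := fun z hz => by
      have := (hF z hz).2
      simp only [List.cons_append, List.length_cons]
      omega
    have hmem : i :: w ++ v ∉ F := fun h => hnot _ h rfl
    refine ⟨insert (i :: w ++ v) F, ?_, ?_, ?_⟩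
    · intro z hz
      rcases Finset.mem_insert.1 hz with rfl | hz
      · exact ⟨List.suffix_append _ _, le_rfl⟩
      · exact ⟨(hF z hz).1, (hF z hz).2.trans (by simp)⟩
    · rw [Finset.coe_insert, Set.injOn_insert (by simpa using hmem)]
      refine ⟨hinj, ?_⟩
      rintro ⟨z, hz, hzl⟩
      exact hnot z hz hzl
    · rw [Finset.sum_insert hmem, ← hsum]
      have h1 : death α x (i :: w ++ v) = death α x (w ++ v) +
        mass x (i :: w ++ v) ^ (-α) * (x (i :: w ++ v)).1 := rfl
      rw [h1]
      ring

lemma le_add_pow_succ_div {z δ : ℝ} (hz : 0 ≤ z) (hδ : 0 < δ) (k : ℕ) :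
    z ≤ δ + z ^ (k + 1) / δ ^ k := by
  rcases le_or_gt z δ with h | h
  · exact h.trans (le_add_of_nonneg_right (by positivity))
  · have h1 : δ ^ k ≤ z ^ k := pow_le_pow_left₀ hδ.le h.le k
    have h2 : z ≤ z ^ (k + 1) / δ ^ k := by
      rw [le_div_iff₀ (by positivity), pow_succ']
      exact mul_le_mul_of_nonneg_left h1 hz
    linarith

/-- The weights of the blocks whose sum controls the extinction time. -/
def blockWeight (α : ℝ) (r : ℝ) (k : ℕ) (x : Realization) (u : List ℕ) : ℝ :=
  (mass x u ^ (-α) * (x u).1 / r ^ u.length) ^ (k + 1)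

/-- Each lifetime is written as `r ^ length` times a ratio `z`, and `z ≤ δ + z ^ (k + 1) / δ ^ k`.
The first terms sum to at most `δ / (1 - r)`, the second ones to at most `B / δ ^ k`, whatever the
line of descent. -/
lemma death_sub_birth_le (hc : ClockPos x) {r : ℝ} (hr : 0 < r) (hr1 : r < 1) {k : ℕ} {δ B : ℝ}
    (hδ : 0 < δ) {v : List ℕ}
    (hB : ∀ F : Finset (List ℕ), (∀ z ∈ F, v <:+ z) → ∑ z ∈ F, blockWeight α r k x z ≤ B)
    (w : List ℕ) : death α x (w ++ v) - birth α x v ≤ δ * (1 - r)⁻¹ + B / δ ^ k := by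
  obtain ⟨F, hF, hinj, hsum⟩ := exists_finset_death (α := α) x v w
  rw [hsum]
  have hterm : ∀ z ∈ F, mass x z ^ (-α) * (x z).1 ≤
      δ * r ^ z.length + blockWeight α r k x z / δ ^ k := by
    intro z _
    have hy : 0 ≤ mass x z ^ (-α) * (x z).1 :=
      mul_nonneg (Real.rpow_nonneg (mass_nonneg _ _) _) (hc z).le
    have hrz : 0 < r ^ z.length := by positivity
    have h1 := le_add_pow_succ_div (div_nonneg hy hrz.le) hδ k
    rw [div_le_iff₀ hrz, add_mul] at h1
    refine h1.trans (add_le_add_right (mul_le_of_le_one_right ?_ (pow_le_one₀ hr.le hr1.le)) _)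
    have := div_nonneg hy hrz.le
    positivity
  refine (Finset.sum_le_sum hterm).trans ?_
  rw [Finset.sum_add_distrib, ← Finset.mul_sum, ← Finset.sum_div]
  have h2 : ∑ z ∈ F, r ^ z.length ≤ (1 - r)⁻¹ := by
    rw [← tsum_geometric_of_lt_one hr.le hr1, ← Finset.sum_image (f := fun n => r ^ n) hinj]
    exact (summable_geometric_of_lt_one hr.le hr1).sum_le_tsum _ fun n _ => by positivity
  have h3 := hB F fun z hz => (hF z hz).1
  gcongr

lemma bddDeath_and_tendsto_of_summable (hα : α < 0) (hc : ClockPos x) {r : ℝ} (hr : 0 < r)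
    (hr1 : r < 1) {k : ℕ} (hs : Summable (blockWeight α r k x)) :
    BddDeath α x ∧
      Tendsto (fun v => mass x v ^ (-α) * life α (subtree v x)) cofinite (𝓝 0) := by
  have hφ : ∀ z, 0 ≤ blockWeight α r k x z := fun z => by
    have : 0 ≤ mass x z ^ (-α) * (x z).1 / r ^ z.length :=
      div_nonneg (mul_nonneg (Real.rpow_nonneg (mass_nonneg _ _) _) (hc z).le) (by positivity)
    exact pow_nonneg this _
  have hle : ∀ {δ B : ℝ}, 0 < δ → 0 ≤ B → ∀ v : List ℕ,
      (∀ F : Finset (List ℕ), (∀ z ∈ F, v <:+ z) → ∑ z ∈ F, blockWeight α r k x z ≤ B) →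
      mass x v ^ (-α) * life α (subtree v x) ≤ δ * (1 - r)⁻¹ + B / δ ^ k := by
    intro δ B hδ hB0 v hB
    rcases (mass_nonneg x v).eq_or_lt with h0 | h0
    · rw [← h0, Real.zero_rpow (by linarith), zero_mul]
      have : 0 < 1 - r := by linarith
      positivity
    · rw [← sub_nonneg]
      have := dust_le (α := α) hc h0 (C := birth α x v + (δ * (1 - r)⁻¹ + B / δ ^ k)) (by
        rintro _ ⟨w, rfl⟩ _
        linarith [death_sub_birth_le hc hr hr1 hδ hB w])
      rw [dust] at this
      linarith
  constructor
  · refine ⟨1 * (1 - r)⁻¹ + (∑' z, blockWeight α r k x z) / 1 ^ k, fun w _ => ?_⟩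
    have := death_sub_birth_le (α := α) hc hr hr1 (k := k) one_pos (v := [])
      (B := ∑' z, blockWeight α r k x z) (fun F _ => hs.sum_le_tsum F fun z _ => hφ z) w
    simpa [birth] using this
  · refine tendsto_order.2 ⟨fun a ha => .of_forall fun v => ha.trans_le ?_, fun a ha => ?_⟩
    · refine mul_nonneg (Real.rpow_nonneg (mass_nonneg _ _) _) ?_
      refine Real.iSup_nonneg fun w => ?_
      split_ifs
      · exact (birth_nonneg (hc.subtree v) w).trans (birth_le_death (hc.subtree v) w)
      · exact le_rfl
    · have hr' : 0 < 1 - r := by linarith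
      -- With this choice each of the two error terms equals `a / 3`.
      set δ := a / 3 * (1 - r) with hδ
      have hδ0 : 0 < δ := by positivity
      set B := a / 3 * δ ^ k with hB
      have hB0 : 0 < B := by positivity
      -- Outside `S` every finite sum of weights is below `B`. Apart from the finitely many
      -- ancestors of elements of `S`, all blocks have their whole progeny outside `S`.
      obtain ⟨S, hS⟩ := summable_iff_vanishing_norm.1 hs B hB0
      have hfin : {v : List ℕ | ∃ z ∈ S, v <:+ z}.Finite := by
        have : {v : List ℕ | ∃ z ∈ S, v <:+ z} = ⋃ z ∈ S, {v | v <:+ z} := by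
          ext v; simp
        rw [this]
        refine Set.Finite.biUnion S.finite_toSet fun z _ => ?_
        refine (List.finite_toSet z.tails).subset fun v hv => ?_
        exact (List.mem_tails v z).2 hv
      have hev : ∀ᶠ v in cofinite, v ∉ {v : List ℕ | ∃ z ∈ S, v <:+ z} := hfin.compl_mem_cofinite
      filter_upwards [hev] with v hv
      refine (hle hδ0 hB0.le v fun F hF => ?_).trans_lt ?_
      · refine (le_abs_self _).trans (hS F ?_).le
        rw [Finset.disjoint_left]
        exact fun z hz hzS => hv ⟨z, hzS, hF z hz⟩
      · rw [hB, mul_div_cancel_right₀ _ (by positivity), hδ, mul_inv_cancel_right₀ hr'.ne']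
        linarith

section AlmostSure

variable (ν : Measure UnitMassSeq) [IsProbabilityMeasure ν]

lemma ae_clockPos : ∀ᵐ x ∂realLaw ν, ClockPos x := by
  refine ae_all_iff.2 fun u => ?_
  have h1 : MeasurePreserving (fun x : Realization => x u) (realLaw ν) (nodeLaw ν) :=
    measurePreserving_eval_infinitePi (fun _ => nodeLaw ν) u
  have h2 : MeasurePreserving (Prod.fst : ℝ × UnitMassSeq → ℝ) (nodeLaw ν) (expMeasure 1) :=
    measurePreserving_fst
  exact (h2.comp h1).quasiMeasurePreserving.ae expMeasure_ae_pos

lemma ae_bddDeath_and_tendsto (hα : α < 0) (hν : ν {s | (s : ℕ → ℝ) = oneState} = 0) :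
    ∀ᵐ x ∂realLaw ν, BddDeath α x ∧
      Tendsto (fun v => mass x v ^ (-α) * life α (subtree v x)) cofinite (𝓝 0) := by
  -- The power `k + 1` of a lifetime involves the mass to the power `p = -α (k + 1)`, which has to
  -- exceed one for `powSum` to be below one.
  obtain ⟨k, hk⟩ := exists_nat_gt (1 / (-α))
  have hp : 1 < -α * ((k + 1 : ℕ) : ℝ) := by
    rw [div_lt_iff₀ (by linarith)] at hk
    push_cast
    nlinarith
  obtain ⟨c, hc1, hc2⟩ := ENNReal.lt_iff_exists_nnreal_btwn.1 (powSum_lt_one ν hν hp)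
  have hc0 : 0 < c := by
    have : (0 : ℝ≥0∞) < c := bot_le.trans_lt hc1
    exact_mod_cast this
  have hc2' : c < 1 := by exact_mod_cast hc2
  -- Thus `r ^ (k + 1) = c`, and the mean total weight is a multiple of a geometric series of ratio
  -- `powSum / c < 1`.
  set r : ℝ := (c : ℝ) ^ ((1 : ℝ) / ((k + 1 : ℕ) : ℝ)) with hr
  have hr0 : 0 < r := Real.rpow_pos_of_pos (by exact_mod_cast hc0) _
  have hr1 : r < 1 := Real.rpow_lt_one c.2 (by exact_mod_cast hc2') (by positivity)
  have hrk : r ^ (k + 1) = c := by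
    rw [hr, one_div]
    exact Real.rpow_inv_natCast_pow c.2 (by omega)
  have hb : ENNReal.ofReal ((c : ℝ)⁻¹) * powSum ν (-α * ((k + 1 : ℕ) : ℝ)) < 1 := by
    rw [ENNReal.ofReal_inv_of_pos (by exact_mod_cast hc0), ENNReal.ofReal_coe_nnreal, mul_comm,
      ← div_eq_mul_inv]
    refine ENNReal.div_lt_of_lt_mul ?_
    simpa using hc1
  have h := ae_tsum_mass_pow_lt_top ν (p := -α * ((k + 1 : ℕ) : ℝ))
    (f := fun e => ENNReal.ofReal (e ^ (k + 1))) (by fun_prop)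
    (lintegral_pow_expMeasure_lt_top (k + 1)) hb
  filter_upwards [h, ae_clockPos ν] with x hx hc
  refine bddDeath_and_tendsto_of_summable hα hc hr0 hr1 (k := k) ?_
  have hsum := ENNReal.summable_toReal hx.ne
  refine hsum.congr fun u => ?_
  have hm := mass_nonneg x u
  have he := (hc u).le
  rw [ENNReal.toReal_mul, ENNReal.toReal_mul, ENNReal.toReal_pow,
    ENNReal.toReal_ofReal (by positivity), ENNReal.toReal_ofReal (by positivity),
    ENNReal.toReal_ofReal (by positivity), blockWeight, div_pow, mul_pow, ← pow_mul, mul_comm u.length,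
    pow_mul, hrk, Real.rpow_mul hm, Real.rpow_natCast, inv_pow]
  rw [div_eq_inv_mul]

/-! ### Conditioning on all but one coordinate -/

lemma ae_update {p : Realization → Prop} (h : ∀ᵐ x ∂realLaw ν, p x) (v : List ℕ) :
    ∀ᵐ x ∂realLaw ν, ∀ᵐ s ∂ν, ∀ᵐ e ∂expMeasure 1, p (Function.update x v (e, s)) := by
  have h1 : MeasurePreserving (fun q : Realization × (UnitMassSeq × ℝ) => (q.1, q.2.swap))
      ((realLaw ν).prod (ν.prod (expMeasure 1))) ((realLaw ν).prod (nodeLaw ν)) :=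
    (MeasurePreserving.id _).prod Measure.measurePreserving_swap
  have h2 := ((measurePreserving_update ν v).comp h1).quasiMeasurePreserving.ae h
  filter_upwards [Measure.ae_ae_of_ae_prod h2] with x hx
  exact Measure.ae_ae_of_ae_prod hx

lemma ae_of_ae_update {p : Realization → Prop} (hp : MeasurableSet {x | p x}) (v : List ℕ)
    (h : ∀ᵐ x ∂realLaw ν, ∀ᵐ s ∂ν, ∀ᵐ e ∂expMeasure 1, p (Function.update x v (e, s))) :
    ∀ᵐ x ∂realLaw ν, p x := by
  rw [ae_iff, ← lintegral_indicator_one (by exact hp.compl), lintegral_update ν v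
    (measurable_one.indicator (by exact hp.compl))]
  refine lintegral_eq_zero_of_ae_eq_zero ?_
  filter_upwards [h] with x hx
  refine lintegral_eq_zero_of_ae_eq_zero ?_
  filter_upwards [hx] with s hs
  refine lintegral_eq_zero_of_ae_eq_zero ?_
  filter_upwards [hs] with e he
  exact Set.indicator_of_notMem (by simpa using he) _

lemma ae_graft {p : Realization → Prop} (h : ∀ᵐ x ∂realLaw ν, p x) (v : List ℕ) :
    ∀ᵐ x ∂realLaw ν, ∀ᵐ y ∂realLaw ν, p (graft v x y) :=
  Measure.ae_ae_of_ae_prod ((measurePreserving_graft ν v).quasiMeasurePreserving.ae h)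

lemma ae_of_ae_graft {p : Realization → Prop} (hp : MeasurableSet {x | p x}) (v : List ℕ)
    (h : ∀ᵐ x ∂realLaw ν, ∀ᵐ y ∂realLaw ν, p (graft v x y)) : ∀ᵐ x ∂realLaw ν, p x := by
  rw [ae_iff, ← lintegral_indicator_one (by exact hp.compl), lintegral_graft ν v
    (measurable_one.indicator (by exact hp.compl))]
  refine lintegral_eq_zero_of_ae_eq_zero ?_
  filter_upwards [h] with x hx
  refine lintegral_eq_zero_of_ae_eq_zero ?_
  filter_upwards [hx] with y hy
  exact Set.indicator_of_notMem (by simpa using hy) _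

/-! ### No ties -/

/-- Given everything but the root clock `e`, `life` is `e` plus a constant, and `e` has a law
without atoms. -/
lemma ae_life_ne (hα : α < 0) (hν : ν {s | (s : ℕ → ℝ) = oneState} = 0) (c : ℝ) :
    ∀ᵐ x ∂realLaw ν, life α x ≠ c := by
  have hset : MeasurableSet {x : Realization | life α x ≠ c} :=
    measurable_life (measurableSet_singleton c).compl
  refine ae_of_ae_update ν hset [] ?_
  have h := ae_update ν ((ae_clockPos ν).and (ae_bddDeath_and_tendsto ν hα hν)) []
  filter_upwards [h] with x hx
  filter_upwards [hx] with s hs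
  obtain ⟨e₀, hc₀, hb₀, -⟩ := hs.exists
  have hne : ∀ᵐ e ∂expMeasure 1,
      e ≠ c - (life α (Function.update x [] (e₀, s)) - e₀) := by
    rw [ae_iff]
    simp
  filter_upwards [hs, hne] with e ⟨hc, hb, _⟩ hne hlife
  refine hne ?_
  have h1 := (agreeExceptClock_update [] x s e e₀).life_sub_le hb hc₀
  have h2 := (agreeExceptClock_update [] x s e₀ e).life_sub_le hb₀ hc
  simp only [Function.update_self] at h1 h2
  linarith

/-- Resampling the subtree of child `i` changes neither the root nor `childLife α x j`, while the
law of the resampled `life` has no atom. -/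
lemma ae_childLife_ne (hα : α < 0) (hν : ν {s | (s : ℕ → ℝ) = oneState} = 0) {i j : ℕ}
    (hij : i ≠ j) : ∀ᵐ x ∂realLaw ν, 0 < ((x []).2 : ℕ → ℝ) i →
      childLife α x i ≠ childLife α x j := by
  have hm : Measurable fun x : Realization => ((x []).2 : ℕ → ℝ) i :=
    (measurable_pi_apply i).comp (measurable_subtype_coe.comp
      (measurable_snd.comp (measurable_pi_apply [])))
  have hset : MeasurableSet {x : Realization | 0 < ((x []).2 : ℕ → ℝ) i →
      childLife α x i ≠ childLife α x j} := by
    refine MeasurableSet.imp (measurableSet_lt measurable_const hm) ?_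
    exact (measurableSet_eq_fun (measurable_childLife i) (measurable_childLife j)).compl
  refine ae_of_ae_graft ν hset [i] (.of_forall fun x => ?_)
  filter_upwards [ae_life_ne ν hα hν (childLife α x j / ((x []).2 : ℕ → ℝ) i ^ (-α))] with y hy
  have h0 : ∀ y, graft [i] x y [] = x [] := fun y => graft_of_not_suffix (by simp) _ _
  have hsub : subtree [j] (graft [i] x y) = subtree [j] x :=
    subtree_graft_of_incomparable (fun h => hij (by simpa using (h.eq_of_length rfl).symm))
      (fun h => hij (by simpa using h.eq_of_length rfl)) _ _
  rw [h0]
  intro hpos heq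
  rw [childLife, childLife, h0, subtree_graft, hsub] at heq
  refine hy ?_
  rw [eq_div_iff (Real.rpow_pos_of_pos hpos _).ne', mul_comm, heq, childLife]

end AlmostSure

end

section

variable {α : ℝ} {x : Realization}

/-! ### No mass is reduced to dust at a single time -/

/-- A bound for the probability that the death of a block of mass `m` falls within `δ` of a given
time. -/
def gapBound (α δ m : ℝ) : ℝ≥0∞ := min 1 (ENNReal.ofReal (2 * δ / m ^ (-α)))

lemma measurable_gapBound (δ : ℝ) : Measurable (gapBound α δ) := by
  unfold gapBound
  exact measurable_const.min (((measurable_id.pow_const _).const_div _).ennreal_ofReal)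

lemma gapBound_le_one (δ m : ℝ) : gapBound α δ m ≤ 1 := min_le_left _ _

lemma tendsto_gapBound (m : ℝ) :
    Tendsto (fun j : ℕ => gapBound α (1 / ((j : ℝ) + 1)) m) atTop (𝓝 0) := by
  have h1 : Tendsto (fun j : ℕ => ENNReal.ofReal (2 * (1 / ((j : ℝ) + 1)) / m ^ (-α)))
      atTop (𝓝 (ENNReal.ofReal (2 * 0 / m ^ (-α)))) :=
    ENNReal.tendsto_ofReal
      ((tendsto_one_div_add_atTop_nhds_zero_nat.const_mul 2).div_const _)
  rw [mul_zero, zero_div, ENNReal.ofReal_zero] at h1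
  exact tendsto_of_tendsto_of_tendsto_of_le_of_le tendsto_const_nhds h1 (fun _ => zero_le)
    fun _ => min_le_right _ _

lemma tsum_tsum_mass_le (x : Realization) (k : ℕ) (δ : ℝ) (u : Lev k) :
    ∑' u' : Lev k, ENNReal.ofReal (mass x u'.1) *
      (({u} : Set (Lev k)).indicator 1 u' + gapBound α δ (mass x u.1)) ≤
      ENNReal.ofReal (mass x u.1) + gapBound α δ (mass x u.1) := by
  simp_rw [mul_add]
  rw [ENNReal.tsum_add, ENNReal.tsum_mul_right, tsum_lev_mass, one_mul]
  refine add_le_add_left (le_of_eq ?_) _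
  rw [tsum_eq_single u]
  · simp
  · intro u' hu'
    simp [hu']

/-- Pairs of words are grouped by their ancestors in generation `k`, whose progeny carries their
mass. A common ancestor `u` contributes `mass x u ^ 2`; the `gapBound` term is summed over all
pairs. -/
lemma tsum_pairs_le (x : Realization) (l k : ℕ) (δ : ℝ) :
    ∑' p : (Lev l × Lev k) × (Lev l × Lev k),
      ENNReal.ofReal (mass x (p.1.1.1 ++ p.1.2.1)) * ENNReal.ofReal (mass x (p.2.1.1 ++ p.2.2.1)) *
        (({p.1.2} : Set (Lev k)).indicator 1 p.2.2 + gapBound α δ (mass x p.1.2.1)) ≤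
      (∑' u : Lev k, ENNReal.ofReal (mass x u.1 ^ (2 : ℝ)) * 1) +
        ∑' u : Lev k, ENNReal.ofReal (mass x u.1) * gapBound α δ (mass x u.1) := by
  rw [ENNReal.tsum_prod', ENNReal.tsum_prod', ENNReal.tsum_comm, ← ENNReal.tsum_add]
  refine ENNReal.tsum_le_tsum fun u => ?_
  have h1 : ∀ v1 : Lev l, ∑' q : Lev l × Lev k,
      ENNReal.ofReal (mass x (v1.1 ++ u.1)) * ENNReal.ofReal (mass x (q.1.1 ++ q.2.1)) *
        (({u} : Set (Lev k)).indicator 1 q.2 + gapBound α δ (mass x u.1)) =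
      ENNReal.ofReal (mass x (v1.1 ++ u.1)) * ∑' u' : Lev k, ENNReal.ofReal (mass x u'.1) *
        (({u} : Set (Lev k)).indicator 1 u' + gapBound α δ (mass x u.1)) := by
    intro v1
    simp_rw [mul_assoc]
    rw [ENNReal.tsum_mul_left, ENNReal.tsum_prod', ENNReal.tsum_comm]
    congr 1
    refine tsum_congr fun u' => ?_
    simp only
    rw [ENNReal.tsum_mul_right, tsum_lev_mass_append]
  simp_rw [h1]
  rw [ENNReal.tsum_mul_right, tsum_lev_mass_append]
  refine (mul_le_mul_right (tsum_tsum_mass_le x k δ u) _).trans (le_of_eq ?_)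
  rw [mul_add, mul_one, Real.rpow_two, sq, ENNReal.ofReal_mul (mass_nonneg _ _)]

section AlmostSure

variable (ν : Measure UnitMassSeq) [IsProbabilityMeasure ν]

lemma measurable_pair_indicator (v v' : List ℕ) (δ : ℝ) :
    Measurable fun x : Realization => {x : Realization | |birth α x v - birth α x v'| < δ}.indicator
      (fun x => ENNReal.ofReal (mass x v) * ENNReal.ofReal (mass x v')) x := by
  refine Measurable.indicator
    ((measurable_mass _).ennreal_ofReal.mul (measurable_mass _).ennreal_ofReal) ?_
  have := (measurable_birth (α := α) v).sub (measurable_birth (α := α) v')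
  exact measurableSet_lt (continuous_abs.measurable.comp this) measurable_const

/-- Given everything but the clock of `u`, this clock moves the birth of `i :: v` at speed `mass x u
^ (-α)` and leaves the masses and the birth of `j :: v'` unchanged. The extra letter `i` guarantees
that the clock of `u` has run out before the birth considered. -/
lemma lintegral_pair_le {u u' v v' : List ℕ} (hlen : u.length = u'.length) (hne : u ≠ u')
    (hu : u <:+ v) (hu' : u' <:+ v') (i j : ℕ) (δ : ℝ) :
    ∫⁻ x, {x : Realization | |birth α x (i :: v) - birth α x (j :: v')| < δ}.indicator
      (fun x => ENNReal.ofReal (mass x (i :: v)) * ENNReal.ofReal (mass x (j :: v'))) x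
        ∂realLaw ν ≤
      ∫⁻ x, ENNReal.ofReal (mass x (i :: v)) * ENNReal.ofReal (mass x (j :: v')) *
        gapBound α δ (mass x u) ∂realLaw ν := by
  have hnot : ¬ u <:+ v' := fun h => hne (eq_of_suffix_of_suffix_of_length_eq h hu' hlen)
  have hm2 : Measurable fun x : Realization => ENNReal.ofReal (mass x (i :: v)) *
      ENNReal.ofReal (mass x (j :: v')) * gapBound α δ (mass x u) :=
    ((measurable_mass _).ennreal_ofReal.mul (measurable_mass _).ennreal_ofReal).mul
      ((measurable_gapBound δ).comp (measurable_mass u))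
  rw [lintegral_update ν u (measurable_pair_indicator _ _ _), lintegral_update ν u hm2]
  refine lintegral_mono fun x => lintegral_mono fun s => ?_
  set z : ℝ → Realization := fun e => Function.update x u (e, s) with hz
  have hag : ∀ e, AgreeExceptClock u (z 0) (z e) := fun e => agreeExceptClock_update u x s 0 e
  have hmass : ∀ e w, mass (z e) w = mass (z 0) w := fun e w => (hag e).mass_eq w
  have hb1 : ∀ e, birth α (z e) (i :: v) = birth α (z 0) (i :: v) + mass (z 0) u ^ (-α) * e := by
    intro e
    have := (hag e).death_eq (α := α) v
    rw [if_pos hu] at this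
    show death α (z e) v = death α (z 0) v + _
    simpa [hz] using this
  have hb2 : ∀ e, birth α (z e) (j :: v') = birth α (z 0) (j :: v') := by
    intro e
    have := (hag e).death_eq (α := α) v'
    rw [if_neg hnot, add_zero] at this
    exact this
  set M := ENNReal.ofReal (mass (z 0) (i :: v)) * ENNReal.ofReal (mass (z 0) (j :: v')) with hM
  have hL : ∀ e, {x : Realization | |birth α x (i :: v) - birth α x (j :: v')| < δ}.indicator
      (fun x => ENNReal.ofReal (mass x (i :: v)) * ENNReal.ofReal (mass x (j :: v'))) (z e) =
      M * {e | |(birth α (z 0) (i :: v) - birth α (z 0) (j :: v')) + mass (z 0) u ^ (-α) * e| < δ}.indicator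
        1 e := by
    intro e
    have harg : birth α (z e) (i :: v) - birth α (z e) (j :: v') =
      (birth α (z 0) (i :: v) - birth α (z 0) (j :: v')) + mass (z 0) u ^ (-α) * e := by
      rw [hb1, hb2]; ring
    by_cases h : |birth α (z e) (i :: v) - birth α (z e) (j :: v')| < δ
    · rw [Set.indicator_of_mem (by exact h), Set.indicator_of_mem (by rw [harg] at h; exact h),
        Pi.one_apply, mul_one]
      simp only [hmass e, hM]
    · rw [Set.indicator_of_notMem (by exact h),
        Set.indicator_of_notMem (by rw [harg] at h; exact h), mul_zero]
  have hR : ∀ e, ENNReal.ofReal (mass (z e) (i :: v)) * ENNReal.ofReal (mass (z e) (j :: v')) *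
      gapBound α δ (mass (z e) u) = M * gapBound α δ (mass (z 0) u) := by
    intro e
    simp only [hmass e, hM]
  calc (∫⁻ e, {x : Realization | |birth α x (i :: v) - birth α x (j :: v')| < δ}.indicator
      (fun x => ENNReal.ofReal (mass x (i :: v)) * ENNReal.ofReal (mass x (j :: v'))) (z e)
        ∂expMeasure 1)
      = ∫⁻ e, M * {e | |(birth α (z 0) (i :: v) - birth α (z 0) (j :: v')) +
          mass (z 0) u ^ (-α) * e| < δ}.indicator 1 e ∂expMeasure 1 := lintegral_congr hL
    _ ≤ M * gapBound α δ (mass (z 0) u) := by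
      have hset : MeasurableSet {e | |(birth α (z 0) (i :: v) - birth α (z 0) (j :: v')) +
          mass (z 0) u ^ (-α) * e| < δ} := by
        refine measurableSet_lt ?_ measurable_const
        fun_prop
      rw [lintegral_const_mul _ (measurable_one.indicator hset), lintegral_indicator_one hset]
      -- If `u` has no mass its descendants have none either, and both sides vanish; the interval
      -- estimate needs a positive speed.
      rcases (mass_nonneg (z 0) u).eq_or_lt with h0 | h0
      · have : mass (z 0) (i :: v) = 0 := by
          obtain ⟨w, rfl⟩ := hu
          refine le_antisymm ?_ (mass_nonneg _ _)
          exact (mass_append_le (z 0) (i :: w) u).trans h0.ge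
        have hM0 : M = 0 := by rw [hM, this]; simp
        rw [hM0, zero_mul, zero_mul]
      · gcongr
        exact le_min prob_le_one (expMeasure_abs_lt_le _ (Real.rpow_pos_of_pos h0 _) δ)
    _ = ∫⁻ e, ENNReal.ofReal (mass (z e) (i :: v)) * ENNReal.ofReal (mass (z e) (j :: v')) *
      gapBound α δ (mass (z e) u) ∂expMeasure 1 := by
      rw [lintegral_congr hR]
      simp

lemma lintegral_pairMass_le (l k : ℕ) (δ : ℝ) :
    ∫⁻ x, pairMass α x (l + 1 + k) δ ∂realLaw ν ≤ powSum ν 2 ^ k +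
      ∫⁻ x, ∑' u : Lev k, ENNReal.ofReal (mass x u.1) * gapBound α δ (mass x u.1) ∂realLaw ν := by
  classical
  have hmR : ∀ p : (Lev (l + 1) × Lev k) × (Lev (l + 1) × Lev k),
      Measurable fun x : Realization =>
      ENNReal.ofReal (mass x (p.1.1.1 ++ p.1.2.1)) * ENNReal.ofReal (mass x (p.2.1.1 ++ p.2.2.1)) *
        (({p.1.2} : Set (Lev k)).indicator 1 p.2.2 + gapBound α δ (mass x p.1.2.1)) := fun p =>
    ((measurable_mass _).ennreal_ofReal.mul (measurable_mass _).ennreal_ofReal).mul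
      (measurable_const.add ((measurable_gapBound δ).comp (measurable_mass _)))
  have hmain : ∫⁻ x, pairMass α x (l + 1 + k) δ ∂realLaw ν ≤
      ∫⁻ x, ∑' p : (Lev (l + 1) × Lev k) × (Lev (l + 1) × Lev k),
      ENNReal.ofReal (mass x (p.1.1.1 ++ p.1.2.1)) * ENNReal.ofReal (mass x (p.2.1.1 ++ p.2.2.1)) *
        (({p.1.2} : Set (Lev k)).indicator 1 p.2.2 + gapBound α δ (mass x p.1.2.1))
          ∂realLaw ν := by
    rw [lintegral_tsum fun p => (hmR p).aemeasurable]
    have hpm : ∀ x : Realization, pairMass α x (l + 1 + k) δ =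
        ∑' p : (Lev (l + 1) × Lev k) × (Lev (l + 1) × Lev k),
        {x : Realization | |birth α x (p.1.1.1 ++ p.1.2.1) - birth α x (p.2.1.1 ++ p.2.2.1)| <
          δ}.indicator (fun x => ENNReal.ofReal (mass x (p.1.1.1 ++ p.1.2.1)) *
            ENNReal.ofReal (mass x (p.2.1.1 ++ p.2.2.1))) x := by
      intro x
      rw [pairMass, ← ((levAppend (l + 1) k).prodCongr (levAppend (l + 1) k)).tsum_eq]
      refine tsum_congr fun p => ?_
      simp only [Set.indicator]
      rfl
    simp_rw [hpm]
    rw [lintegral_tsum fun p => (measurable_pair_indicator _ _ _).aemeasurable]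
    refine ENNReal.tsum_le_tsum fun p => ?_
    obtain ⟨⟨⟨v, hv⟩, ⟨u, hu⟩⟩, ⟨⟨v', hv'⟩, ⟨u', hu'⟩⟩⟩ := p
    obtain ⟨i, v, rfl⟩ := List.exists_cons_of_length_eq_add_one hv
    obtain ⟨j, v', rfl⟩ := List.exists_cons_of_length_eq_add_one hv'
    -- Equal ancestors are bounded trivially, through the indicator; distinct ones have clocks that
    -- can be moved separately.
    by_cases huu : u = u'
    · subst huu
      refine lintegral_mono fun x => ?_
      refine (Set.indicator_le_self _ _ _).trans (le_mul_of_one_le_right zero_le ?_)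
      simp
    · refine (lintegral_pair_le ν (hu.trans hu'.symm) huu (List.suffix_append v u)
        (List.suffix_append v' u') i j δ).trans (lintegral_mono fun x => ?_)
      simp only [List.cons_append]
      gcongr
      exact le_add_self
  refine hmain.trans ((lintegral_mono fun x => tsum_pairs_le x (l + 1) k δ).trans (le_of_eq ?_))
  have hm1 : ∀ u : Lev k, Measurable fun x : Realization =>
      ENNReal.ofReal (mass x u.1 ^ (2 : ℝ)) * 1 := fun u =>
    ((measurable_mass _).pow_const _).ennreal_ofReal.mul_const _
  rw [lintegral_add_left (Measurable.tsum hm1), lintegral_tsum fun u => (hm1 u).aemeasurable]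
  congr 1
  have := fun u : Lev k => lintegral_mass_pow ν 2 (f := fun _ => 1) measurable_const u.1
  simp_rw [this]
  simp only [lintegral_one, measure_univ, mul_one]
  rw [tsum_lev_prod, powSum]

lemma tendsto_lintegral_gapBound (k : ℕ) :
    Tendsto (fun j : ℕ => ∫⁻ x, ∑' u : Lev k, ENNReal.ofReal (mass x u.1) *
      gapBound α (1 / ((j : ℝ) + 1)) (mass x u.1) ∂realLaw ν) atTop (𝓝 0) := by
  have hterm : ∀ (x : Realization) (δ : ℝ) (u : Lev k),
      ENNReal.ofReal (mass x u.1) * gapBound α δ (mass x u.1) ≤ ENNReal.ofReal (mass x u.1) :=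
    fun x δ u => mul_le_of_le_one_right zero_le (gapBound_le_one _ _)
  have hm : ∀ δ : ℝ, Measurable fun x : Realization => ∑' u : Lev k, ENNReal.ofReal (mass x u.1) *
      gapBound α δ (mass x u.1) := fun δ => Measurable.tsum fun u =>
    (measurable_mass _).ennreal_ofReal.mul ((measurable_gapBound δ).comp (measurable_mass _))
  have key := tendsto_lintegral_of_dominated_convergence (μ := realLaw ν)
    (F := fun (j : ℕ) (x : Realization) => ∑' u : Lev k, ENNReal.ofReal (mass x u.1) *
      gapBound α (1 / ((j : ℝ) + 1)) (mass x u.1)) (f := 0) (fun _ => 1) (fun j => hm _)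
    (fun j => .of_forall fun x => ?_) (by simp) (.of_forall fun x => ?_)
  · simpa using key
  · exact (ENNReal.tsum_le_tsum (hterm x _)).trans (tsum_lev_mass x k).le
  · let _ : MeasurableSpace (Lev k) := ⊤
    simp_rw [← lintegral_count]
    have := tendsto_lintegral_of_dominated_convergence (μ := (Measure.count : Measure (Lev k)))
      (F := fun (j : ℕ) (u : Lev k) => ENNReal.ofReal (mass x u.1) *
        gapBound α (1 / ((j : ℝ) + 1)) (mass x u.1)) (f := 0)
      (fun u => ENNReal.ofReal (mass x u.1)) (fun j => measurable_from_top)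
      (fun j => .of_forall fun u => hterm x _ u) (by rw [lintegral_count, tsum_lev_mass]; simp)
      (.of_forall fun u => ?_)
    · simpa using this
    · have := ENNReal.Tendsto.const_mul (a := ENNReal.ofReal (mass x u.1))
        (tendsto_gapBound (α := α) (mass x u.1)) (Or.inr ENNReal.ofReal_ne_top)
      simpa using this

lemma ae_exists_frequently_pairMass_lt (hν : ν {s | (s : ℕ → ℝ) = oneState} = 0) {η : ℝ≥0∞}
    (hη : 0 < η) : ∀ᵐ x ∂realLaw ν, ∃ δ : ℝ, 0 < δ ∧ ∃ᶠ n in atTop, pairMass α x n δ < η := by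
  set L : ℕ → Realization → ℝ≥0∞ := fun j x =>
    liminf (fun n => pairMass α x n (1 / ((j : ℝ) + 1))) atTop with hL
  have hLm : ∀ j, Measurable (L j) := fun j => Measurable.liminf fun n => measurable_pairMass n _
  set B : Set Realization := {x | ∀ j, η ≤ L j x} with hB
  -- By Fatou's lemma the limit over generations comes first. Then `δ → 0` (through `j`) removes the
  -- `gapBound` term for fixed `k`, and `k → ∞` removes `powSum ν 2 ^ k`.
  have hbound : ∀ j k : ℕ, η * realLaw ν B ≤ powSum ν 2 ^ k +
      ∫⁻ x, ∑' u : Lev k, ENNReal.ofReal (mass x u.1) *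
        gapBound α (1 / ((j : ℝ) + 1)) (mass x u.1) ∂realLaw ν := by
    intro j k
    calc η * realLaw ν B ≤ η * realLaw ν {x | η ≤ L j x} := by
          gcongr
          exact fun x hx => hx j
      _ ≤ ∫⁻ x, L j x ∂realLaw ν := mul_meas_ge_le_lintegral (hLm j) η
      _ ≤ liminf (fun n => ∫⁻ x, pairMass α x n (1 / ((j : ℝ) + 1)) ∂realLaw ν) atTop :=
          lintegral_liminf_le fun n => measurable_pairMass n _
      _ ≤ _ := by
          refine liminf_le_of_frequently_le' (Eventually.frequently ?_)
          filter_upwards [eventually_ge_atTop (k + 1)] with n hn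
          obtain ⟨l, rfl⟩ : ∃ l, n = l + 1 + k := ⟨n - (k + 1), by omega⟩
          exact lintegral_pairMass_le ν l k _
  have h1 : ∀ k : ℕ, η * realLaw ν B ≤ powSum ν 2 ^ k := by
    intro k
    have := (tendsto_lintegral_gapBound (α := α) ν k).const_add (powSum ν 2 ^ k)
    rw [add_zero] at this
    exact ge_of_tendsto' this fun j => hbound j k
  have h2 : η * realLaw ν B ≤ 0 :=
    ge_of_tendsto' (ENNReal.tendsto_pow_atTop_nhds_zero_of_lt_one
      (powSum_lt_one ν hν (by norm_num))) h1
  have h3 : realLaw ν B = 0 := by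
    rcases mul_eq_zero.1 (le_antisymm h2 zero_le) with h | h
    exacts [absurd h hη.ne', h]
  rw [ae_iff]
  refine measure_mono_null (fun x hx => ?_) h3
  intro j
  by_contra! hlt
  refine hx ⟨1 / ((j : ℝ) + 1), by positivity, ?_⟩
  exact frequently_lt_of_liminf_lt (by isBoundedDefault) hlt

/-! ### Regularity -/

lemma ae_nice (hα : α < 0) (hν : ν {s | (s : ℕ → ℝ) = oneState} = 0) :
    ∀ᵐ x ∂realLaw ν, Nice α x := by
  have h1 : ∀ᵐ x ∂realLaw ν, ∀ i, ((x []).2 : ℕ → ℝ) i < 1 := by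
    have e1 : MeasurePreserving (fun x : Realization => x []) (realLaw ν) (nodeLaw ν) :=
      measurePreserving_eval_infinitePi (fun _ => nodeLaw ν) []
    have e2 : MeasurePreserving (Prod.snd : ℝ × UnitMassSeq → UnitMassSeq) (nodeLaw ν) ν :=
      measurePreserving_snd
    exact (e2.comp e1).quasiMeasurePreserving.ae (ae_lt_one ν hν)
  have h2 : ∀ᵐ x ∂realLaw ν, ∀ i j, i ≠ j → 0 < ((x []).2 : ℕ → ℝ) i →
      childLife α x i ≠ childLife α x j := by
    refine ae_all_iff.2 fun i => ae_all_iff.2 fun j => ?_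
    by_cases hij : i = j
    · exact .of_forall fun x h => absurd hij h
    · filter_upwards [ae_childLife_ne ν hα hν hij] with x hx _
      exact hx
  have h3 : ∀ᵐ x ∂realLaw ν, ∀ m : ℕ, ∃ δ : ℝ, 0 < δ ∧
      ∃ᶠ n in atTop, pairMass α x n δ < (m : ℝ≥0∞)⁻¹ :=
    ae_all_iff.2 fun m => ae_exists_frequently_pairMass_lt ν hν (by simp)
  filter_upwards [ae_clockPos ν, h1, ae_bddDeath_and_tendsto ν hα hν, ae_tendsto_mass ν hν, h2, h3]
    with x hc h1 hb hm h2 h3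
  refine ⟨hc [], h1, hb.1, hm, hb.2, fun i j hij hi _ => h2 i j hij hi, fun η hη => ?_⟩
  obtain ⟨m, hm⟩ := ENNReal.exists_inv_nat_lt hη.ne'
  obtain ⟨δ, hδ, hf⟩ := h3 m
  exact ⟨δ, hδ, hf.mono fun n hn => hn.trans hm⟩

lemma ae_good (hα : α < 0) (hν : ν {s | (s : ℕ → ℝ) = oneState} = 0) :
    ∀ᵐ x ∂realLaw ν, Good α x :=
  ae_all_iff.2 fun v => (measurePreserving_subtree ν v).quasiMeasurePreserving.ae (ae_nice ν hα hν)

end AlmostSure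

end

section

variable {α : ℝ} {x : Realization}

/-! ### Changing the fragmentation of a sibling of the spine -/

/-- The time that is left, in the units of the `m`-th block that splits off at the `n`-th split of
the last fragment. -/
def sibTime (α : ℝ) (x : Realization) (n m : ℕ) : ℝ :=
  mass x (sibWord α x n m) ^ α * (life α x - spineTime α x (n + 1))

/-- The time-reversed fragmentation of the `m`-th block that splits off at the `n`-th split of
the last fragment. -/
def sibPath (α : ℝ) (x : Realization) (n m : ℕ) : ℝ≥0 → ℕ → ℝ :=
  revPath α (subtree (sibWord α x n m) x) (sibTime α x n m)

lemma birth_sibWord (n m : ℕ) : birth α x (sibWord α x n m) = spineTime α x (n + 1) := rfl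

lemma length_sibWord (n m : ℕ) : (sibWord α x n m).length = n + 1 := by
  simp [sibWord]

lemma sibWord_ne_spine (n m : ℕ) : sibWord α x n m ≠ spine α x (n + 1) := by
  intro h
  rw [sibWord, spine] at h
  exact sibIdx_ne _ _ (List.cons.inj h).1

lemma not_sibWord_suffix_spine (n m k : ℕ) : ¬ sibWord α x n m <:+ spine α x k := by
  intro h
  have hlen := h.length_le
  rw [length_sibWord, length_spine] at hlen
  refine sibWord_ne_spine n m (eq_of_suffix_of_suffix_of_length_eq h (spine_suffix α x hlen) ?_)
  rw [length_sibWord, length_spine]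

lemma not_sibWord_suffix_sibWord {n m n' m' : ℕ} (h : (n, m) ≠ (n', m')) :
    ¬ sibWord α x n m <:+ sibWord α x n' m' := by
  intro hs
  have h2 := hs
  rw [sibWord.eq_def α x n' m', List.suffix_cons_iff] at hs
  rcases hs with hs | hs
  · have hn : n = n' := by
      have := congrArg List.length hs
      simpa [length_sibWord] using this
    subst hn
    rw [sibWord] at hs
    have := sibIdx_injective _ (List.cons.inj hs).1
    exact h (by rw [this])
  · exact not_sibWord_suffix_spine _ _ _ hs

/-- A sibling of a spine block is reduced to dust strictly before `life`; the inequality is this one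
in the units of the sibling. -/
lemma Good.life_sib_lt (hα : α < 0) (h : Good α x) {n m : ℕ}
    (hm : 0 < mass x (sibWord α x n m)) :
    life α (subtree (sibWord α x n m) x) < sibTime α x n m := by
  have h1 : dust α x (sibWord α x n m) < dust α x (spine α x n) :=
    h.dust_cons_lt hα (h.mass_spine_pos hα n) (sibIdx_ne _ _)
  rw [h.dust_spine hα, dust, birth_sibWord] at h1
  have hp : 0 < mass x (sibWord α x n m) ^ α := Real.rpow_pos_of_pos hm _
  have hinv : mass x (sibWord α x n m) ^ (-α) = (mass x (sibWord α x n m) ^ α)⁻¹ :=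
    Real.rpow_neg hm.le _
  rw [hinv] at h1
  rw [sibTime, ← inv_mul_lt_iff₀ hp]
  linarith

/-- The realizations `x` and `z` differ at most in the fragmentation of the block `v`. -/
def AgreeOff (v : List ℕ) (x z : Realization) : Prop := ∀ u, ¬ v <:+ u → z u = x u

lemma agreeOff_graft (v : List ℕ) (x y y' : Realization) :
    AgreeOff v (graft v x y) (graft v x y') := fun u hu => by
  rw [graft_of_not_suffix hu, graft_of_not_suffix hu]

lemma not_suffix_of_not_suffix_cons {v u : List ℕ} {i : ℕ} (h : ¬ v <:+ i :: u) : ¬ v <:+ u :=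
  fun hu => h (hu.trans (List.suffix_cons _ _))

lemma AgreeOff.mass_eq {v : List ℕ} {x z : Realization} (h : AgreeOff v x z) :
    ∀ {u : List ℕ}, ¬ v <:+ u → mass z u = mass x u
  | [], _ => rfl
  | i :: u, hu => by
    have hu' := not_suffix_of_not_suffix_cons hu
    rw [mass, mass, h.mass_eq hu', h u hu']

lemma AgreeOff.birth_eq {v : List ℕ} {x z : Realization} (h : AgreeOff v x z) :
    ∀ {u : List ℕ}, ¬ v <:+ u → birth α z u = birth α x u
  | [], _ => rfl
  | i :: u, hu => by
    have hu' := not_suffix_of_not_suffix_cons hu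
    rw [birth, birth, h.birth_eq hu', h.mass_eq hu', h u hu']

lemma AgreeOff.death_eq {v : List ℕ} {x z : Realization} (h : AgreeOff v x z) {u : List ℕ}
    (hu : ¬ v <:+ u) : death α z u = death α x u := by
  rw [death, death, h.birth_eq hu, h.mass_eq hu, h u hu]

lemma AgreeOff.mass_cons_eq {v : List ℕ} {x z : Realization} (h : AgreeOff v x z) {u : List ℕ}
    (hu : ¬ v <:+ u) (i : ℕ) : mass z (i :: u) = mass x (i :: u) := by
  rw [mass, mass, h.mass_eq hu, h u hu]

lemma AgreeOff.subtree_eq {v : List ℕ} {x z : Realization} (h : AgreeOff v x z) {u : List ℕ}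
    (h1 : ¬ v <:+ u) (h2 : ¬ u <:+ v) : subtree u z = subtree u x := by
  funext w
  refine h _ fun hw => ?_
  rcases List.suffix_or_suffix_of_suffix hw (List.suffix_append w u) with h | h
  exacts [h1 h, h2 h]

/-- `z` is obtained from `x` by changing the fragmentation of the block that splits off the spine at
the index `(n, m)`, in such a way that the block is still not the last to be reduced to dust. -/
structure SibChange (α : ℝ) (n m : ℕ) (x z : Realization) : Prop where
  good : Good α x
  good' : Good α z
  pos : 0 < mass x (sibWord α x n m)
  agree : AgreeOff (sibWord α x n m) x z
  lt : life α (subtree (sibWord α x n m) z) < sibTime α x n m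

namespace SibChange

variable {n m : ℕ} {z : Realization}

/-- The changed block still ends before the old `life`, all other splitting times are the same, and
the spine from generation `n + 1` on lies outside the changed subtree, so the old value is still
attained. -/
lemma life_eq (hα : α < 0) (h : SibChange α n m x z) : life α z = life α x := by
  have hns := not_sibWord_suffix_spine (α := α) (x := x) n m
  have hmass : mass z (sibWord α x n m) = mass x (sibWord α x n m) :=
    h.agree.mass_cons_eq (hns n) _
  have hbirth : birth α z (sibWord α x n m) = spineTime α x (n + 1) := h.agree.death_eq (hns n)
  refine le_antisymm (life_le h.good'.clockPos fun w hw => ?_) ?_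
  · by_cases hv : sibWord α x n m <:+ w
    · refine (death_le_dust h.good'.bdd hv hw).trans ?_
      rw [dust, hmass, hbirth]
      have hp : 0 < mass x (sibWord α x n m) ^ α := Real.rpow_pos_of_pos h.pos _
      have hlt := h.lt
      rw [sibTime, ← inv_mul_lt_iff₀ hp, ← Real.rpow_neg h.pos.le] at hlt
      linarith
    · rw [h.agree.death_eq hv]
      rw [h.agree.mass_eq hv] at hw
      exact death_le_life h.good.bdd hw
  · have h1 : ¬ spine α x (n + 1) <:+ sibWord α x n m := fun hs =>
      sibWord_ne_spine n m (hs.eq_of_length (by rw [length_sibWord, length_spine])).symm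
    have h2 : dust α z (spine α x (n + 1)) = life α x := by
      rw [dust, h.agree.birth_eq (hns _), h.agree.mass_eq (hns _), h.agree.subtree_eq (hns _) h1,
        ← dust, h.good.dust_spine hα]
    rw [← h2]
    refine h.good'.dust_le_life ?_
    rw [h.agree.mass_eq (hns _)]
    exact h.good.mass_spine_pos hα _

lemma spine_eq (hα : α < 0) (h : SibChange α n m x z) (k : ℕ) : spine α z k = spine α x k := by
  have hns := not_sibWord_suffix_spine (α := α) (x := x) n m
  -- Beyond generation `n` a spine block is incomparable with the changed block, so its dust time is
  -- unchanged and still equals `life`; this identifies it as the new spine block. Earlier spine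
  -- blocks are then ancestors of the one in generation `n + 1`.
  have hlarge : ∀ k, n + 1 ≤ k → spine α z k = spine α x k := by
    intro k hk
    have h1 : ¬ spine α x k <:+ sibWord α x n m := fun hs => by
      have hl := hs.length_le
      rw [length_spine, length_sibWord] at hl
      obtain rfl : k = n + 1 := by omega
      exact sibWord_ne_spine n m (hs.eq_of_length (by rw [length_sibWord, length_spine])).symm
    have h2 : dust α z (spine α x k) = life α z := by
      rw [dust, h.agree.birth_eq (hns _), h.agree.mass_eq (hns _), h.agree.subtree_eq (hns _) h1,
        ← dust, h.good.dust_spine hα, h.life_eq hα]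
    have h3 := h.good'.eq_spine hα (u := spine α x k)
      (by rw [h.agree.mass_eq (hns _)]; exact h.good.mass_spine_pos hα _) h2
    rw [length_spine] at h3
    exact h3.symm
  rcases le_total (n + 1) k with hk | hk
  · exact hlarge k hk
  · refine eq_of_suffix_of_suffix_of_length_eq (w := spine α x (n + 1)) ?_ (spine_suffix α x hk)
      (by simp)
    rw [← hlarge _ le_rfl]
    exact spine_suffix α z hk

lemma mass_spine_eq (hα : α < 0) (h : SibChange α n m x z) (k : ℕ) :
    mass z (spine α z k) = mass x (spine α x k) := by
  rw [h.spine_eq hα, h.agree.mass_eq (not_sibWord_suffix_spine n m k)]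

lemma spineTime_eq (hα : α < 0) (h : SibChange α n m x z) (k : ℕ) :
    spineTime α z k = spineTime α x k := by
  rw [spineTime, spineTime, h.spine_eq hα, h.agree.birth_eq (not_sibWord_suffix_spine n m k)]

lemma sibWord_eq (hα : α < 0) (h : SibChange α n m x z) (n' m' : ℕ) :
    sibWord α z n' m' = sibWord α x n' m' := by
  have h1 := h.spine_eq hα (n' + 1)
  rw [spine, spine] at h1
  rw [sibWord, sibWord, (List.cons.inj h1).1, (List.cons.inj h1).2]

lemma mass_sibWord_eq (hα : α < 0) (h : SibChange α n m x z) (n' m' : ℕ) :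
    mass z (sibWord α z n' m') = mass x (sibWord α x n' m') := by
  rw [h.sibWord_eq hα]
  exact h.agree.mass_cons_eq (not_sibWord_suffix_spine n m n') _

lemma sibTime_eq (hα : α < 0) (h : SibChange α n m x z) (n' m' : ℕ) :
    sibTime α z n' m' = sibTime α x n' m' := by
  rw [sibTime, sibTime, h.mass_sibWord_eq hα, h.life_eq hα, h.spineTime_eq hα]

lemma spineCount_eq (hα : α < 0) (h : SibChange α n m x z) (ε : ℝ) :
    spineCount α ε z = spineCount α ε x := by
  simp_rw [spineCount, h.life_eq hα, h.spineTime_eq hα]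

lemma sibPath_eq (hα : α < 0) (h : SibChange α n m x z) {n' m' : ℕ} (hne : (n', m') ≠ (n, m)) :
    sibPath α z n' m' = sibPath α x n' m' := by
  rw [sibPath, sibPath, h.sibTime_eq hα, h.sibWord_eq hα,
    h.agree.subtree_eq (not_sibWord_suffix_sibWord hne.symm) (not_sibWord_suffix_sibWord hne)]

lemma chain_eq (hα : α < 0) (h : SibChange α n m x z) : chain α z = chain α x := by
  funext k
  have hΘ : chainΘ α z k = chainΘ α x k := by
    cases k with
    | zero => rfl
    | succ k => rw [h.good'.chainΘ_succ hα, h.good.chainΘ_succ hα, h.mass_spine_eq hα,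
        h.mass_spine_eq hα]
  have hΔ : chainΔ α z k = chainΔ α x k := by
    funext j
    cases k with
    | zero => rfl
    | succ k => rw [h.good'.chainΔ_succ hα, h.good.chainΔ_succ hα, h.mass_spine_eq hα,
        h.mass_sibWord_eq hα]
  have hZ : chainZ α z k = chainZ α x k := by
    rw [h.good'.chainZ_eq hα, h.good.chainZ_eq hα, h.mass_spine_eq hα, h.life_eq hα,
      h.spineTime_eq hα]
  rw [chain, chain, hΘ, hΔ, hZ]

end SibChange

/-- The function `f` vanishes if the `(n, m)`-th block that splits off the spine has no mass, and it
does not depend on the fragmentation of this block. -/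
def SibInvariant (α : ℝ) (n m : ℕ) (f : Realization → ℝ≥0∞) : Prop :=
  (∀ z, Good α z → f z ≠ 0 → 0 < mass z (sibWord α z n m)) ∧
    ∀ x z, SibChange α n m x z → f z = f x

lemma SibInvariant.mul {n m : ℕ} {f g : Realization → ℝ≥0∞} (hf : SibInvariant α n m f)
    (hg : ∀ x z, SibChange α n m x z → g z = g x) : SibInvariant α n m fun z => f z * g z :=
  ⟨fun z hz h0 => hf.1 z hz (left_ne_zero_of_mul h0), fun x z h => by
    simp only [hf.2 x z h, hg x z h]⟩

/-! ### Measurability -/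

lemma measurable_mass_sibWord (n m : ℕ) :
    Measurable fun x : Realization => mass x (sibWord α x n m) :=
  measurable_of_discrete_index (f := fun w x => mass x w) (measurableSet_sibWord n m) measurable_mass

lemma measurable_sibTime (n m : ℕ) : Measurable fun x : Realization => sibTime α x n m :=
  ((measurable_mass_sibWord n m).pow_const _).mul (measurable_life.sub (measurable_spineTime _))

lemma measurable_sibPath (n m : ℕ) : Measurable fun x : Realization => sibPath α x n m :=
  measurable_revPath (measurable_pi_lambda _ fun u =>
    measurable_of_discrete_index (f := fun w (x : Realization) => x (u ++ w))
      (measurableSet_sibWord n m) fun _ => measurable_pi_apply _) (measurable_sibTime n m)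

lemma lintegral_eq_tsum_discrete {β κ : Type*} [MeasurableSpace β] {μ : Measure β} [Countable κ]
    {g : β → κ} (hg : ∀ w, MeasurableSet {z | g z = w}) {F : β → ℝ≥0∞} (hF : Measurable F) :
    ∫⁻ z, F z ∂μ = ∑' w, ∫⁻ z, {z | g z = w}.indicator 1 z * F z ∂μ := by
  have hm : ∀ w, Measurable fun z => {z | g z = w}.indicator (1 : β → ℝ≥0∞) z * F z :=
    fun w => (measurable_one.indicator (hg w)).mul hF
  rw [← lintegral_tsum fun w => (hm w).aemeasurable]
  refine lintegral_congr fun z => ?_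
  rw [ENNReal.tsum_mul_right, tsum_eq_single (g z)]
  · simp
  · intro w hw
    simp [Ne.symm hw]

section Law

variable (ν : Measure UnitMassSeq)

/-- The law of the time-reversal, from time `c`, of the fragmentation conditioned to become extinct
before time `c`. -/
def revLaw (α c : ℝ) (B : Set (ℝ≥0 → ℕ → ℝ)) : ℝ≥0∞ :=
  (realLaw ν {x | life α x < c})⁻¹ * realLaw ν ({x | life α x < c} ∩ {x | revPath α x c ∈ B})

variable [IsProbabilityMeasure ν]

lemma measurable_revLaw {B : Set (ℝ≥0 → ℕ → ℝ)} (hB : MeasurableSet B) :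
    Measurable fun c => revLaw ν α c B := by
  have h1 : MeasurableSet {p : ℝ × Realization | life α p.2 < p.1} :=
    measurableSet_lt (measurable_life.comp measurable_snd) measurable_fst
  have h2 : MeasurableSet {p : ℝ × Realization | revPath α p.2 p.1 ∈ B} :=
    measurable_revPath measurable_snd measurable_fst hB
  exact (measurable_measure_prodMk_left h1).inv.mul (measurable_measure_prodMk_left (h1.inter h2))

lemma mul_revLaw (c : ℝ) (B : Set (ℝ≥0 → ℕ → ℝ)) :
    realLaw ν {x | life α x < c} * revLaw ν α c B =
      realLaw ν ({x | life α x < c} ∩ {x | revPath α x c ∈ B}) := by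
  rw [revLaw, ← mul_assoc]
  -- Conditioning on a null event causes no harm: the right-hand side is null as well.
  by_cases h0 : realLaw ν {x | life α x < c} = 0
  · rw [h0, zero_mul, zero_mul, measure_mono_null Set.inter_subset_left h0]
  · rw [ENNReal.mul_inv_cancel h0 (measure_ne_top _ _), one_mul]

/-- Integrate first over the subtree `y` grafted at `v`. As a function of `y`, the integrand is a
constant times the indicator of `life y < c₀`, and times that of `revPath ∈ B` on the left. The
ratio of the two integrals is the conditional law. -/
lemma lintegral_sibWord_eq (hα : α < 0) (hν : ν {s | (s : ℕ → ℝ) = oneState} = 0) {n m : ℕ}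
    {B : Set (ℝ≥0 → ℕ → ℝ)} (hB : MeasurableSet B) {f : Realization → ℝ≥0∞} (hf : Measurable f)
    (hinv : SibInvariant α n m f) (v : List ℕ)
    (hv : ∀ z, Good α z → f z ≠ 0 → sibWord α z n m = v) :
    ∫⁻ z, f z * B.indicator 1 (sibPath α z n m) ∂realLaw ν =
      ∫⁻ z, f z * revLaw ν α (sibTime α z n m) B ∂realLaw ν := by
  have hm1 : Measurable fun z => f z * B.indicator 1 (sibPath α z n m) :=
    hf.mul ((measurable_one.indicator hB).comp (measurable_sibPath n m))
  have hm2 : Measurable fun z => f z * revLaw ν α (sibTime α z n m) B :=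
    hf.mul ((measurable_revLaw ν hB).comp (measurable_sibTime n m))
  rw [lintegral_graft ν v hm1, lintegral_graft ν v hm2]
  refine lintegral_congr_ae ?_
  filter_upwards [ae_graft ν (ae_good ν hα hν) v] with x hx
  by_cases hex : ∃ y, Good α (graft v x y) ∧ f (graft v x y) ≠ 0
  · obtain ⟨y₀, hg₀, hf₀⟩ := hex
    have hw₀ := hv _ hg₀ hf₀
    have hp₀ := hinv.1 _ hg₀ hf₀
    have hl₀ := hg₀.life_sib_lt hα hp₀
    set z₀ := graft v x y₀ with hz₀
    set c₀ := sibTime α z₀ n m with hc₀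
    have hchange : ∀ y, Good α (graft v x y) → life α y < c₀ → SibChange α n m z₀ (graft v x y) :=
      fun y hg hlt => ⟨hg₀, hg, hp₀, by rw [hw₀]; exact agreeOff_graft v x y₀ y, by
        rw [hw₀, subtree_graft]; exact hlt⟩
    -- If `f` were nonzero at such a `y`, then, seen from `y`, passing to `y₀` would be an
    -- admissible change, since `life y₀ < c₀ ≤ life y`. The two thresholds would agree, yet `life
    -- y` lies below one and not below the other.
    have hvanish : ∀ y, Good α (graft v x y) → c₀ ≤ life α y → f (graft v x y) = 0 := by
      intro y hg hle
      by_contra hne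
      have hw := hv _ hg hne
      have hp := hinv.1 _ hg hne
      have hl := hg.life_sib_lt hα hp
      rw [hw, subtree_graft] at hl
      rw [hw₀, hz₀, subtree_graft] at hl₀
      have hc : SibChange α n m (graft v x y) z₀ :=
        ⟨hg, hg₀, hp, by rw [hw]; exact agreeOff_graft v x y y₀, by
          rw [hw, hz₀, subtree_graft]
          linarith⟩
      have := hc.sibTime_eq hα n m
      linarith
    have hL : ∀ᵐ y ∂realLaw ν, f (graft v x y) * B.indicator 1 (sibPath α (graft v x y) n m) =
        f z₀ * ({y | life α y < c₀} ∩ {y | revPath α y c₀ ∈ B}).indicator 1 y := by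
      filter_upwards [hx] with y hg
      rcases lt_or_ge (life α y) c₀ with hlt | hge
      · have hc := hchange y hg hlt
        have hpath : sibPath α (graft v x y) n m = revPath α y c₀ := by
          rw [sibPath, hc.sibTime_eq hα, hc.sibWord_eq hα, hw₀, subtree_graft]
        rw [hinv.2 _ _ hc, hpath]
        by_cases hyB : revPath α y c₀ ∈ B
        · rw [Set.indicator_of_mem hyB, Set.indicator_of_mem (by exact ⟨hlt, hyB⟩)]
          rfl
        · rw [Set.indicator_of_notMem hyB, Set.indicator_of_notMem fun hh => hyB hh.2]
      · rw [hvanish y hg hge, zero_mul, Set.indicator_of_notMem fun hh => not_lt.2 hge hh.1,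
          mul_zero]
    have hR : ∀ᵐ y ∂realLaw ν, f (graft v x y) * revLaw ν α (sibTime α (graft v x y) n m) B =
        f z₀ * revLaw ν α c₀ B * {y | life α y < c₀}.indicator 1 y := by
      filter_upwards [hx] with y hg
      rcases lt_or_ge (life α y) c₀ with hlt | hge
      · have hc := hchange y hg hlt
        rw [hinv.2 _ _ hc, hc.sibTime_eq hα, Set.indicator_of_mem (by exact hlt), Pi.one_apply,
          mul_one]
      · rw [hvanish y hg hge, zero_mul, Set.indicator_of_notMem (by exact not_lt.2 hge), mul_zero]
    have hs1 : MeasurableSet {y : Realization | life α y < c₀} :=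
      measurableSet_lt measurable_life measurable_const
    have hs2 : MeasurableSet {y : Realization | revPath α y c₀ ∈ B} :=
      measurable_revPath measurable_id measurable_const hB
    rw [lintegral_congr_ae hL, lintegral_congr_ae hR,
      lintegral_const_mul _ (measurable_one.indicator (hs1.inter hs2)),
      lintegral_const_mul _ (measurable_one.indicator hs1), lintegral_indicator_one (hs1.inter hs2),
      lintegral_indicator_one hs1, ← mul_revLaw, mul_assoc, mul_comm (revLaw ν α c₀ B)]
  · push Not at hex
    refine lintegral_congr_ae ?_
    filter_upwards [hx] with y hg
    rw [hex y hg, zero_mul, zero_mul]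

/-- The label of the sibling is random; the integral is split according to its countably many
values, which an admissible change does not affect. -/
lemma lintegral_sib (hα : α < 0) (hν : ν {s | (s : ℕ → ℝ) = oneState} = 0) {n m : ℕ}
    {B : Set (ℝ≥0 → ℕ → ℝ)} (hB : MeasurableSet B) {f : Realization → ℝ≥0∞} (hf : Measurable f)
    (hinv : SibInvariant α n m f) :
    ∫⁻ z, f z * B.indicator 1 (sibPath α z n m) ∂realLaw ν =
      ∫⁻ z, f z * revLaw ν α (sibTime α z n m) B ∂realLaw ν := by
  have hm1 : Measurable fun z => f z * B.indicator 1 (sibPath α z n m) :=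
    hf.mul ((measurable_one.indicator hB).comp (measurable_sibPath n m))
  have hm2 : Measurable fun z => f z * revLaw ν α (sibTime α z n m) B :=
    hf.mul ((measurable_revLaw ν hB).comp (measurable_sibTime n m))
  rw [lintegral_eq_tsum_discrete (measurableSet_sibWord (α := α) n m) hm1,
    lintegral_eq_tsum_discrete (measurableSet_sibWord (α := α) n m) hm2]
  refine tsum_congr fun v => ?_
  simp_rw [← mul_assoc]
  refine lintegral_sibWord_eq ν hα hν hB
    ((measurable_one.indicator (measurableSet_sibWord (α := α) n m v)).mul hf) ⟨fun z hz h0 => ?_,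
      fun x z h => ?_⟩ v fun z hz h0 => ?_
  · exact hinv.1 z hz (right_ne_zero_of_mul h0)
  · have : {z | sibWord α z n m = v}.indicator (1 : Realization → ℝ≥0∞) z =
        {z | sibWord α z n m = v}.indicator 1 x := by
      simp only [Set.indicator, Set.mem_ofPred_eq, h.sibWord_eq hα, Pi.one_apply]
    simp only [this, hinv.2 x z h]
  · by_contra hne
    exact left_ne_zero_of_mul h0 (Set.indicator_of_notMem (by exact hne) _)

/-- Given the spine, the time-reversed fragmentations of the blocks that split off from it are
independent, with explicit conditional laws. -/
lemma lintegral_prod_sib (hα : α < 0) (hν : ν {s | (s : ℕ → ℝ) = oneState} = 0) {ι : Type*}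
    (s : Finset ι) {e : ι → ℕ × ℕ} (he : Set.InjOn e s) {B : ι → Set (ℝ≥0 → ℕ → ℝ)}
    (hB : ∀ p, MeasurableSet (B p)) {f : Realization → ℝ≥0∞} (hf : Measurable f)
    (hinv : ∀ p ∈ s, SibInvariant α (e p).1 (e p).2 f) :
    ∫⁻ z, f z * ∏ p ∈ s, (B p).indicator 1 (sibPath α z (e p).1 (e p).2) ∂realLaw ν =
      ∫⁻ z, f z * ∏ p ∈ s, revLaw ν α (sibTime α z (e p).1 (e p).2) (B p) ∂realLaw ν := by
  classical
  induction s using Finset.induction_on generalizing f with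
  | empty => simp
  | insert a s ha ih =>
    have hne : ∀ p ∈ s, e p ≠ e a := fun p hp hpa =>
      ha (he (by simp [hp]) (by simp) hpa ▸ hp)
    have hma : Measurable fun z => (B a).indicator (1 : (ℝ≥0 → ℕ → ℝ) → ℝ≥0∞)
        (sibPath α z (e a).1 (e a).2) :=
      (measurable_one.indicator (hB a)).comp (measurable_sibPath _ _)
    -- The path at `a` is unaffected by changes at the other indices, so its indicator can be
    -- absorbed into `f`. Afterwards the conditional laws at the other indices depend only on
    -- remaining times, which a change at `a` preserves.
    have h1 := ih (he.mono (by simp)) (hf.mul hma) (fun p hp =>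
      (hinv p (Finset.mem_insert_of_mem hp)).mul fun x z h => by
        rw [h.sibPath_eq hα (by simpa using (hne p hp).symm)])
    have hmp : Measurable fun z => ∏ p ∈ s, revLaw ν α (sibTime α z (e p).1 (e p).2) (B p) :=
      Finset.measurable_prod s fun p _ => (measurable_revLaw ν (hB p)).comp (measurable_sibTime _ _)
    have h2 := lintegral_sib ν hα hν (hB a) (hf.mul hmp)
      ((hinv a (Finset.mem_insert_self _ _)).mul fun x z h => by
        simp only [h.sibTime_eq hα])
    calc _ = ∫⁻ z, f z * (B a).indicator 1 (sibPath α z (e a).1 (e a).2) *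
          ∏ p ∈ s, (B p).indicator 1 (sibPath α z (e p).1 (e p).2) ∂realLaw ν := by
          refine lintegral_congr fun z => ?_
          rw [Finset.prod_insert ha, mul_assoc]
      _ = _ := h1
      _ = ∫⁻ z, f z * (∏ p ∈ s, revLaw ν α (sibTime α z (e p).1 (e p).2) (B p)) *
          (B a).indicator 1 (sibPath α z (e a).1 (e a).2) ∂realLaw ν := by
          refine lintegral_congr fun z => ?_
          simp only [Pi.mul_apply]
          ring
      _ = _ := h2
      _ = _ := by
          refine lintegral_congr fun z => ?_
          rw [Finset.prod_insert ha]
          simp only [Pi.mul_apply]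
          ring

end Law

end

section

variable {α ε : ℝ} {x : Realization}

/-! ### The chain and the re-centering, in terms of the spine -/

/-- The ratio of the masses of consecutive blocks of the spine. -/
def spineRatio (α : ℝ) (x : Realization) : ℕ → ℝ
  | 0 => 1
  | n + 1 => mass x (spine α x (n + 1)) / mass x (spine α x n)

/-- The relative masses of the siblings of a block of the spine. -/
def spineSib (α : ℝ) (x : Realization) : ℕ → ℕ → ℝ
  | 0, _ => 0
  | n + 1, m => mass x (sibWord α x n m) / mass x (spine α x n)

/-- The chain of the masses and remaining life times along the spine. -/
def spineChain (α : ℝ) (x : Realization) : ℕ → ℝ × ℝ × (ℕ → ℝ) := fun n =>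
  (mass x (spine α x n) ^ α * (life α x - spineTime α x n), spineRatio α x n, spineSib α x n)

lemma Good.chain_eq (hα : α < 0) (h : Good α x) : chain α x = spineChain α x := by
  funext n
  have h1 : chainΘ α x n = spineRatio α x n := by
    cases n with
    | zero => rfl
    | succ n => exact h.chainΘ_succ hα n
  have h2 : chainΔ α x n = spineSib α x n := by
    funext m
    cases n with
    | zero => rfl
    | succ n => exact h.chainΔ_succ hα n m
  rw [chain, spineChain, h1, h2, h.chainZ_eq hα]

lemma measurable_spineChain : Measurable fun x : Realization => spineChain α x := by
  refine measurable_pi_lambda _ fun n => ?_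
  refine (((measurable_mass_spine n).pow_const _).mul
    (measurable_life.sub (measurable_spineTime n))).prodMk (Measurable.prodMk ?_ ?_)
  · cases n with
    | zero => exact measurable_const
    | succ n => exact (measurable_mass_spine _).div (measurable_mass_spine n)
  · refine measurable_pi_lambda _ fun m => ?_
    cases n with
    | zero => exact measurable_const
    | succ n => exact (measurable_mass_sibWord n m).div (measurable_mass_spine n)

/-- The generation, shifted by `-1`, of the blocks that split off at the time `T_{N_ε + i}`. -/
def sibLevel (α ε : ℝ) (x : Realization) (i : ℤ) : ℕ := ((spineCount α ε x : ℤ) + i - 1).toNat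

/-- The property of being an index of a block that splits off the spine, in terms of the spine. -/
def IsSibIndex (α ε : ℝ) (x : Realization) (i : ℤ) (m : ℕ) : Prop :=
  ε ≤ life α x ∧ 1 ≤ (spineCount α ε x : ℤ) + i ∧
    0 < mass x (sibWord α x (sibLevel α ε x i) m)

lemma Good.shift_eq (hα : α < 0) (h : Good α x) (hε : 0 < ε) (hl : ε ≤ life α x) {i : ℤ}
    (hi : 1 ≤ (spineCount α ε x : ℤ) + i) :
    (NepsInt α x ε + i).toNat = sibLevel α ε x i + 1 := by
  rw [h.NepsInt_eq hα hε hl, sibLevel]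
  omega

lemma Good.shiftΔ_eq (hα : α < 0) (h : Good α x) (hε : 0 < ε) (hl : ε ≤ life α x) {i : ℤ}
    (hi : 1 ≤ (spineCount α ε x : ℤ) + i) (m : ℕ) :
    shiftΔ α x ε i m = mass x (sibWord α x (sibLevel α ε x i) m) /
      mass x (spine α x (sibLevel α ε x i)) := by
  rw [shiftΔ, h.shift_eq hα hε hl hi, h.chainΔ_succ hα]

lemma Good.isIndex_iff (hα : α < 0) (h : Good α x) (hε : 0 < ε) (i : ℤ) (m : ℕ) :
    IsIndex α x ε i m ↔ IsSibIndex α ε x i m := by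
  rw [IsIndex, IsSibIndex, h.Neps_ne_bot_iff hα hε]
  refine and_congr_right fun hl => ?_
  have h1 : -NepsInt α x ε + 1 ≤ i ↔ 1 ≤ (spineCount α ε x : ℤ) + i := by
    rw [h.NepsInt_eq hα hε hl]
    omega
  rw [h1]
  refine and_congr_right fun hi => ?_
  rw [h.shiftΔ_eq hα hε hl hi, div_pos_iff_of_pos_right (h.mass_spine_pos hα _)]

/-- The powers of the masses of the two spine blocks in `Δ`, `Θ` and `Z` cancel, leaving the mass of
the sibling to the power `α` times the time left. -/
lemma Good.condTime_eq (hα : α < 0) (h : Good α x) (hε : 0 < ε) {i : ℤ} {m : ℕ}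
    (hi : IsSibIndex α ε x i m) :
    condTime α x ε i m = sibTime α x (sibLevel α ε x i) m := by
  obtain ⟨hl, h1, h2⟩ := hi
  rw [condTime, h.shiftΔ_eq hα hε hl h1, h.shift_eq hα hε hl h1, h.chainΘ_succ hα, h.chainZ_eq hα,
    sibTime]
  have hb := h.mass_spine_pos hα (sibLevel α ε x i)
  have hc := h.mass_spine_pos hα (sibLevel α ε x i + 1)
  rw [Real.div_rpow h2.le hb.le, Real.div_rpow hc.le hb.le, Real.rpow_neg hc.le,
    Real.rpow_neg hb.le]
  have hb' := (Real.rpow_pos_of_pos hb α).ne'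
  have hc' := (Real.rpow_pos_of_pos hc α).ne'
  field_simp

lemma measurableSet_isSibIndex (i : ℤ) (m : ℕ) :
    MeasurableSet {x : Realization | IsSibIndex α ε x i m} := by
  refine (measurableSet_le measurable_const measurable_life).inter (MeasurableSet.inter ?_ ?_)
  · exact measurable_spineCount ε (MeasurableSet.of_discrete (s := {n : ℕ | 1 ≤ (n : ℤ) + i}))
  · exact measurableSet_lt measurable_const
      (measurable_of_discrete_index (g := fun x => spineCount α ε x)
        (f := fun N x => mass x (sibWord α x ((N : ℤ) + i - 1).toNat m))
        (fun N => measurable_spineCount ε (measurableSet_singleton N))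
        fun _ => measurable_mass_sibWord _ m)

/-- The time-reversed fragmentation of a block that splits off from the spine, as a function of the
re-centered index. -/
def shiftPath (α ε : ℝ) (x : Realization) (i : ℤ) (m : ℕ) : ℝ≥0 → ℕ → ℝ :=
  sibPath α x (sibLevel α ε x i) m

lemma measurable_shiftPath (i : ℤ) (m : ℕ) :
    Measurable fun x : Realization => shiftPath α ε x i m :=
  measurable_of_discrete_index (g := fun x => spineCount α ε x)
    (f := fun N x => sibPath α x ((N : ℤ) + i - 1).toNat m)
    (fun N => measurable_spineCount ε (measurableSet_singleton N)) fun _ => measurable_sibPath _ m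

/-- The time left to a block that splits off from the spine, as a function of the re-centered
index. -/
def shiftTime (α ε : ℝ) (x : Realization) (i : ℤ) (m : ℕ) : ℝ :=
  sibTime α x (sibLevel α ε x i) m

lemma measurable_shiftTime (i : ℤ) (m : ℕ) :
    Measurable fun x : Realization => shiftTime α ε x i m :=
  measurable_of_discrete_index (g := fun x => spineCount α ε x)
    (f := fun N x => sibTime α x ((N : ℤ) + i - 1).toNat m)
    (fun N => measurable_spineCount ε (measurableSet_singleton N)) fun _ => measurable_sibTime _ m

lemma Good.isRevPath_shiftPath (hα : α < 0) (h : Good α x) {i : ℤ} {m : ℕ}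
    (hi : IsSibIndex α ε x i m) : IsRevPath (shiftTime α ε x i m) (shiftPath α ε x i m) :=
  (h.toSubtree _).isRevPath (h.life_sib_lt hα hi.2.2).le

/-! ### Conditional independence -/

section Law

variable (ν : Measure UnitMassSeq)

/-- The event that the chain lies in `A` and that the elements of `s` are indices of blocks that
split off from the spine. -/
def indexEvent (α ε : ℝ) (s : Finset (ℤ × ℕ)) (A : Set (ℕ → ℝ × ℝ × (ℕ → ℝ))) : Set Realization :=
  {x | spineChain α x ∈ A ∧ ∀ p ∈ s, IsSibIndex α ε x p.1 p.2}

lemma measurableSet_indexEvent (s : Finset (ℤ × ℕ)) {A : Set (ℕ → ℝ × ℝ × (ℕ → ℝ))}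
    (hA : MeasurableSet A) : MeasurableSet (indexEvent α ε s A) := by
  have : indexEvent α ε s A = {x | spineChain α x ∈ A} ∩ ⋂ p ∈ s, {x | IsSibIndex α ε x p.1 p.2} := by
    ext x; simp [indexEvent]
  rw [this]
  exact (measurable_spineChain hA).inter
    (Finset.measurableSet_biInter _ fun p _ => measurableSet_isSibIndex p.1 p.2)

lemma measurableSet_shiftPath_mem (s : Finset (ℤ × ℕ)) {B : ℤ × ℕ → Set (ℝ≥0 → ℕ → ℝ)}
    (hB : ∀ p, MeasurableSet (B p)) :
    MeasurableSet {x : Realization | ∀ p ∈ s, shiftPath α ε x p.1 p.2 ∈ B p} := by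
  have : {x : Realization | ∀ p ∈ s, shiftPath α ε x p.1 p.2 ∈ B p} =
      ⋂ p ∈ s, {x | shiftPath α ε x p.1 p.2 ∈ B p} := by ext; simp
  rw [this]
  exact Finset.measurableSet_biInter _ fun p _ => measurable_shiftPath p.1 p.2 (hB p)

lemma SibChange.mem_indexEvent_iff (hα : α < 0) {n m : ℕ} {x z : Realization}
    (h : SibChange α n m x z) (s : Finset (ℤ × ℕ)) (A : Set (ℕ → ℝ × ℝ × (ℕ → ℝ))) :
    z ∈ indexEvent α ε s A ↔ x ∈ indexEvent α ε s A := by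
  show (_ ∧ _) ↔ (_ ∧ _)
  rw [← h.good.chain_eq hα, ← h.good'.chain_eq hα, h.chain_eq hα]
  simp only [IsSibIndex, sibLevel, h.spineCount_eq hα, h.life_eq hα, h.mass_sibWord_eq hα]

variable [IsProbabilityMeasure ν]

lemma lintegral_shiftPath (hα : α < 0) (hν : ν {s | (s : ℕ → ℝ) = oneState} = 0)
    (s : Finset (ℤ × ℕ)) {A : Set (ℕ → ℝ × ℝ × (ℕ → ℝ))} (hA : MeasurableSet A)
    {B : ℤ × ℕ → Set (ℝ≥0 → ℕ → ℝ)} (hB : ∀ p, MeasurableSet (B p)) :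
    ∫⁻ z, (indexEvent α ε s A).indicator 1 z *
        ∏ p ∈ s, (B p).indicator 1 (shiftPath α ε z p.1 p.2) ∂realLaw ν =
      ∫⁻ z, (indexEvent α ε s A).indicator 1 z *
        ∏ p ∈ s, revLaw ν α (shiftTime α ε z p.1 p.2) (B p) ∂realLaw ν := by
  have hE := measurableSet_indexEvent (α := α) (ε := ε) s hA
  have hf := (measurable_one (α := ℝ≥0∞)).indicator hE
  have hN : ∀ N, MeasurableSet {z : Realization | spineCount α ε z = N} :=
    fun N => measurable_spineCount ε (measurableSet_singleton N)
  rw [lintegral_eq_tsum_discrete hN, lintegral_eq_tsum_discrete hN]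
  rotate_left
  · exact hf.mul (Finset.measurable_prod s fun p _ =>
      (measurable_revLaw ν (hB p)).comp (measurable_shiftTime p.1 p.2))
  · exact hf.mul (Finset.measurable_prod s fun p _ =>
      (measurable_one.indicator (hB p)).comp (measurable_shiftPath p.1 p.2))
  -- On `spineCount = N` the re-centred indices become deterministic generations.
  refine tsum_congr fun N => ?_
  set f : Realization → ℝ≥0∞ := fun z => {z | spineCount α ε z = N}.indicator 1 z *
    (indexEvent α ε s A).indicator 1 z with hfdef
  have hfm : Measurable f := (measurable_one.indicator (hN N)).mul hf
  have hf0 : ∀ z, f z ≠ 0 → spineCount α ε z = N ∧ z ∈ indexEvent α ε s A := by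
    intro z hz
    refine ⟨?_, ?_⟩
    · by_contra hne
      exact left_ne_zero_of_mul hz (Set.indicator_of_notMem (by exact hne) _)
    · by_contra hne
      exact right_ne_zero_of_mul hz (Set.indicator_of_notMem hne _)
  set e : ℤ × ℕ → ℕ × ℕ := fun p => (((N : ℤ) + p.1 - 1).toNat, p.2) with he
  have h1 : ∀ (Φ : (ℤ × ℕ) → Realization → ℕ → ℕ → ℝ≥0∞),
      ∫⁻ z, {z | spineCount α ε z = N}.indicator 1 z * ((indexEvent α ε s A).indicator 1 z *
        ∏ p ∈ s, Φ p z (sibLevel α ε z p.1) p.2) ∂realLaw ν =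
      ∫⁻ z, f z * ∏ p ∈ s, Φ p z (e p).1 (e p).2 ∂realLaw ν := by
    intro Φ
    refine lintegral_congr fun z => ?_
    rw [← mul_assoc]
    by_cases hz : f z = 0
    · have hz' := hz
      simp only [hfdef] at hz'
      rw [hz, hz', zero_mul, zero_mul]
    · simp only [he, sibLevel, (hf0 z hz).1, hfdef]
  refine (h1 fun p z n m => (B p).indicator 1 (sibPath α z n m)).trans
    (Eq.trans ?_ (h1 fun p z n m => revLaw ν α (sibTime α z n m) (B p)).symm)
  -- `toNat` is injective only on the generations with `1 ≤ N + i`; if some index violates this, the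
  -- event is empty.
  by_cases hs : ∀ p ∈ s, 1 ≤ (N : ℤ) + p.1
  · refine lintegral_prod_sib ν hα hν s ?_ hB hfm fun p hp => ⟨fun z _ hz => ?_, fun x z h => ?_⟩
    · rintro p hp q hq hpq
      have h2 := hs p hp
      have h3 := hs q hq
      have h4 := congrArg Prod.fst hpq
      have h5 := congrArg Prod.snd hpq
      simp only [he] at h4 h5
      exact Prod.ext (by omega) h5
    · obtain ⟨h2, h3⟩ := hf0 z hz
      have h4 := (h3.2 p hp).2.2
      rw [sibLevel, h2] at h4
      exact h4
    · have h2 := h.mem_indexEvent_iff (ε := ε) hα s A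
      have h3 : (indexEvent α ε s A).indicator (1 : Realization → ℝ≥0∞) z =
          (indexEvent α ε s A).indicator 1 x := by
        by_cases hx : x ∈ indexEvent α ε s A
        · rw [Set.indicator_of_mem hx, Set.indicator_of_mem (h2.2 hx)]
          rfl
        · rw [Set.indicator_of_notMem hx, Set.indicator_of_notMem fun hz => hx (h2.1 hz)]
      simp only [hfdef, h3]
      simp only [Set.indicator, Set.mem_ofPred_eq, h.spineCount_eq hα, Pi.one_apply]
  · have h0 : ∀ z, f z = 0 := by
      intro z
      by_contra hz
      obtain ⟨h2, h3⟩ := hf0 z hz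
      exact hs fun p hp => h2 ▸ (h3.2 p hp).2.1
    simp only [h0, zero_mul]

lemma measure_shiftPath (hα : α < 0) (hν : ν {s | (s : ℕ → ℝ) = oneState} = 0)
    (s : Finset (ℤ × ℕ)) {A : Set (ℕ → ℝ × ℝ × (ℕ → ℝ))} (hA : MeasurableSet A)
    {B : ℤ × ℕ → Set (ℝ≥0 → ℕ → ℝ)} (hB : ∀ p, MeasurableSet (B p)) :
    realLaw ν (indexEvent α ε s A ∩ {x | ∀ p ∈ s, shiftPath α ε x p.1 p.2 ∈ B p}) =
      ∫⁻ x in indexEvent α ε s A, ∏ p ∈ s, revLaw ν α (shiftTime α ε x p.1 p.2) (B p)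
        ∂realLaw ν := by
  have hE := measurableSet_indexEvent (α := α) (ε := ε) s hA
  have hP := measurableSet_shiftPath_mem (α := α) (ε := ε) s hB
  rw [← lintegral_indicator_one (hE.inter hP), ← lintegral_indicator hE]
  refine Eq.trans ?_ ((lintegral_shiftPath (ε := ε) ν hα hν s hA hB).trans ?_)
  · refine lintegral_congr fun z => ?_
    by_cases hz : z ∈ indexEvent α ε s A
    · by_cases hz' : ∀ p ∈ s, shiftPath α ε z p.1 p.2 ∈ B p
      · rw [Set.indicator_of_mem (by exact ⟨hz, hz'⟩), Set.indicator_of_mem hz,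
          Finset.prod_congr rfl fun p hp => Set.indicator_of_mem (hz' p hp) _]
        simp
      · rw [Set.indicator_of_notMem fun hh => hz' hh.2]
        push Not at hz'
        obtain ⟨p, hp, hpB⟩ := hz'
        rw [Finset.prod_eq_zero hp (Set.indicator_of_notMem hpB _), mul_zero]
    · rw [Set.indicator_of_notMem hz, Set.indicator_of_notMem fun hh => hz hh.1, zero_mul]
  · refine lintegral_congr fun z => ?_
    by_cases hz : z ∈ indexEvent α ε s A
    · rw [Set.indicator_of_mem hz, Set.indicator_of_mem hz, Pi.one_apply, one_mul]
    · rw [Set.indicator_of_notMem hz, Set.indicator_of_notMem hz, zero_mul]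

variable {Ω : Type*} [MeasurableSpace Ω] {P : Measure Ω} {X : Ω → Realization}

lemma condRevLaw_eq (hα : α < 0) (hν : ν {s | (s : ℕ → ℝ) = oneState} = 0)
    (hX : MeasurePreserving X P (realLaw ν)) (c : ℝ) {B : Set (ℝ≥0 → ℕ → ℝ)}
    (hB : MeasurableSet B) : condRevLaw P X α c B = revLaw ν α c B := by
  have hgood := hX.quasiMeasurePreserving.ae (ae_good ν hα hν)
  have hs1 : MeasurableSet {y : Realization | life α y < c} :=
    measurableSet_lt measurable_life measurable_const
  have hs2 : MeasurableSet {y : Realization | revPath α y c ∈ B} :=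
    measurable_revPath measurable_id measurable_const hB
  have hset : ({ω | extinction α (X ω) < c} : Set Ω) =ᵐ[P] X ⁻¹' {y | life α y < c} := by
    refine eventuallyEq_set.2 ?_
    filter_upwards [hgood] with ω hω
    show extinction α (X ω) < c ↔ life α (X ω) < c
    rw [hω.extinction_eq]
  -- Conditional probabilities depend on the conditioning event only up to null sets, so
  -- `extinction` can be replaced by the measurable `life`.
  have hcond : P[|{ω | extinction α (X ω) < c}] = P[|X ⁻¹' {y | life α y < c}] := by
    rw [ProbabilityTheory.cond, ProbabilityTheory.cond, measure_congr hset,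
      Measure.restrict_congr_set hset]
  rw [condRevLaw, hcond, cond_apply (hX.measurable hs1), revLaw,
    hX.measure_preimage hs1.nullMeasurableSet,
    ← hX.measure_preimage (hs1.inter hs2).nullMeasurableSet]
  rfl

lemma isCondIndepRevFrag_shiftPath (hα : α < 0) (hν : ν {s | (s : ℕ → ℝ) = oneState} = 0)
    (hX : MeasurePreserving X P (realLaw ν)) (hε : 0 < ε) :
    IsCondIndepRevFrag P X α ε fun i m ω => shiftPath α ε (X ω) i m := by
  have hgood := hX.quasiMeasurePreserving.ae (ae_good ν hα hν)
  refine ⟨fun i m => (measurable_shiftPath i m).comp hX.measurable, ?_, fun s A B hA hB => ?_⟩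
  · filter_upwards [hgood] with ω hω i m hi
    rw [hω.isIndex_iff hα hε] at hi
    rw [hω.condTime_eq hα hε hi]
    exact hω.isRevPath_shiftPath hα hi
  · have hE := measurableSet_indexEvent (α := α) (ε := ε) s hA
    have hP := measurableSet_shiftPath_mem (α := α) (ε := ε) s hB
    have h1 : ({ω | chain α (X ω) ∈ A ∧ ∀ p ∈ s, IsIndex α (X ω) ε p.1 p.2 ∧
        shiftPath α ε (X ω) p.1 p.2 ∈ B p} : Set Ω) =ᵐ[P]
        X ⁻¹' (indexEvent α ε s A ∩ {x | ∀ p ∈ s, shiftPath α ε x p.1 p.2 ∈ B p}) := by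
      refine eventuallyEq_set.2 ?_
      filter_upwards [hgood] with ω hω
      show (chain α (X ω) ∈ A ∧ _) ↔ ((spineChain α (X ω) ∈ A ∧ _) ∧ _)
      simp only [hω.chain_eq hα, hω.isIndex_iff hα hε, and_assoc]
      exact and_congr_right fun _ => forall₂_and
    have h2 : ({ω | chain α (X ω) ∈ A ∧ ∀ p ∈ s, IsIndex α (X ω) ε p.1 p.2} : Set Ω) =ᵐ[P]
        X ⁻¹' indexEvent α ε s A := by
      refine eventuallyEq_set.2 ?_
      filter_upwards [hgood] with ω hω
      show (chain α (X ω) ∈ A ∧ _) ↔ (spineChain α (X ω) ∈ A ∧ _)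
      simp only [hω.chain_eq hα, hω.isIndex_iff hα hε]
    have hL : Measurable fun x : Realization =>
        ∏ p ∈ s, revLaw ν α (shiftTime α ε x p.1 p.2) (B p) :=
      Finset.measurable_prod s fun p _ =>
        (measurable_revLaw ν (hB p)).comp (measurable_shiftTime p.1 p.2)
    rw [measure_congr h1, hX.measure_preimage (hE.inter hP).nullMeasurableSet,
      measure_shiftPath ν hα hν s hA hB, Measure.restrict_congr_set h2,
      ← hX.setLIntegral_comp_preimage hE hL]
    refine setLIntegral_congr_fun_ae (hX.measurable hE) ?_
    filter_upwards [hgood] with ω hω hωE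
    refine Finset.prod_congr rfl fun p hp => ?_
    rw [condRevLaw_eq ν hα hν hX _ (hB p), hω.condTime_eq hα hε (hωE.2 p hp)]
    rfl

end Law

end

section

variable {α ε : ℝ} {x : Realization}

/-! ### The decomposition of the state along the spine -/

lemma encard_setOf_sum {β γ : Type*} (p : β ⊕ γ → Prop) :
    {q | p q}.encard = {b | p (.inl b)}.encard + {c | p (.inr c)}.encard := by
  have h : {q | p q} = Sum.inl '' {b | p (.inl b)} ∪ Sum.inr '' {c | p (.inr c)} := by
    ext q
    rcases q with b | c <;> simp
  rw [h, Set.encard_union_eq, Sum.inl_injective.encard_image, Sum.inr_injective.encard_image]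
  rw [Set.disjoint_left]
  rintro _ ⟨b, -, rfl⟩ ⟨c, -, hc⟩
  cases hc

/-- A word incomparable with the spine block follows the spine up to some generation `j < n` and
then takes a letter other than the best child, which leads to a sibling. -/
lemma exists_sibWord_suffix {n : ℕ} {u : List ℕ} (h1 : ¬ spine α x n <:+ u)
    (h2 : ¬ u <:+ spine α x n) : ∃ j < n, ∃ m w, w ++ sibWord α x j m = u := by
  induction n with
  | zero => exact absurd (List.nil_suffix) h1
  | succ n ih =>
    by_cases h : spine α x n <:+ u
    · obtain ⟨w, rfl⟩ := h
      rcases w.eq_nil_or_concat with rfl | ⟨w, i, rfl⟩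
      · exact absurd (spine_suffix α x n.le_succ) h2
      · have hi : i ≠ best α (subtree (spine α x n) x) := by
          rintro rfl
          exact h1 ⟨w, by simp [spine]⟩
        obtain ⟨m, hm⟩ := exists_sibIdx hi
        exact ⟨n, n.lt_succ_self, m, w, by simp [sibWord, hm]⟩
    · obtain ⟨j, hj, hjw⟩ := ih h fun hu => h2 (hu.trans (spine_suffix α x n.le_succ))
      exact ⟨j, hj.trans n.lt_succ_self, hjw⟩

lemma append_sibWord_injective {n m n' m' : ℕ} {w w' : List ℕ}
    (h : w ++ sibWord α x n m = w' ++ sibWord α x n' m') : n = n' ∧ m = m' ∧ w = w' := by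
  have hs : (n, m) = (n', m') := by
    by_contra hne
    rcases List.suffix_or_suffix_of_suffix (List.suffix_append w _)
      (h ▸ List.suffix_append w' (sibWord α x n' m')) with hh | hh
    · exact not_sibWord_suffix_sibWord hne hh
    · exact not_sibWord_suffix_sibWord (Ne.symm hne) hh
  obtain ⟨rfl, rfl⟩ := Prod.mk.inj hs
  exact ⟨rfl, rfl, List.append_cancel_right h⟩

/-- In the units of the sibling, going back `(life α x - t) * m ^ α` from `sibTime` leads to the
time `(t - birth) * m ^ α` of its own fragmentation, whose blocks are the descendants present at
`t`. -/
lemma encard_alive_sib {t : ℝ} {n m : ℕ} (ht : spineTime α x (n + 1) ≤ t)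
    (htl : t ≤ life α x) {y : ℝ} (hy : 0 ≤ y) :
    {w | Alive α x t (w ++ sibWord α x n m) ∧ y < mass x (w ++ sibWord α x n m)}.encard =
      {l | y < mass x (sibWord α x n m) * sibPath α x n m
        ((life α x - t) * mass x (sibWord α x n m) ^ α).toNNReal l}.encard := by
  set v := sibWord α x n m with hv
  -- A sibling without mass contributes nothing on either side; `sibPath` is then multiplied by
  -- zero.
  rcases (mass_nonneg x v).eq_or_lt with h0 | hpos
  · have h1 : {w | Alive α x t (w ++ v) ∧ y < mass x (w ++ v)} = ∅ := by
      refine Set.eq_empty_of_forall_notMem fun w hw => ?_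
      exact (mass_pos_of_append hw.1.1).ne h0
    have h2 : {l : ℕ | y < mass x v * sibPath α x n m
        ((life α x - t) * mass x v ^ α).toNNReal l} = ∅ := by
      refine Set.eq_empty_of_forall_notMem fun l hl => ?_
      have hl' : y < mass x v * _ := hl
      rw [← h0, zero_mul] at hl'
      exact absurd hl' (not_lt.2 hy)
    rw [h1, h2, Set.encard_empty, Set.encard_empty]
  · have hp : 0 < mass x v ^ α := Real.rpow_pos_of_pos hpos _
    have hr : (((life α x - t) * mass x v ^ α).toNNReal : ℝ) = (life α x - t) * mass x v ^ α :=
      Real.coe_toNNReal _ (mul_nonneg (sub_nonneg.2 htl) hp.le)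
    have hle : (life α x - t) * mass x v ^ α ≤ sibTime α x n m := by
      rw [sibTime, ← hv, mul_comm]
      exact mul_le_mul_of_nonneg_left (by linarith) hp.le
    have hsub : sibTime α x n m - (life α x - t) * mass x v ^ α =
        (t - birth α x v) * mass x v ^ α := by
      rw [sibTime, ← hv, hv, birth_sibWord]
      ring
    rw [sibPath, revPath, hr, if_pos hle, hsub, ← hv]
    have h1 : {l | y < mass x v * frag α (subtree v x) ((t - birth α x v) * mass x v ^ α) l} =
        {l | y / mass x v < frag α (subtree v x) ((t - birth α x v) * mass x v ^ α) l} := by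
      ext l
      exact (div_lt_iff₀' hpos).symm
    rw [h1]
    unfold frag
    rw [encard_lt_decRearr (M := 1) (fun u => mass_le_one _ _) (div_nonneg hy hpos.le),
      encard_subtype_and (Alive α (subtree v x) ((t - birth α x v) * mass x v ^ α))
        (fun u => y / mass x v < mass (subtree v x) u)]
    congr 1
    ext w
    show (_ ∧ _) ↔ (_ ∧ _)
    rw [alive_append_iff hpos, mass_append, div_lt_iff₀' hpos]

lemma Good.prodΘ_eq (hα : α < 0) (h : Good α x) {k : ℤ} {n : ℕ}
    (hn : NepsInt α x ε + k = n) : prodΘ α x ε k = mass x (spine α x n) := by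
  rw [prodΘ, ← h.prod_chainΘ hα, show (NepsInt α x ε + k + 1).toNat = n + 1 by omega]

lemma Good.Reps_eq (hα : α < 0) (h : Good α x) {k : ℤ} {n : ℕ}
    (hn : NepsInt α x ε + k = n) : Reps α x ε k = ε⁻¹ * (life α x - spineTime α x n) := by
  rw [Reps, ← h.prod_chainY hα, show (NepsInt α x ε + k + 1).toNat = n + 1 by omega]

lemma Good.le_Reps_iff (hα : α < 0) (h : Good α x) (hε : 0 < ε) {k : ℤ} {n : ℕ}
    (hn : NepsInt α x ε + k = n) {t : ℝ} :
    t ≤ Reps α x ε k ↔ spineTime α x n ≤ life α x - ε * t := by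
  rw [h.Reps_eq hα hn, le_inv_mul_iff₀ hε]
  constructor <;> intro h <;> linarith

/-- With `n = N_ε + k`, the two inequalities say that `ζ - ε t` lies in the lifetime `[T_n,
T_{n+1})` of the `n`-th spine block; these intervals partition `[0, ζ)`. -/
lemma Good.existsUnique_Reps (hα : α < 0) (h : Good α x) (hε : 0 < ε) {t : ℝ} (h0 : 0 < t)
    (ht : t ≤ life α x / ε) : ∃! k : ℤ, -NepsInt α x ε ≤ k ∧ t ≤ Reps α x ε k ∧
      Reps α x ε (k + 1) < t := by
  have ht' : ε * t ≤ life α x := by rwa [le_div_iff₀' hε] at ht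
  have hpos : 0 < ε * t := mul_pos hε h0
  obtain ⟨n, hn⟩ := h.exists_spineTime hα (t := life α x - ε * t) (by linarith) (by linarith)
  refine ⟨n - NepsInt α x ε, ⟨by omega, ?_, ?_⟩, ?_⟩
  · exact (h.le_Reps_iff hα hε (n := n) (by ring)).2 hn.1
  · rw [← not_le, h.le_Reps_iff hα hε (n := n + 1) (by push_cast; ring)]
    exact not_le.2 hn.2
  · rintro k ⟨hk0, hk1, hk2⟩
    obtain ⟨n', hn'⟩ := Int.eq_ofNat_of_zero_le (show 0 ≤ NepsInt α x ε + k by omega)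
    rw [h.le_Reps_iff hα hε hn'] at hk1
    rw [← not_le, h.le_Reps_iff hα hε (n := n' + 1) (by push_cast; omega), not_le] at hk2
    have := h.spineTime_unique hα hn ⟨hk1, hk2⟩
    omega

/-- Blocks present are labelled injectively by `f`: the spine block, or a sibling `(i, m)` together
with a word `w` below it. For each sibling the words above a given level are as many as the ranks
`l` above it in the rearranged path. -/
lemma Good.frag_eq_decRearr_spineMasses (hα : α < 0) (h : Good α x) (hε : 0 < ε)
    (hl : ε ≤ life α x) {t : ℝ} (h0 : 0 < t) {k : ℤ} (hk : -NepsInt α x ε ≤ k)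
    (h1 : t ≤ Reps α x ε k) (h2 : Reps α x ε (k + 1) < t) :
    frag α x (life α x - ε * t) =
      decRearr (spineMasses α x ε (fun i m => shiftPath α ε x i m) t k) := by
  obtain ⟨n, hn⟩ := Int.eq_ofNat_of_zero_le (show 0 ≤ NepsInt α x ε + k by omega)
  have hpos : 0 < ε * t := mul_pos hε h0
  rw [h.le_Reps_iff hα hε hn] at h1
  rw [← not_le, h.le_Reps_iff hα hε (n := n + 1) (by push_cast; omega), not_le] at h2
  have hspine : Alive α x (life α x - ε * t) (spine α x n) := (h.alive_spine_iff hα).2 ⟨h1, h2⟩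
  have hN := h.NepsInt_eq hα hε hl
  set τ := life α x - ε * t with hτ
  set f : Unit ⊕ ({i : ℤ // -NepsInt α x ε + 1 ≤ i ∧ i ≤ k} × ℕ × List ℕ) → List ℕ :=
    Sum.elim (fun _ => spine α x n) fun p => p.2.2 ++ sibWord α x (sibLevel α ε x p.1) p.2.1
    with hf
  have hlevel : ∀ i : {i : ℤ // -NepsInt α x ε + 1 ≤ i ∧ i ≤ k},
      NepsInt α x ε + (i : ℤ) - 1 = sibLevel α ε x i ∧ sibLevel α ε x i + 1 ≤ n := by
    rintro ⟨i, hi1, hi2⟩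
    rw [sibLevel, ← hN]
    constructor
    · dsimp only
      omega
    · dsimp only
      omega
  have hinj : Function.Injective f := by
    rintro (a | ⟨i, m, w⟩) (b | ⟨i', m', w'⟩) hab
    · rfl
    · exact absurd ⟨w', hab.symm⟩ (not_sibWord_suffix_spine _ _ _)
    · exact absurd ⟨w, hab⟩ (not_sibWord_suffix_spine _ _ _)
    · obtain ⟨e1, e2, e3⟩ := append_sibWord_injective hab
      dsimp only at e1 e2 e3
      have hi : i = i' := Subtype.ext (by have := (hlevel i).1; have := (hlevel i').1; omega)
      rw [hi, e2, e3]
  unfold frag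
  refine decRearr_congr fun y hy => ?_
  rw [encard_subtype_and (Alive α x τ) (fun u => y < mass x u)]
  have himage : {u | Alive α x τ u ∧ y < mass x u} =
      f '' {q | Alive α x τ (f q) ∧ y < mass x (f q)} := by
    ext u
    refine ⟨fun hu => ?_, fun ⟨q, hq, hqu⟩ => hqu ▸ hq⟩
    suffices ∃ q, f q = u by
      obtain ⟨q, rfl⟩ := this
      exact ⟨q, hu, rfl⟩
    by_cases hus : u = spine α x n
    · exact ⟨.inl (), hus.symm⟩
    -- Two distinct blocks present at the same time are incomparable, so such a block hangs from a
    -- sibling that left the spine earlier.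
    · obtain ⟨j, hj, m, w, hw⟩ := exists_sibWord_suffix
        (fun hh => hus (hspine.eq_of_suffix h.clockPos hu.1 hh).symm)
        (fun hh => hus (hu.1.eq_of_suffix h.clockPos hspine hh))
      have hlj : sibLevel α ε x ((j : ℤ) + 1 - NepsInt α x ε) = j := by
        rw [sibLevel, ← hN]
        omega
      -- Siblings of generation `j + 1` split off at the time `T_{j+1}`, whence `i = j + 1 - N_ε`.
      refine ⟨.inr (⟨(j : ℤ) + 1 - NepsInt α x ε, by omega, by omega⟩, m, w), ?_⟩
      rw [hf, Sum.elim_inr, hlj, hw]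
  rw [himage, hinj.encard_image, encard_setOf_sum, encard_setOf_sum]
  congr 1
  · congr 1
    ext a
    show (Alive α x τ (spine α x n) ∧ y < mass x (spine α x n)) ↔ y < prodΘ α x ε k
    rw [h.prodΘ_eq hα hn]
    exact and_iff_right hspine
  · refine encard_sigma_congr
      (fun i => {q : ℕ × List ℕ | Alive α x τ (f (.inr (i, q))) ∧ y < mass x (f (.inr (i, q)))})
      (fun i => {q : ℕ × ℕ | y < spineMasses α x ε (fun i m => shiftPath α ε x i m) t k
        (.inr (i, q))}) fun i => ?_
    refine encard_sigma_congr
      (fun m => {w | Alive α x τ (f (.inr (i, m, w))) ∧ y < mass x (f (.inr (i, m, w)))})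
      (fun m => {l | y < spineMasses α x ε (fun i m => shiftPath α ε x i m) t k
        (.inr (i, m, l))}) fun m => ?_
    obtain ⟨hi1, hi2⟩ := hlevel i
    have hb := h.mass_spine_pos hα (sibLevel α ε x i)
    have hmul : prodΘ α x ε (i - 1) * shiftΔ α x ε i m =
        mass x (sibWord α x (sibLevel α ε x i) m) := by
      rw [h.prodΘ_eq hα (n := sibLevel α ε x i) (by omega),
        h.shiftΔ_eq hα hε hl (by rw [← hN]; omega), mul_div_cancel₀ _ hb.ne']
    have hpow : prodΘ α x ε (i - 1) ^ α * shiftΔ α x ε i m ^ α =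
        mass x (sibWord α x (sibLevel α ε x i) m) ^ α := by
      rw [← hmul, Real.mul_rpow]
      · rw [h.prodΘ_eq hα (n := sibLevel α ε x i) (by omega)]
        exact hb.le
      · rw [h.shiftΔ_eq hα hε hl (by rw [← hN]; omega)]
        exact div_nonneg (mass_nonneg _ _) hb.le
    have hτt : t * ε = life α x - τ := by rw [hτ]; ring
    refine (encard_alive_sib (m := m)
      (((h.strictMono_spineTime hα).monotone hi2).trans h1) (by linarith) hy).trans ?_
    show _ = {l | y < prodΘ α x ε (i - 1) * shiftΔ α x ε i m * shiftPath α ε x i m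
      (t * ε * prodΘ α x ε (i - 1) ^ α * shiftΔ α x ε i m ^ α).toNNReal l}.encard
    rw [mul_assoc (t * ε), hmul, hpow, hτt]
    rfl

end

end Fragmentation

end

/-! ### The spine decomposition -/

theorem mainTheorem6 (α : ℝ) (hα : α < 0)
    (ν : MeasureTheory.Measure Fragmentation.UnitMassSeq) [MeasureTheory.IsProbabilityMeasure ν]
    (hν : ν {s | (s : ℕ → ℝ) = Fragmentation.oneState} = 0)
    {Ω : Type*} [MeasurableSpace Ω] (P : MeasureTheory.Measure Ω)
    [MeasureTheory.IsProbabilityMeasure P]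
    (X : Ω → Fragmentation.Realization)
    (hX : ∀ u, Measurable fun ω => X ω u)
    (hindep : ProbabilityTheory.iIndepFun (fun u ω => X ω u) P)
    (hlaw : ∀ u, P.map (fun ω => X ω u) = (ProbabilityTheory.expMeasure 1).prod ν)
    (ε : ℝ) (hε : 0 < ε) :
    AEMeasurable (fun ω => Fragmentation.chain α (X ω)) P ∧
    (∀ᵐ ω ∂P,
      (Fragmentation.Neps α (X ω) ε ≠ ⊥ ↔ ε ≤ Fragmentation.extinction α (X ω)) ∧
      Fragmentation.Neps α (X ω) ε ≠ ((⊤ : ℕ∞) : WithBot ℕ∞)) ∧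
    ∃ G : ℤ → ℕ → Ω → NNReal → ℕ → ℝ,
      Fragmentation.IsCondIndepRevFrag P X α ε G ∧
      ∀ᵐ ω ∂P, ε ≤ Fragmentation.extinction α (X ω) →
        ∀ t : ℝ, 0 < t → t ≤ Fragmentation.extinction α (X ω) / ε →
          (∃! k : ℤ, -Fragmentation.NepsInt α (X ω) ε ≤ k ∧
            t ≤ Fragmentation.Reps α (X ω) ε k ∧ Fragmentation.Reps α (X ω) ε (k + 1) < t) ∧
          ∀ k : ℤ, -Fragmentation.NepsInt α (X ω) ε ≤ k →
            t ≤ Fragmentation.Reps α (X ω) ε k → Fragmentation.Reps α (X ω) ε (k + 1) < t →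
            Fragmentation.frag α (X ω) (Fragmentation.extinction α (X ω) - ε * t) =
              Fragmentation.decRearr
                (Fragmentation.spineMasses α (X ω) ε (fun i m => G i m ω) t k) := by
  have hXm : Measurable X := measurable_pi_lambda _ hX
  have hmp : MeasurePreserving X P (Fragmentation.realLaw ν) := by
    refine ⟨hXm, ?_⟩
    -- Independence of the nodes with common law `nodeLaw ν` means that `X` has the product law
    -- `realLaw ν`.
    have h1 := (iIndepFun_iff_map_fun_eq_infinitePi_map hX).1 hindep
    rw [funext hlaw] at h1
    exact h1
  have hgood := hmp.quasiMeasurePreserving.ae (Fragmentation.ae_good ν hα hν)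
  -- The chain is only almost surely equal to the measurable `spineChain`; this is why it is
  -- asserted to be almost everywhere measurable.
  refine ⟨⟨fun ω => Fragmentation.spineChain α (X ω),
      Fragmentation.measurable_spineChain.comp hXm, ?_⟩, ?_,
    fun i m ω => Fragmentation.shiftPath α ε (X ω) i m,
    Fragmentation.isCondIndepRevFrag_shiftPath ν hα hν hmp hε, ?_⟩
  · filter_upwards [hgood] with ω hω using hω.chain_eq hα
  · filter_upwards [hgood] with ω hω
    exact ⟨by rw [hω.extinction_eq, hω.Neps_ne_bot_iff hα hε], hω.Neps_ne_top hα hε⟩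
  · filter_upwards [hgood] with ω hω hl t h0 ht
    rw [hω.extinction_eq] at hl ht ⊢
    exact ⟨hω.existsUnique_Reps hα hε h0 ht, fun k hk h1 h2 =>
      hω.frag_eq_decRearr_spineMasses hα hε hl h0 hk h1 h2⟩
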